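/- Let $H=\mathbb{Q}x\oplus\mathbb{Q}y$ with the skew-symmetric form $x\cdot y=1$, let $\mathcal{L}=\bigoplus_{n\ge1}\mathcal{L}(n)$ be the free Lie algebra on $H$, embedded in the tensor algebra of $H$ so that $\mathcal{L}(n)\subset H^{\otimes n}$, and let $\mathfrak{h}_{1,1}(n)$ $(n\ge0)$ be the space of derivations $D$ of $\mathcal{L}$ of degree $n$ (i.e. $D(H)\subset\mathcal{L}(n+1)$) with $D([x,y])=0$. The group $\mathrm{Sp}=\mathrm{Sp}(2,\mathbb{Q})=\mathrm{SL}(2,\mathbb{Q})$ acts on $\mathfrak{h}_{1,1}(n)$ by conjugation; $\mathfrak{h}_{1,1}(n)^{\mathrm{Sp}}$ is the invariant part and $[m]_{\mathrm{Sp}}$ denotes the irreducible representation of highest weight $m$. The Enomoto–Satoh map $ES$ is, on $\mathfrak{h}_{1,1}(n)$, the composite $$\mathfrak{h}_{1,1}(n)\subset H^{\otimes(n+2)}\xrightarrow{K_{12}}H^{\otimes n}\to(H^{\otimes n})_{\mathbb{Z}/n}\cong(H^{\otimes n})^{\mathbb{Z}/n}=\mathfrak{a}_1(n-2),$$ where the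 inclusion is $D\mapsto y\otimes D(x)-x\otimes D(y)$, $K_{12}(u_1\otimes u_2\otimes u_3\otimes\cdots)=(u_1\cdot u_2)\,u_3\otimes\cdots$, and the isomorphism from coinvariants to invariants is the sum over all cyclic permutations (so $ES=0$ for $n=0$). For $k\ge1$ let $\epsilon_{2k}\in\mathfrak{h}_{1,1}(2k)$ be the derivation with $\epsilon_{2k}(x)=\mathrm{ad}(x)^{2k}(y)$ and $\epsilon_{2k}(y)=\sum_{0\le j<k}(-1)^j[\mathrm{ad}(x)^j(y),\mathrm{ad}(x)^{2k-1-j}(y)]$. (i) For every $k\ge1$ there is exactly one $\mathrm{Sp}$-submodule of $\mathfrak{h}_{1,1}(2k)$ isomorphic to $[2k-2]_{\mathrm{Sp}}$; $\epsilon_{2k}$ is a highest weight vector of it, and this submodule lies in the kernel of $ES$. Moreover, for any $\epsilon_0\in\mathfrak{h}_{1,1}(0)$, the map $ES$ vanishes on the Lie algebra $\mathfrak{u}$ generated by $\epsilon_0$ and all $\epsilon_{2k}$, $k\ge1$. (ii) $\dim\mathfrak{h}_{1,1}(10)^{\mathrm{Sp}}=3$, whereas $$\dim\mathrm{Ker}\left(\mathfrak{h}_{1,1}(10)^{\mathrm{Sp}}\xrightarrow{[\epsilon_4,\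 ]}\mathfrak{h}_{1,1}(14)\xrightarrow{ES}\mathfrak{a}_1(12)\right)=1.$$ Consequently any nonzero $\sigma\in\mathfrak{h}_{1,1}(10)^{\mathrm{Sp}}$ with $[\epsilon_4,\sigma]\in\mathfrak{u}$ (in particular any nonzero $\sigma$ that normalizes $\mathfrak{u}$, such as the image $\tilde\sigma_5$ of the Galois-theoretic generator $\sigma_5$) is characterized, up to a scalar, by the condition $ES([\epsilon_4,\sigma])=0$: for $v\in\mathfrak{h}_{1,1}(10)^{\mathrm{Sp}}$ one has $ES([\epsilon_4,v])=0$ if and only if $v\in\mathbb{Q}\sigma$. -/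

import Mathlib

/-! # The genus one symplectic derivation Lie algebra and the Enomoto-Satoh map

`H = ℚ x ⊕ ℚ y` with intersection form `x · y = 1 = - y · x`; the basis vector `x` has index `0`
and `y` has index `1`. -/

noncomputable section

namespace GenusOne

open scoped Matrix

/-! ## The free Lie algebra on `H` and its derivations -/

/-- The free Lie algebra `𝓛` generated by `H = ℚ x ⊕ ℚ y`. -/
abbrev L : Type := FreeLieAlgebra ℚ (Fin 2)

/-- The generator `x`. -/
def x : L := FreeLieAlgebra.of ℚ 0

/-- The generator `y`. -/
def y : L := FreeLieAlgebra.of ℚ 1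

/-- The part `𝓛(n)` of degree `n`: `𝓛(1) = H` and `𝓛(n + 1) = [H, 𝓛(n)]`. -/
def freeLieDeg : ℕ → Submodule ℚ L
  | 0 => ⊥
  | 1 => Submodule.span ℚ (Set.range (FreeLieAlgebra.of ℚ))
  | n + 2 => Submodule.span ℚ
      {c | ∃ i : Fin 2, ∃ a ∈ freeLieDeg (n + 1), c = ⁅FreeLieAlgebra.of ℚ i, a⁆}

/-- The Lie algebra of all derivations of `𝓛` (the bracket is the commutator). -/
abbrev Der : Type := LieDerivation ℚ L L

/-- `𝔥_{1,1}(n)`: the symplectic derivations of `𝓛` of degree `n`, that is the derivations which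
kill the symplectic element `ω₀ = [x, y]` and map `H = 𝓛(1)` into `𝓛(n + 1)`. -/
def hDeg (n : ℕ) : Submodule ℚ Der where
  carrier := {D | D ⁅x, y⁆ = 0 ∧ ∀ i : Fin 2, D (FreeLieAlgebra.of ℚ i) ∈ freeLieDeg (n + 1)}
  zero_mem' := ⟨rfl, fun _ => (freeLieDeg (n + 1)).zero_mem⟩
  add_mem' := by
    rintro D E ⟨hD, hD'⟩ ⟨hE, hE'⟩
    refine ⟨?_, fun i => ?_⟩
    · rw [LieDerivation.add_apply, hD, hE, add_zero]
    · rw [LieDerivation.add_apply]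
      exact add_mem (hD' i) (hE' i)
  smul_mem' := by
    rintro c D ⟨hD, hD'⟩
    refine ⟨?_, fun i => ?_⟩
    · rw [LieDerivation.smul_apply, hD, smul_zero]
    · rw [LieDerivation.smul_apply]
      exact Submodule.smul_mem _ c (hD' i)

/-! ## Derivations with prescribed values on the generators -/

/-- The zero 2-cocycle of `𝓛` with values in the adjoint module. The Lie algebra attached to it is
the semidirect product of `𝓛` with its adjoint module (as an abelian ideal). -/
abbrev zeroCocycle : LieModule.Cohomology.twoCocycle ℚ L L := 0

/-- The homomorphism `𝓛 → 𝓛 ⋉ 𝓛` with `xᵢ ↦ (xᵢ, f xᵢ)`. -/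
def derAux (f : Fin 2 → L) : L →ₗ⁅ℚ⁆ LieAlgebra.ofTwoCocycle zeroCocycle :=
  FreeLieAlgebra.lift ℚ fun i =>
    LieAlgebra.ofProd zeroCocycle (FreeLieAlgebra.of ℚ i, f i)

theorem derAux_of (f : Fin 2 → L) (i : Fin 2) :
    derAux f (FreeLieAlgebra.of ℚ i) =
      LieAlgebra.ofProd zeroCocycle (FreeLieAlgebra.of ℚ i, f i) := by
  rw [derAux, FreeLieAlgebra.lift_of_apply]

/-- The projection of `𝓛 ⋉ 𝓛` to the first factor. -/
def projFst : LieAlgebra.ofTwoCocycle zeroCocycle →ₗ⁅ℚ⁆ L where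
  toFun z := ((LieAlgebra.ofProd zeroCocycle).symm z).1
  map_add' _ _ := rfl
  map_smul' _ _ := rfl
  map_lie' := rfl

theorem derAux_fst (f : Fin 2 → L) (a : L) :
    ((LieAlgebra.ofProd zeroCocycle).symm (derAux f a)).1 = a := by
  have h : projFst.comp (derAux f) = LieHom.id := by
    apply FreeLieAlgebra.hom_ext
    intro i
    rw [LieHom.comp_apply, derAux_of]
    rfl
  exact LieHom.congr_fun h a

/-- The projection of `𝓛 ⋉ 𝓛` to the second factor. -/
def projSnd : LieAlgebra.ofTwoCocycle zeroCocycle →ₗ[ℚ] L where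
  toFun z := ((LieAlgebra.ofProd zeroCocycle).symm z).2
  map_add' _ _ := rfl
  map_smul' _ _ := rfl

theorem projSnd_lie (z w : LieAlgebra.ofTwoCocycle zeroCocycle) :
    projSnd ⁅z, w⁆ =
      ⁅((LieAlgebra.ofProd zeroCocycle).symm z).1, projSnd w⁆ -
        ⁅((LieAlgebra.ofProd zeroCocycle).symm w).1, projSnd z⁆ := by
  have h : projSnd ⁅z, w⁆ =
      (0 : L) + ⁅((LieAlgebra.ofProd zeroCocycle).symm z).1, projSnd w⁆ -
        ⁅((LieAlgebra.ofProd zeroCocycle).symm w).1, projSnd z⁆ := rfl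
  rw [h, zero_add]

/-- The derivation of `𝓛` with prescribed values `f` on the generators. -/
def derLift (f : Fin 2 → L) : Der where
  toLinearMap := projSnd ∘ₗ (derAux f : L →ₗ[ℚ] LieAlgebra.ofTwoCocycle zeroCocycle)
  leibniz' a b := by
    change projSnd (derAux f ⁅a, b⁆) = ⁅a, projSnd (derAux f b)⁆ - ⁅b, projSnd (derAux f a)⁆
    rw [LieHom.map_lie, projSnd_lie, derAux_fst, derAux_fst]

theorem derLift_of (f : Fin 2 → L) (i : Fin 2) : derLift f (FreeLieAlgebra.of ℚ i) = f i := by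
  change projSnd (derAux f (FreeLieAlgebra.of ℚ i)) = f i
  rw [derAux_of]
  rfl

/-! ## The action of `Sp(2, ℚ) = SL(2, ℚ)` -/

/-- `Sp(2, ℚ) = SL(2, ℚ)`. -/
abbrev Sp2 : Type := Matrix.SpecialLinearGroup (Fin 2) ℚ

/-- The automorphism of `𝓛` induced by the linear action of `g` on `H`. -/
def spLie (g : Sp2) : L →ₗ⁅ℚ⁆ L :=
  FreeLieAlgebra.lift ℚ fun j => ∑ i, (g : Matrix (Fin 2) (Fin 2) ℚ) i j • FreeLieAlgebra.of ℚ i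

theorem spLie_one (a : L) : spLie 1 a = a := by
  have h : spLie 1 = LieHom.id := by
    apply FreeLieAlgebra.hom_ext
    intro j
    simp [spLie, Matrix.one_apply]
  rw [h, LieHom.id_apply]

theorem spLie_mul (g h : Sp2) (a : L) : spLie (g * h) a = spLie g (spLie h a) := by
  have e : spLie (g * h) = (spLie g).comp (spLie h) := by
    apply FreeLieAlgebra.hom_ext
    intro j
    simp only [spLie, FreeLieAlgebra.lift_of_apply, LieHom.comp_apply, map_sum, map_smul,
      Matrix.SpecialLinearGroup.coe_mul, Matrix.mul_apply, Finset.sum_smul, Finset.smul_sum,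
      smul_smul]
    rw [Finset.sum_comm]
    simp only [mul_comm]
  rw [e, LieHom.comp_apply]

/-- The action of `Sp(2, ℚ)` on derivations by conjugation, `g · D = g ∘ D ∘ g⁻¹`. -/
def spRep : Representation ℚ Sp2 Der where
  toFun g :=
    { toFun := fun D =>
        { toFun := fun a => spLie g (D (spLie g⁻¹ a))
          map_add' := fun a b => by simp only [map_add]
          map_smul' := fun c a => by simp only [map_smul, RingHom.id_apply]
          leibniz' := fun a b => by
            simp [LieHom.map_lie, ← spLie_mul, spLie_one] }
      map_add' := fun D E => by
        ext a
        exact map_add (spLie g) _ _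
      map_smul' := fun c D => by
        ext a
        exact map_smul (spLie g) _ _ }
  map_one' := by
    ext D a
    change spLie 1 (D (spLie 1⁻¹ a)) = D a
    rw [inv_one, spLie_one, spLie_one]
  map_mul' g h := by
    ext D a
    change spLie (g * h) (D (spLie (g * h)⁻¹ a)) = spLie g (spLie h (D (spLie h⁻¹ (spLie g⁻¹ a))))
    rw [mul_inv_rev, spLie_mul, spLie_mul]

/-- The `Sp`-invariant part `𝔥_{1,1}(n)^Sp`. -/
def hSp (n : ℕ) : Submodule ℚ Der := hDeg n ⊓ spRep.invariants

/-- The torus element `x ↦ t x`, `y ↦ t⁻¹ y`. -/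
def torus (t : ℚˣ) : Sp2 := ⟨!![(t : ℚ), 0; 0, ((t⁻¹ : ℚˣ) : ℚ)], by simp [Matrix.det_fin_two]⟩

/-- The unipotent element `x ↦ x`, `y ↦ y + s x`. -/
def unipotent (s : ℚ) : Sp2 := ⟨!![1, s; 0, 1], by simp [Matrix.det_fin_two]⟩

/-- `v` is a highest weight vector of weight `m` (with respect to `x`). -/
structure IsHighestWeightVector (m : ℕ) (v : Der) : Prop where
  ne_zero : v ≠ 0
  unipotent_fixed : ∀ s : ℚ, spRep (unipotent s) v = v
  torus_weight : ∀ t : ℚˣ, spRep (torus t) v = (t : ℚ) ^ m • v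

/-- `V` is a copy of the irreducible representation `[m]_Sp` (the irreducible representation of
highest weight `m`) inside `𝔥_{1,1}(n)`. -/
structure IsSpSummand (n m : ℕ) (V : Subrepresentation spRep) : Prop where
  le_hDeg : V.toSubmodule ≤ hDeg n
  irreducible : V.toRepresentation.IsIrreducible
  highest_weight : ∃ v ∈ V, IsHighestWeightVector m v

/-! ## The elements `ε_{2k}` and the Lie algebra `𝔲` -/

/-- `adx j = [x, [x, …, [x, y]…]]` with `j` letters `x`. -/
def adx (j : ℕ) : L := (fun a => ⁅x, a⁆)^[j] y

/-- The element `ε_{2k}`, `k ≥ 1`: the derivation with `x ↦ ad(x)^{2k}(y)` and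
`y ↦ ∑_{0 ≤ j < k} (-1)^j [ad(x)^j(y), ad(x)^{2k-1-j}(y)]`. -/
def eps (k : ℕ) : Der :=
  derLift ![adx (2 * k),
    ∑ j ∈ Finset.range k, (-1 : ℚ) ^ j • ⁅adx j, adx (2 * k - 1 - j)⁆]

/-- The Lie algebra `𝔲` generated by a given `ε₀` together with `ε_{2k}` for all `k ≥ 1`. -/
def uLie (ε₀ : Der) : LieSubalgebra ℚ Der :=
  LieSubalgebra.lieSpan ℚ Der (insert ε₀ {D | ∃ k : ℕ, 1 ≤ k ∧ D = eps k})

/-! ## The Enomoto-Satoh map -/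

/-- The tensor algebra of `H`; its degree `n` part is `H^{⊗ n}`, with basis the words of
length `n` in `x` and `y`. -/
abbrev T : Type := FreeAlgebra ℚ (Fin 2)

section

attribute [local instance 100] LieRing.ofAssociativeRing

/-- The embedding `𝓛 ⊂ T`, with `𝓛(n) ⊂ H^{⊗ n}`. -/
def lieToTensor : L →ₗ[ℚ] T :=
  (FreeLieAlgebra.lift ℚ (FreeAlgebra.ι ℚ) : L →ₗ⁅ℚ⁆ T)

end

/-- The inclusion `𝔥_{1,1}(n) ⊂ H ⊗ 𝓛(n + 1) ⊂ H^{⊗ (n + 2)}` given by Poincaré duality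
(`u ⊗ ξ` is the map `v ↦ (v · u) ξ` on `H`): `D ↦ y ⊗ D x - x ⊗ D y`. -/
def derToTensor : Der →ₗ[ℚ] T where
  toFun D := FreeAlgebra.ι ℚ 1 * lieToTensor (D x) - FreeAlgebra.ι ℚ 0 * lieToTensor (D y)
  map_add' D E := by
    simp only [LieDerivation.add_apply, map_add, mul_add]
    abel
  map_smul' c D := by
    simp only [LieDerivation.smul_apply, map_smul, Algebra.mul_smul_comm, smul_sub,
      RingHom.id_apply]

/-- The linear endomorphism of `T` with prescribed values on words. -/
def onWords (f : List (Fin 2) → T) : T →ₗ[ℚ] T :=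
  (FreeAlgebra.basisFreeMonoid ℚ (Fin 2)).constr ℚ fun w => f (FreeMonoid.toList w)

/-- The word `u₁ ⊗ ⋯ ⊗ uₙ` in `x` and `y` as an element of `T`. -/
def word (w : List (Fin 2)) : T := (w.map (FreeAlgebra.ι ℚ)).prod

/-- The intersection form on the basis: `x · y = 1`, `y · x = -1`, `x · x = y · y = 0`. -/
def interForm : Matrix (Fin 2) (Fin 2) ℚ := !![0, 1; -1, 0]

/-- The contraction `K₁₂ (u₁ ⊗ u₂ ⊗ u₃ ⊗ ⋯) = (u₁ · u₂) u₃ ⊗ ⋯` (and `0` in degrees `< 2`). -/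
def contract12 : T →ₗ[ℚ] T :=
  onWords fun w => match w with
    | a :: b :: v => interForm a b • word v
    | _ => 0

/-- The composite `H^{⊗ n} → (H^{⊗ n})_{ℤ/n} ≅ (H^{⊗ n})^{ℤ/n}` of the projection to the cyclic
coinvariants and the isomorphism with the cyclic invariants: the sum of all `n` rotations. -/
def cyclicSum : T →ₗ[ℚ] T :=
  onWords fun w => ∑ i ∈ Finset.range w.length, word (w.rotate i)

/-- The Enomoto-Satoh map: on `𝔥_{1,1}(n)` it is the composite
`𝔥_{1,1}(n) ⊂ H^{⊗ (n + 2)} → H^{⊗ n} → (H^{⊗ n})_{ℤ/n} ≅ (H^{⊗ n})^{ℤ/n} = 𝔞₁(n - 2)`. -/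
def ES : Der →ₗ[ℚ] T := cyclicSum ∘ₗ contract12 ∘ₗ derToTensor

end GenusOne

end

/-! # Symplectic derivations of genus one and the Enomoto–Satoh map

A derivation `D` of degree `n` is determined by the tensor `derToTensor D` of degree `n + 2`, and
everything is expressed through the coefficients of this tensor on words in `x` and `y`. Since `D`
kills `ω₀ = [x, y]`, they are invariant under cyclic rotation (`coeff_rotate_derToTensor`). Since
`D x` and `D y` are Lie elements, they satisfy the shuffle relations (`sum_shuffle_lieToTensor`) and
are invariant up to sign under reversal (`coeff_reverse_lieToTensor`).

*The submodule generated by `ε₂ₖ`.* A tensor of weight `2k - 2` and degree `2k + 2` involves only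
words with two letters `y`, which can be rotated to begin with `y`. A Lie element of degree one in
`y` has a single parameter, hence this weight space is `ℚ ε₂ₖ` (`exists_eq_smul_eps`), and there are
no weights below `-(2k - 2)`. The orbit of `ε₂ₖ` under the lower unipotent subgroup is therefore a
polynomial of degree `2k - 2` with values in derivations; its coefficients span a submodule, on
which the upper unipotent elements act by explicit binomial coefficients, and this gives
irreducibility.

*The map `ES` on `𝔲`.* Up to sign `ES D` is the divergence `∑ᵢ ∂ᵢ (D xᵢ)` modulo commutators, where
`∂ᵢ` is the Fox derivative. The divergence is a cocycle (`ES_lie`), and the kernel of `cyclicSum`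
(commutators and constants) is stable under derivations of the tensor algebra. Hence the kernel of
`ES` is closed under brackets; the divergence of `ε₂ₖ` is a telescoping sum (`ES_eps`).

*The invariants of degree ten.* The coefficients of such a derivation live on the words with six
letters `x` and six letters `y`, which form 35 classes under rotation, reversal and the exchange of
`x` and `y`. Annihilation by the raising operator and the shuffle relations leave three parameters
(`classCoeff_eq`). Conversely, joining the roots of two trees by an edge gives a symplectic
derivation (`treeDer`). Starting from `ω₀ — ω₀`, bracketing with `ω₀` and contracting pairs of
letters produces invariant derivations (`invariantDer`), three of which have linearly independent
parameters.

*The kernel of `ES ∘ [ε₄, ]`.* Because `ES ε₄ = 0`, the element `ES [ε₄, D]` is the class modulo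
commutators of the derivation `ε₄` applied to the divergence of `D`. If the parameters of `D` are
proportional to `(1, -7, -3)`, then this divergence is a multiple of `ω₀⁵` modulo commutators, and
`ε₄` kills `ω₀`. Two coefficients of `ES [ε₄, D]` show that there are no other solutions. An
element `σ` with `[ε₄, σ] ∈ 𝔲` lies in this line by the vanishing of `ES` on `𝔲`. -/

noncomputable section

namespace GenusOne

/-! ### Words and coefficients in the tensor algebra -/

theorem basisFreeMonoid_eq_word (w : List (Fin 2)) :
    FreeAlgebra.basisFreeMonoid ℚ (Fin 2) (FreeMonoid.ofList w) = word w := by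
  change FreeAlgebra.equivMonoidAlgebraFreeMonoid.symm (MonoidAlgebra.single _ (1 : ℚ)) = _
  change MonoidAlgebra.lift ℚ _ _ (FreeMonoid.lift (FreeAlgebra.ι ℚ))
    (MonoidAlgebra.single _ (1 : ℚ)) = _
  rw [MonoidAlgebra.lift_single, one_smul, FreeMonoid.lift_apply]
  rfl

/-- The coefficient of the word `w` in a tensor. -/
def coeff (w : List (Fin 2)) : T →ₗ[ℚ] ℚ :=
  (FreeAlgebra.basisFreeMonoid ℚ (Fin 2)).coord (FreeMonoid.ofList w)

theorem coeff_word (w v : List (Fin 2)) : coeff w (word v) = if v = w then 1 else 0 := by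
  classical
  rw [coeff, ← basisFreeMonoid_eq_word, Module.Basis.coord_apply, Module.Basis.repr_self,
    Finsupp.single_apply]
  exact if_congr Iff.rfl rfl rfl

theorem ext_coeff {s t : T} (h : ∀ w, coeff w s = coeff w t) : s = t :=
  (FreeAlgebra.basisFreeMonoid ℚ (Fin 2)).ext_elem fun w => h w

theorem linearMap_ext_word {M : Type*} [AddCommMonoid M] [Module ℚ M] {f g : T →ₗ[ℚ] M}
    (h : ∀ w, f (word w) = g (word w)) : f = g :=
  (FreeAlgebra.basisFreeMonoid ℚ (Fin 2)).ext fun w => by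
    have := h (FreeMonoid.toList w)
    rwa [← basisFreeMonoid_eq_word] at this

theorem onWords_word (f : List (Fin 2) → T) (w : List (Fin 2)) : onWords f (word w) = f w := by
  rw [onWords, ← basisFreeMonoid_eq_word, Module.Basis.constr_basis]
  rfl

@[simp]
theorem word_nil : word [] = 1 := rfl

@[simp]
theorem word_cons (i : Fin 2) (w : List (Fin 2)) :
    word (i :: w) = FreeAlgebra.ι ℚ i * word w := by
  simp [word]

theorem word_append (v w : List (Fin 2)) : word (v ++ w) = word v * word w := by
  simp [word]

/-- Words span the tensor algebra. -/
theorem mem_span_word (t : T) : t ∈ Submodule.span ℚ (Set.range word) := by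
  have h := (FreeAlgebra.basisFreeMonoid ℚ (Fin 2)).mem_span t
  have e : Set.range (FreeAlgebra.basisFreeMonoid ℚ (Fin 2)) = Set.range word := by
    ext z
    exact ⟨fun ⟨w, hw⟩ => ⟨FreeMonoid.toList w, by rw [← hw, ← basisFreeMonoid_eq_word]; rfl⟩,
      fun ⟨w, hw⟩ => ⟨FreeMonoid.ofList w, by rw [← hw, basisFreeMonoid_eq_word]⟩⟩
  rwa [e] at h

theorem word_induction {p : T → Prop} (t : T) (hw : ∀ w, p (word w))
    (hadd : ∀ s t, p s → p t → p (s + t)) (hsmul : ∀ (c : ℚ) t, p t → p (c • t)) : p t := by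
  have h0 : p 0 := by simpa using hsmul 0 _ (hw [])
  induction mem_span_word t using Submodule.span_induction with
  | mem z hz => obtain ⟨w, rfl⟩ := hz; exact hw w
  | zero => exact h0
  | add a b _ _ ha hb => exact hadd a b ha hb
  | smul c a _ ha => exact hsmul c a ha

theorem coeff_nil_ι_mul (i : Fin 2) (t : T) : coeff [] (FreeAlgebra.ι ℚ i * t) = 0 := by
  induction t using word_induction with
  | hw w => rw [← word_cons, coeff_word, if_neg (by simp)]
  | hadd s t hs ht => rw [mul_add, map_add, hs, ht, add_zero]
  | hsmul c t ht => rw [mul_smul_comm, map_smul, ht, smul_zero]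

theorem coeff_nil_mul_ι (i : Fin 2) (t : T) : coeff [] (t * FreeAlgebra.ι ℚ i) = 0 := by
  induction t using word_induction with
  | hw w =>
    rw [show word w * FreeAlgebra.ι ℚ i = word (w ++ [i]) by simp [word_append],
      coeff_word, if_neg (by simp)]
  | hadd s t hs ht => rw [add_mul, map_add, hs, ht, add_zero]
  | hsmul c t ht => rw [smul_mul_assoc, map_smul, ht, smul_zero]

theorem coeff_cons_ι_mul (i j : Fin 2) (w : List (Fin 2)) (t : T) :
    coeff (j :: w) (FreeAlgebra.ι ℚ i * t) = if i = j then coeff w t else 0 := by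
  induction t using word_induction with
  | hw v =>
    rw [← word_cons, coeff_word, coeff_word]
    by_cases h : i = j <;> simp [h]
  | hadd s t hs ht => rw [mul_add, map_add, hs, ht, map_add]; split_ifs <;> simp
  | hsmul c t ht => rw [mul_smul_comm, map_smul, ht, map_smul]; split_ifs <;> simp

theorem coeff_concat_mul_ι (i j : Fin 2) (w : List (Fin 2)) (t : T) :
    coeff (w ++ [j]) (t * FreeAlgebra.ι ℚ i) = if i = j then coeff w t else 0 := by
  induction t using word_induction with
  | hw v =>
    rw [show word v * FreeAlgebra.ι ℚ i = word (v ++ [i]) by simp [word_append],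
      coeff_word, coeff_word]
    by_cases h : i = j <;> simp [h]
  | hadd s t hs ht => rw [add_mul, map_add, hs, ht, map_add]; split_ifs <;> simp
  | hsmul c t ht => rw [smul_mul_assoc, map_smul, ht, map_smul]; split_ifs <;> simp

theorem coeff_one (w : List (Fin 2)) : coeff w (1 : T) = if w = [] then 1 else 0 := by
  rw [← word_nil, coeff_word]
  simp [eq_comm]

/-- The left Fox derivative: `∂ᵢ` keeps the words beginning with the letter `i` and strips
that letter, so that `t = t₀ + ∑ᵢ xᵢ ∂ᵢ t` with `t₀` the constant term. -/
def strip (i : Fin 2) : T →ₗ[ℚ] T :=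
  onWords fun w => match w with
    | [] => 0
    | j :: v => if j = i then word v else 0

theorem strip_one (i : Fin 2) : strip i (1 : T) = 0 := by
  rw [← word_nil, strip, onWords_word]

theorem strip_ι_mul (i j : Fin 2) (t : T) :
    strip i (FreeAlgebra.ι ℚ j * t) = if j = i then t else 0 := by
  induction t using word_induction with
  | hw v => rw [← word_cons, strip, onWords_word]
  | hadd s t hs ht => rw [mul_add, map_add, hs, ht]; split_ifs <;> simp
  | hsmul c t ht => rw [mul_smul_comm, map_smul, ht]; split_ifs <;> simp

theorem coeff_strip (i : Fin 2) (w : List (Fin 2)) (t : T) :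
    coeff w (strip i t) = coeff (i :: w) t := by
  induction t using word_induction with
  | hw v =>
    cases v with
    | nil => rw [word_nil, strip_one, coeff_one]; simp
    | cons j v =>
      rw [word_cons, strip_ι_mul, coeff_cons_ι_mul]
      split_ifs <;> simp
  | hadd s t hs ht => simp only [map_add, hs, ht]
  | hsmul c t ht => simp only [map_smul, ht]

theorem sum_ι_mul_strip (t : T) (h : coeff [] t = 0) :
    FreeAlgebra.ι ℚ 0 * strip 0 t + FreeAlgebra.ι ℚ 1 * strip 1 t = t := by
  apply ext_coeff
  rintro (_ | ⟨i, w⟩)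
  · rw [map_add, coeff_nil_ι_mul, coeff_nil_ι_mul, h, add_zero]
  · rw [map_add, coeff_cons_ι_mul, coeff_cons_ι_mul]
    fin_cases i <;> simp [coeff_strip]

/-! ### The free Lie algebra inside the tensor algebra -/

section

attribute [local instance 100] LieRing.ofAssociativeRing

theorem lieToTensor_of (i : Fin 2) :
    lieToTensor (FreeLieAlgebra.of ℚ i) = FreeAlgebra.ι ℚ i :=
  FreeLieAlgebra.lift_of_apply (L := T) (FreeAlgebra.ι ℚ) i

theorem lieToTensor_lie (a b : L) :
    lieToTensor ⁅a, b⁆ = lieToTensor a * lieToTensor b - lieToTensor b * lieToTensor a := by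
  have h := LieHom.map_lie (FreeLieAlgebra.lift ℚ (L := T) (FreeAlgebra.ι ℚ)) a b
  rw [LieRing.of_associative_ring_bracket] at h
  exact h

end

theorem lieSpan_range_of :
    LieSubalgebra.lieSpan ℚ L (Set.range (FreeLieAlgebra.of ℚ)) = ⊤ := by
  set S := LieSubalgebra.lieSpan ℚ L (Set.range (FreeLieAlgebra.of ℚ (X := Fin 2)))
  let f : L →ₗ⁅ℚ⁆ S := FreeLieAlgebra.lift ℚ fun i =>
    ⟨FreeLieAlgebra.of ℚ i, LieSubalgebra.subset_lieSpan ⟨i, rfl⟩⟩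
  have h : S.incl.comp f = LieHom.id := by
    apply FreeLieAlgebra.hom_ext
    intro i
    simp [f]
  rw [eq_top_iff]
  intro a _
  have := LieHom.congr_fun h a
  rw [LieHom.comp_apply, LieHom.id_apply] at this
  rw [← this]
  exact (f a).2

theorem lie_induction {p : L → Prop} (a : L) (hof : ∀ i, p (FreeLieAlgebra.of ℚ i))
    (hadd : ∀ a b, p a → p b → p (a + b)) (hsmul : ∀ (c : ℚ) a, p a → p (c • a))
    (hlie : ∀ a b, p a → p b → p ⁅a, b⁆) : p a := by
  have h : a ∈ LieSubalgebra.lieSpan ℚ L (Set.range (FreeLieAlgebra.of ℚ)) := by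
    rw [lieSpan_range_of]; trivial
  have h0 : p 0 := by simpa using hsmul 0 _ (hof 0)
  induction h using LieSubalgebra.lieSpan_induction with
  | mem z hz => obtain ⟨w, rfl⟩ := hz; exact hof w
  | zero => exact h0
  | add a b _ _ ha hb => exact hadd a b ha hb
  | smul c a _ ha => exact hsmul c a ha
  | lie a b _ _ ha hb => exact hlie a b ha hb

theorem der_ext {D E : Der} (h : ∀ i, D (FreeLieAlgebra.of ℚ i) = E (FreeLieAlgebra.of ℚ i)) :
    D = E :=
  LieDerivation.ext_of_lieSpan_eq_top _ lieSpan_range_of (by rintro _ ⟨i, rfl⟩; exact h i)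

theorem coeff_nil_lieToTensor (a : L) : coeff [] (lieToTensor a) = 0 := by
  have hmul : ∀ s t : T, coeff [] (s * t) = coeff [] s * coeff [] t := by
    intro s t
    induction s using word_induction with
    | hw w =>
      cases w with
      | nil => simp [coeff_one]
      | cons i w => rw [word_cons, mul_assoc, coeff_nil_ι_mul, coeff_nil_ι_mul, zero_mul]
    | hadd a b ha hb => rw [add_mul, map_add, map_add, ha, hb, add_mul]
    | hsmul c a ha => rw [smul_mul_assoc, map_smul, map_smul, ha, smul_mul_assoc]
  induction a using lie_induction with
  | hof i => rw [lieToTensor_of, ← mul_one (FreeAlgebra.ι ℚ i), coeff_nil_ι_mul]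
  | hadd a b ha hb => rw [map_add, map_add, ha, hb, add_zero]
  | hsmul c a ha => rw [map_smul, map_smul, ha, smul_zero]
  | hlie a b ha hb => rw [lieToTensor_lie, map_sub, hmul, hmul, ha, hb]; ring

/-- The adjoint action extended to the tensor algebra: `x₁ ⊗ ⋯ ⊗ xₙ` acts on `𝓛` as
`ad x₁ ∘ ⋯ ∘ ad xₙ`. -/
def adT : T →ₐ[ℚ] Module.End ℚ L :=
  FreeAlgebra.lift ℚ fun i => (LieAlgebra.ad ℚ L (FreeLieAlgebra.of ℚ i) : Module.End ℚ L)

theorem adT_ι (i : Fin 2) (a : L) :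
    adT (FreeAlgebra.ι ℚ i) a = ⁅FreeLieAlgebra.of ℚ i, a⁆ := by
  rw [adT, FreeAlgebra.lift_ι_apply, LieAlgebra.ad_apply]

theorem adT_lieToTensor (a b : L) : adT (lieToTensor a) b = ⁅a, b⁆ := by
  induction a using lie_induction generalizing b with
  | hof i => rw [lieToTensor_of, adT_ι]
  | hadd a a' ha hb => rw [map_add, map_add, LinearMap.add_apply, ha, hb, add_lie]
  | hsmul c a ha => rw [map_smul, map_smul, LinearMap.smul_apply, ha, smul_lie]
  | hlie a a' ha hb =>
    rw [lieToTensor_lie, map_sub, map_mul, map_mul, LinearMap.sub_apply, Module.End.mul_apply,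
      Module.End.mul_apply, ha, hb, ha, hb, lie_lie]

theorem of_mem_freeLieDeg (i : Fin 2) : FreeLieAlgebra.of ℚ i ∈ freeLieDeg 1 :=
  Submodule.subset_span ⟨i, rfl⟩

theorem of_lie_mem_freeLieDeg (i : Fin 2) {n : ℕ} {a : L} (ha : a ∈ freeLieDeg n) :
    ⁅FreeLieAlgebra.of ℚ i, a⁆ ∈ freeLieDeg (n + 1) := by
  cases n with
  | zero =>
    rw [show freeLieDeg 0 = ⊥ from rfl, Submodule.mem_bot] at ha
    rw [ha, lie_zero]
    exact zero_mem _
  | succ n => exact Submodule.subset_span ⟨i, a, ha, rfl⟩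

/-- Induction along right normed brackets. -/
theorem freeLieDeg_induction {p : ℕ → L → Prop} (hof : ∀ i, p 1 (FreeLieAlgebra.of ℚ i))
    (hzero : ∀ n, p n 0)
    (hadd : ∀ n a b, p n a → p n b → p n (a + b)) (hsmul : ∀ n (c : ℚ) a, p n a → p n (c • a))
    (hlie : ∀ n (i : Fin 2) (a : L), a ∈ freeLieDeg n → p n a →
      p (n + 1) ⁅FreeLieAlgebra.of ℚ i, a⁆) :
    ∀ {n : ℕ} {a : L}, a ∈ freeLieDeg n → p n a := by
  intro n
  induction n with
  | zero =>
    intro a ha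
    rw [show freeLieDeg 0 = ⊥ from rfl, Submodule.mem_bot] at ha
    rw [ha]
    exact hzero 0
  | succ n ih =>
    intro a ha
    cases n with
    | zero =>
      induction ha using Submodule.span_induction with
      | mem z hz => obtain ⟨w, rfl⟩ := hz; exact hof w
      | zero => exact hzero _
      | add a b _ _ ha hb => exact hadd _ a b ha hb
      | smul c a _ ha => exact hsmul _ c a ha
    | succ n =>
      induction ha using Submodule.span_induction with
      | mem z hz => obtain ⟨i, a, ha, rfl⟩ := hz; exact hlie _ i a ha (ih ha)
      | zero => exact hzero _
      | add a b _ _ ha hb => exact hadd _ a b ha hb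
      | smul c a _ ha => exact hsmul _ c a ha

theorem lie_mem_freeLieDeg {m n : ℕ} {a b : L} (ha : a ∈ freeLieDeg m) (hb : b ∈ freeLieDeg n) :
    ⁅a, b⁆ ∈ freeLieDeg (m + n) := by
  refine freeLieDeg_induction
    (p := fun m a => ∀ n b, b ∈ freeLieDeg n → ⁅a, b⁆ ∈ freeLieDeg (m + n))
    ?_ ?_ ?_ ?_ ?_ ha n b hb
  · intro i n b hb
    rw [add_comm]
    exact of_lie_mem_freeLieDeg i hb
  · intro m n b hb
    rw [zero_lie]
    exact zero_mem _
  · intro m a a' ha ha' n b hb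
    rw [add_lie]
    exact add_mem (ha n b hb) (ha' n b hb)
  · intro m c a ha n b hb
    rw [smul_lie]
    exact Submodule.smul_mem _ _ (ha n b hb)
  · intro m i a _ ha n b hb
    rw [lie_lie]
    refine sub_mem ?_ ?_
    · rw [show m + 1 + n = m + n + 1 by ring]
      exact of_lie_mem_freeLieDeg i (ha n b hb)
    · rw [show m + 1 + n = m + (n + 1) by ring]
      exact ha _ _ (of_lie_mem_freeLieDeg i hb)

/-- Elements of `𝓛(n)` are combinations of words of length `n`. -/
theorem coeff_lieToTensor_of_length_ne {n : ℕ} {a : L} (ha : a ∈ freeLieDeg n)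
    {w : List (Fin 2)} (hw : w.length ≠ n) : coeff w (lieToTensor a) = 0 := by
  refine freeLieDeg_induction
    (p := fun n a => ∀ w : List (Fin 2), w.length ≠ n → coeff w (lieToTensor a) = 0)
    ?_ ?_ ?_ ?_ ?_ ha w hw
  · intro i w hw
    rw [lieToTensor_of, ← mul_one (FreeAlgebra.ι ℚ i)]
    cases w with
    | nil => exact coeff_nil_ι_mul _ _
    | cons j w =>
      rw [coeff_cons_ι_mul, coeff_one, if_neg (c := w = []), ite_self]
      rintro rfl
      simp at hw
  · intro n w _
    simp
  · intro n a b ha hb w hw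
    rw [map_add, map_add, ha w hw, hb w hw, add_zero]
  · intro n c a ha w hw
    rw [map_smul, map_smul, ha w hw, smul_zero]
  · intro n i a _ ha w hw
    rw [lieToTensor_lie, lieToTensor_of, map_sub]
    have h1 : coeff w (FreeAlgebra.ι ℚ i * lieToTensor a) = 0 := by
      cases w with
      | nil => exact coeff_nil_ι_mul _ _
      | cons j w =>
        rw [coeff_cons_ι_mul, ha w (by rintro rfl; simp at hw), ite_self]
    have h2 : coeff w (lieToTensor a * FreeAlgebra.ι ℚ i) = 0 := by
      rcases List.eq_nil_or_concat w with rfl | ⟨w, j, rfl⟩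
      · exact coeff_nil_mul_ι _ _
      · rw [List.concat_eq_append, coeff_concat_mul_ι,
          ha w (by rintro rfl; simp at hw), ite_self]
    rw [h1, h2, sub_zero]

/-- The Dynkin operator `x₁ ⊗ ⋯ ⊗ xₙ ↦ [x₁, [x₂, …, xₙ]…]`, with value `0` on constants. -/
def dynkin : T →ₗ[ℚ] L :=
  ∑ i : Fin 2, LinearMap.applyₗ (FreeLieAlgebra.of ℚ i) ∘ₗ adT.toLinearMap ∘ₗ
    onWords fun w => if w.getLast? = some i then word w.dropLast else 0

theorem dynkin_ι (i : Fin 2) : dynkin (FreeAlgebra.ι ℚ i) = FreeLieAlgebra.of ℚ i := by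
  have : FreeAlgebra.ι ℚ i = word [i] := by simp
  rw [this, dynkin]
  simp only [LinearMap.sum_apply, LinearMap.comp_apply, onWords_word, List.getLast?_singleton,
    Option.some.injEq]
  fin_cases i <;> simp [Fin.sum_univ_two]

theorem dynkin_word_mul (v w : List (Fin 2)) (hw : w ≠ []) :
    dynkin (word (v ++ w)) = adT (word v) (dynkin (word w)) := by
  simp only [dynkin, LinearMap.sum_apply, LinearMap.comp_apply, onWords_word, map_sum]
  refine Finset.sum_congr rfl fun i _ => ?_
  rw [List.getLast?_append_of_ne_nil _ hw, List.dropLast_append_of_ne_nil hw]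
  split_ifs
  · simp [word_append]
  · simp

theorem dynkin_mul (s t : T) (ht : coeff [] t = 0) : dynkin (s * t) = adT s (dynkin t) := by
  have key : ∀ t : T, dynkin (s * (t - coeff [] t • 1)) = adT s (dynkin (t - coeff [] t • 1)) := by
    intro t
    induction t using word_induction with
    | hw w =>
      cases w with
      | nil => simp [coeff_one]
      | cons i w =>
        rw [coeff_word, if_neg (by simp), zero_smul, sub_zero]
        induction s using word_induction with
        | hw v => rw [← word_append, dynkin_word_mul _ _ (by simp)]
        | hadd a b ha hb => rw [add_mul, map_add, ha, hb, map_add, LinearMap.add_apply]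
        | hsmul c a ha => rw [smul_mul_assoc, map_smul, ha, map_smul, LinearMap.smul_apply]
    | hadd a b ha hb =>
      have : a + b - coeff [] (a + b) • (1 : T) =
          (a - coeff [] a • 1) + (b - coeff [] b • 1) := by
        rw [map_add, add_smul]; abel
      rw [this, mul_add, map_add, ha, hb, map_add, map_add]
    | hsmul c a ha =>
      have : c • a - coeff [] (c • a) • (1 : T) = c • (a - coeff [] a • 1) := by
        rw [map_smul, smul_sub, smul_smul, smul_eq_mul]
      rw [this, mul_smul_comm, map_smul, ha, map_smul, map_smul]
  have := key t
  rwa [ht, zero_smul, sub_zero] at this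

/-- The Dynkin–Specht–Wever identity: the Dynkin operator multiplies `𝓛(n)` by `n`. -/
theorem dynkin_lieToTensor {n : ℕ} {a : L} (ha : a ∈ freeLieDeg n) :
    dynkin (lieToTensor a) = (n : ℚ) • a := by
  refine freeLieDeg_induction (p := fun n a => dynkin (lieToTensor a) = (n : ℚ) • a)
    ?_ ?_ ?_ ?_ ?_ ha
  · intro i
    rw [lieToTensor_of, dynkin_ι]
    simp
  · intro n
    simp
  · intro n a b ha hb
    rw [map_add, map_add, ha, hb, smul_add]
  · intro n c a ha
    rw [map_smul, map_smul, ha, smul_comm]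
  · intro n i a _ ha
    rw [lieToTensor_lie, map_sub, dynkin_mul _ _ (coeff_nil_lieToTensor a), ha, lieToTensor_of,
      dynkin_mul _ _ (by rw [← mul_one (FreeAlgebra.ι ℚ i), coeff_nil_ι_mul]), dynkin_ι, adT_ι,
      adT_lieToTensor, ← lie_skew a (FreeLieAlgebra.of ℚ i), lie_smul]
    push_cast
    module

theorem lieToTensor_injective_on {n : ℕ} {a : L} (ha : a ∈ freeLieDeg n)
    (h : lieToTensor a = 0) : a = 0 := by
  cases n with
  | zero => exact (Submodule.mem_bot ℚ).1 ha
  | succ n =>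
    have e := dynkin_lieToTensor ha
    rw [h, map_zero] at e
    exact (smul_eq_zero.1 e.symm).resolve_left (by positivity)

/-! ### The symplectic group and derivations acting on the tensor algebra -/

/-- The automorphism of the tensor algebra induced by the linear action of `g` on `H`. -/
def spT (g : Sp2) : T →ₐ[ℚ] T :=
  FreeAlgebra.lift ℚ fun j => ∑ i, (g : Matrix (Fin 2) (Fin 2) ℚ) i j • FreeAlgebra.ι ℚ i

theorem spT_ι (g : Sp2) (j : Fin 2) :
    spT g (FreeAlgebra.ι ℚ j) =
      (g : Matrix (Fin 2) (Fin 2) ℚ) 0 j • FreeAlgebra.ι ℚ 0 +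
        (g : Matrix (Fin 2) (Fin 2) ℚ) 1 j • FreeAlgebra.ι ℚ 1 := by
  rw [spT, FreeAlgebra.lift_ι_apply, Fin.sum_univ_two]

theorem spLie_of (g : Sp2) (j : Fin 2) :
    spLie g (FreeLieAlgebra.of ℚ j) =
      (g : Matrix (Fin 2) (Fin 2) ℚ) 0 j • FreeLieAlgebra.of ℚ 0 +
        (g : Matrix (Fin 2) (Fin 2) ℚ) 1 j • FreeLieAlgebra.of ℚ 1 := by
  rw [spLie, FreeLieAlgebra.lift_of_apply, Fin.sum_univ_two]

theorem lieToTensor_spLie (g : Sp2) (a : L) :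
    lieToTensor (spLie g a) = spT g (lieToTensor a) := by
  induction a using lie_induction with
  | hof i =>
    rw [spLie_of, lieToTensor_of, spT_ι, map_add, map_smul, map_smul, lieToTensor_of,
      lieToTensor_of]
  | hadd a b ha hb => simp only [map_add, ha, hb]
  | hsmul c a ha => simp only [map_smul, ha]
  | hlie a b ha hb => rw [LieHom.map_lie, lieToTensor_lie, lieToTensor_lie, ha, hb, map_sub,
      map_mul, map_mul]

theorem spRep_apply (g : Sp2) (D : Der) (a : L) : spRep g D a = spLie g (D (spLie g⁻¹ a)) := rfl

theorem spRep_apply_x (g : Sp2) (D : Der) :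
    spRep g D x = (g : Matrix (Fin 2) (Fin 2) ℚ) 1 1 • spLie g (D x) -
      (g : Matrix (Fin 2) (Fin 2) ℚ) 1 0 • spLie g (D y) := by
  rw [spRep_apply, x, spLie_of, map_add, map_smul, map_smul, map_add, map_smul, map_smul,
    Matrix.SpecialLinearGroup.coe_inv, Matrix.adjugate_fin_two]
  simp [y, sub_eq_add_neg]

theorem spRep_apply_y (g : Sp2) (D : Der) :
    spRep g D y = (g : Matrix (Fin 2) (Fin 2) ℚ) 0 0 • spLie g (D y) -
      (g : Matrix (Fin 2) (Fin 2) ℚ) 0 1 • spLie g (D x) := by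
  rw [spRep_apply, y, spLie_of, map_add, map_smul, map_smul, map_add, map_smul, map_smul,
    Matrix.SpecialLinearGroup.coe_inv, Matrix.adjugate_fin_two]
  simp [x, sub_eq_add_neg, add_comm]

theorem derToTensor_apply (D : Der) : derToTensor D =
    FreeAlgebra.ι ℚ 1 * lieToTensor (D x) - FreeAlgebra.ι ℚ 0 * lieToTensor (D y) := rfl

theorem derToTensor_spRep (g : Sp2) (D : Der) :
    derToTensor (spRep g D) = spT g (derToTensor D) := by
  rw [derToTensor_apply, derToTensor_apply, spRep_apply_x, spRep_apply_y, map_sub, map_sub,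
    map_sub, map_smul, map_smul, map_smul, map_smul, map_mul, map_mul, spT_ι, spT_ι,
    lieToTensor_spLie, lieToTensor_spLie]
  simp only [mul_sub, add_mul, smul_mul_assoc, mul_smul_comm]
  abel

/-- The derivation of the tensor algebra with values `d` on the letters. -/
def derT (d : Fin 2 → T) : T →ₗ[ℚ] T :=
  onWords fun w => w.rec 0 fun i v r => d i * word v + FreeAlgebra.ι ℚ i * r

theorem derT_one (d : Fin 2 → T) : derT d 1 = 0 := by
  rw [← word_nil, derT, onWords_word]

theorem derT_ι_mul (d : Fin 2 → T) (i : Fin 2) (t : T) :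
    derT d (FreeAlgebra.ι ℚ i * t) = d i * t + FreeAlgebra.ι ℚ i * derT d t := by
  induction t using word_induction with
  | hw w => rw [← word_cons, derT, onWords_word, onWords_word]
  | hadd s t hs ht => rw [mul_add, map_add, hs, ht, map_add]; noncomm_ring
  | hsmul c t ht => rw [mul_smul_comm, map_smul, ht, map_smul, smul_add, mul_smul_comm,
      mul_smul_comm]

theorem derT_ι (d : Fin 2 → T) (i : Fin 2) : derT d (FreeAlgebra.ι ℚ i) = d i := by
  have := derT_ι_mul d i 1
  rwa [mul_one, mul_one, derT_one, mul_zero, add_zero] at this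

theorem derT_mul (d : Fin 2 → T) (s t : T) : derT d (s * t) = derT d s * t + s * derT d t := by
  induction s using word_induction with
  | hw w =>
    induction w with
    | nil => rw [word_nil, one_mul, derT_one, zero_mul, zero_add, one_mul]
    | cons i w ih => rw [word_cons, mul_assoc, derT_ι_mul, derT_ι_mul, ih]; noncomm_ring
  | hadd s s' hs hs' => rw [add_mul, map_add, hs, hs', map_add]; noncomm_ring
  | hsmul c s hs =>
    rw [smul_mul_assoc, map_smul, hs, map_smul, smul_add, smul_mul_assoc, smul_mul_assoc]

/-- The values on the letters of the derivation of the tensor algebra which extends `D`. -/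
def derVal (D : Der) (i : Fin 2) : T := lieToTensor (D (FreeLieAlgebra.of ℚ i))

theorem lieToTensor_der (D : Der) (a : L) :
    lieToTensor (D a) = derT (derVal D) (lieToTensor a) := by
  induction a using lie_induction with
  | hof i => rw [lieToTensor_of, derT_ι]; rfl
  | hadd a b ha hb => simp only [map_add, ha, hb]
  | hsmul c a ha => simp only [map_smul, ha]
  | hlie a b ha hb =>
    rw [LieDerivation.apply_lie_eq_add, map_add, lieToTensor_lie, lieToTensor_lie,
      lieToTensor_lie, map_sub, derT_mul, derT_mul, ha, hb]
    abel

/-! ### Cyclic words -/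

theorem sum_rotate_rotate {M : Type*} [AddCommGroup M] (f : List (Fin 2) → M) (w : List (Fin 2))
    (k : ℕ) :
    ∑ i ∈ Finset.range w.length, f ((w.rotate k).rotate i) =
      ∑ i ∈ Finset.range w.length, f (w.rotate i) := by
  induction k with
  | zero => simp
  | succ k ih =>
    rw [← ih]
    have h1 := Finset.sum_range_succ (fun i => f ((w.rotate k).rotate i)) w.length
    have h2 := Finset.sum_range_succ' (fun i => f ((w.rotate k).rotate i)) w.length
    have h3 : (w.rotate k).rotate w.length = (w.rotate k).rotate 0 := by
      conv_lhs => rw [← List.length_rotate w k]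
      rw [List.rotate_length, List.rotate_zero]
    rw [h1, h3] at h2
    rw [add_right_cancel h2]
    refine Finset.sum_congr rfl fun i _ => ?_
    rw [List.rotate_rotate, List.rotate_rotate, add_assoc, add_comm 1 i]

theorem cyclicSum_word (w : List (Fin 2)) :
    cyclicSum (word w) = ∑ i ∈ Finset.range w.length, word (w.rotate i) := onWords_word _ _

theorem cyclicSum_one : cyclicSum (1 : T) = 0 := by
  rw [← word_nil, cyclicSum_word]
  simp

/-- A bilinear identity on the tensor algebra can be checked on words. -/
theorem bilinear_word_induction {M : Type*} [AddCommMonoid M] [Module ℚ M]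
    {f g : T →ₗ[ℚ] T →ₗ[ℚ] M} (h : ∀ v w, f (word v) (word w) = g (word v) (word w)) (s t : T) :
    f s t = g s t := by
  have : f = g := linearMap_ext_word fun v => linearMap_ext_word fun w => h v w
  rw [this]

theorem cyclicSum_mul_comm (s t : T) : cyclicSum (s * t) = cyclicSum (t * s) := by
  refine bilinear_word_induction (f := (LinearMap.mul ℚ T).compr₂ cyclicSum)
    (g := (LinearMap.mul ℚ T).flip.compr₂ cyclicSum) (fun v w => ?_) s t
  change cyclicSum (word v * word w) = cyclicSum (word w * word v)
  rw [← word_append, ← word_append, cyclicSum_word, cyclicSum_word,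
    ← sum_rotate_rotate _ (v ++ w) v.length, List.rotate_append_length_eq]
  simp [add_comm]

/-- In characteristic zero, the kernel of the cyclic symmetrization is spanned by commutators and
the constants. This is its universal property. -/
theorem eq_zero_of_cyclicSum_eq_zero {M : Type*} [AddCommGroup M] [Module ℚ M] (f : T →ₗ[ℚ] M)
    (h1 : f 1 = 0) (hf : ∀ s t, f (s * t) = f (t * s)) {t : T} (ht : cyclicSum t = 0) :
    f t = 0 := by
  have hrot : ∀ (w : List (Fin 2)) (k : ℕ), f (word (w.rotate k)) = f (word w) := by
    intro w k
    rw [List.rotate_eq_drop_append_take_mod, word_append, hf, ← word_append,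
      List.take_append_drop]
  have key : f = f ∘ₗ (onWords fun w => (w.length : ℚ)⁻¹ • word w) ∘ₗ cyclicSum := by
    refine linearMap_ext_word fun w => ?_
    rw [LinearMap.comp_apply, LinearMap.comp_apply, cyclicSum_word, map_sum, map_sum]
    simp only [onWords_word, List.length_rotate, map_smul, hrot, Finset.sum_const,
      Finset.card_range]
    cases w with
    | nil => simp [h1]
    | cons i w =>
      rw [← Nat.cast_smul_eq_nsmul ℚ, smul_smul, mul_inv_cancel₀, one_smul]
      exact Nat.cast_ne_zero.2 (by simp)
  rw [key, LinearMap.comp_apply, LinearMap.comp_apply, ht, map_zero, map_zero]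

theorem cyclicSum_spT (g : Sp2) {t : T} (ht : cyclicSum t = 0) : cyclicSum (spT g t) = 0 :=
  eq_zero_of_cyclicSum_eq_zero (cyclicSum ∘ₗ (spT g).toLinearMap)
    (by simp [cyclicSum_one]) (fun s t => by simp [cyclicSum_mul_comm]) ht

theorem cyclicSum_derT (d : Fin 2 → T) {t : T} (ht : cyclicSum t = 0) :
    cyclicSum (derT d t) = 0 :=
  eq_zero_of_cyclicSum_eq_zero (cyclicSum ∘ₗ derT d) (by simp [derT_one])
    (fun s t => by
      simp only [LinearMap.comp_apply, derT_mul, map_add]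
      rw [cyclicSum_mul_comm (derT d s) t, cyclicSum_mul_comm s, add_comm]) ht

/-! ### The Enomoto–Satoh map as a divergence -/

theorem contract12_ι_mul_ι_mul (i j : Fin 2) (t : T) :
    contract12 (FreeAlgebra.ι ℚ i * (FreeAlgebra.ι ℚ j * t)) = interForm i j • t := by
  induction t using word_induction with
  | hw w => rw [← word_cons, ← word_cons, contract12, onWords_word]
  | hadd s t hs ht => rw [mul_add, mul_add, map_add, hs, ht, smul_add]
  | hsmul c t ht => rw [mul_smul_comm, mul_smul_comm, map_smul, ht, smul_comm]

theorem contract12_ι (i : Fin 2) : contract12 (FreeAlgebra.ι ℚ i) = 0 := by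
  rw [← mul_one (FreeAlgebra.ι ℚ i), ← word_nil, ← word_cons, contract12, onWords_word]

theorem contract12_one : contract12 1 = 0 := by
  rw [← word_nil, contract12, onWords_word]

theorem contract12_spT (g : Sp2) (t : T) : contract12 (spT g t) = spT g (contract12 t) := by
  have : contract12 ∘ₗ (spT g).toLinearMap = (spT g).toLinearMap ∘ₗ contract12 := by
    refine linearMap_ext_word fun w => ?_
    change contract12 (spT g (word w)) = spT g (contract12 (word w))
    match w with
    | [] => rw [word_nil, map_one, contract12_one, map_zero]
    | [i] =>
      rw [word_cons, word_nil, mul_one, contract12_ι, map_zero, spT_ι, map_add, map_smul,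
        map_smul, contract12_ι, contract12_ι, smul_zero, smul_zero, add_zero]
    | i :: j :: w =>
      have hdet := g.det_coe
      rw [Matrix.det_fin_two] at hdet
      rw [word_cons, word_cons, contract12_ι_mul_ι_mul, map_mul (spT g), map_mul (spT g),
        map_smul (spT g), spT_ι, spT_ι]
      simp only [add_mul, smul_mul_assoc, mul_add, mul_smul_comm, map_add, map_smul,
        contract12_ι_mul_ι_mul, smul_smul, ← add_smul]
      congr 1
      fin_cases i <;> fin_cases j <;> simp [interForm] <;> linarith
  exact LinearMap.congr_fun this t

theorem contract12_ι_one_mul (t : T) : contract12 (FreeAlgebra.ι ℚ 1 * t) = - strip 0 t := by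
  induction t using word_induction with
  | hw w =>
    cases w with
    | nil => rw [word_nil, mul_one, contract12_ι, strip_one, neg_zero]
    | cons i w =>
      rw [word_cons, contract12_ι_mul_ι_mul, strip_ι_mul]
      fin_cases i <;> simp [interForm]
  | hadd s t hs ht => rw [mul_add, map_add, hs, ht, map_add, neg_add]
  | hsmul c t ht => rw [mul_smul_comm, map_smul, ht, map_smul, smul_neg]

theorem contract12_ι_zero_mul (t : T) : contract12 (FreeAlgebra.ι ℚ 0 * t) = strip 1 t := by
  induction t using word_induction with
  | hw w =>
    cases w with
    | nil => rw [word_nil, mul_one, contract12_ι, strip_one]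
    | cons i w =>
      rw [word_cons, contract12_ι_mul_ι_mul, strip_ι_mul]
      fin_cases i <;> simp [interForm]
  | hadd s t hs ht => rw [mul_add, map_add, hs, ht, map_add]
  | hsmul c t ht => rw [mul_smul_comm, map_smul, ht, map_smul]

theorem ES_apply (D : Der) : ES D = cyclicSum (contract12 (derToTensor D)) := rfl

/-- Up to sign, the contraction of a derivation is its divergence `∑ᵢ ∂ᵢ (D xᵢ)`. -/
theorem contract12_derToTensor (D : Der) :
    contract12 (derToTensor D) = - ∑ i, strip i (derVal D i) := by
  rw [derToTensor_apply, map_sub, contract12_ι_one_mul, contract12_ι_zero_mul, Fin.sum_univ_two,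
    neg_add, sub_eq_add_neg]
  rfl

theorem strip_mul (i : Fin 2) {s : T} (hs : coeff [] s = 0) (t : T) :
    strip i (s * t) = strip i s * t := by
  conv_lhs => rw [← sum_ι_mul_strip s hs]
  simp only [add_mul, mul_assoc, map_add, strip_ι_mul]
  fin_cases i <;> simp

/-- The Leibniz rule for Fox derivatives. -/
theorem strip_derT {d : Fin 2 → T} (hd : ∀ j, coeff [] (d j) = 0) (i : Fin 2) (t : T) :
    strip i (derT d t) = ∑ j, strip i (d j) * strip j t + derT d (strip i t) := by
  induction t using word_induction with
  | hw w =>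
    cases w with
    | nil => simp [derT_one, strip_one]
    | cons k w =>
      rw [word_cons, derT_ι_mul, map_add, strip_mul i (hd k), strip_ι_mul, strip_ι_mul]
      congr 1
      · simp [strip_ι_mul]
      · split_ifs <;> simp
  | hadd s t hs ht =>
    simp only [map_add, hs, ht, mul_add, Finset.sum_add_distrib]
    abel
  | hsmul c t ht =>
    simp only [map_smul, ht, mul_smul_comm, smul_add, Finset.smul_sum]

/-- The divergence is a 1-cocycle with values in cyclic words: the mixed terms
`∑ᵢⱼ ∂ᵢ(D xⱼ) ∂ⱼ(E xᵢ)` and `∑ᵢⱼ ∂ᵢ(E xⱼ) ∂ⱼ(D xᵢ)` are equal up to a cyclic rotation. -/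
theorem ES_lie (D E : Der) :
    ES ⁅D, E⁆ = cyclicSum (derT (derVal D) (contract12 (derToTensor E))) -
      cyclicSum (derT (derVal E) (contract12 (derToTensor D))) := by
  have hnil : ∀ (D : Der) (j : Fin 2), coeff [] (derVal D j) = 0 :=
    fun D j => coeff_nil_lieToTensor _
  have hval : ∀ i, derVal ⁅D, E⁆ i = derT (derVal D) (derVal E i) -
      derT (derVal E) (derVal D i) := by
    intro i
    rw [derVal, LieDerivation.commutator_apply, map_sub, lieToTensor_der D (E _),
      lieToTensor_der E (D _)]
    rfl
  rw [ES_apply, contract12_derToTensor, contract12_derToTensor, contract12_derToTensor]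
  simp only [hval, map_sub, strip_derT (hnil _), map_neg, map_add, Fin.sum_univ_two]
  rw [cyclicSum_mul_comm (strip 0 (derVal D 0)), cyclicSum_mul_comm (strip 0 (derVal D 1)),
    cyclicSum_mul_comm (strip 1 (derVal D 0)), cyclicSum_mul_comm (strip 1 (derVal D 1))]
  abel

theorem ES_lie_eq_zero {D E : Der} (hD : ES D = 0) (hE : ES E = 0) : ES ⁅D, E⁆ = 0 := by
  rw [ES_lie]
  rw [ES_apply] at hD hE
  rw [cyclicSum_derT _ hE, cyclicSum_derT _ hD, sub_zero]

theorem ES_spRep (g : Sp2) {D : Der} (hD : ES D = 0) : ES (spRep g D) = 0 := by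
  rw [ES_apply, derToTensor_spRep, contract12_spT]
  exact cyclicSum_spT g hD

/-! ### Shuffle relations and reversal for Lie elements -/

/-- The shuffles of two words, with multiplicity. -/
def shuffle : List (Fin 2) → List (Fin 2) → List (List (Fin 2))
  | [], v => [v]
  | a :: u, v => v.rec [a :: u] fun b v r => (shuffle u (b :: v)).map (a :: ·) ++ r.map (b :: ·)

theorem shuffle_nil (v : List (Fin 2)) : shuffle [] v = [v] := rfl

theorem shuffle_cons_nil (a : Fin 2) (u : List (Fin 2)) : shuffle (a :: u) [] = [a :: u] := rfl

theorem shuffle_cons_cons (a b : Fin 2) (u v : List (Fin 2)) : shuffle (a :: u) (b :: v) =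
    (shuffle u (b :: v)).map (a :: ·) ++ (shuffle (a :: u) v).map (b :: ·) := rfl

open scoped TensorProduct

/-- The unshuffle coproduct. -/
def coproduct : T →ₐ[ℚ] T ⊗[ℚ] T :=
  FreeAlgebra.lift ℚ fun i => FreeAlgebra.ι ℚ i ⊗ₜ 1 + 1 ⊗ₜ FreeAlgebra.ι ℚ i

theorem coproduct_lieToTensor (a : L) :
    coproduct (lieToTensor a) = lieToTensor a ⊗ₜ 1 + 1 ⊗ₜ lieToTensor a := by
  induction a using lie_induction with
  | hof i => rw [lieToTensor_of, coproduct, FreeAlgebra.lift_ι_apply]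
  | hadd a b ha hb =>
    rw [map_add, map_add, ha, hb, TensorProduct.add_tmul, TensorProduct.tmul_add]
    abel
  | hsmul c a ha =>
    rw [map_smul, map_smul, ha, smul_add, TensorProduct.smul_tmul', TensorProduct.tmul_smul]
  | hlie a b ha hb =>
    rw [lieToTensor_lie, map_sub, map_mul, map_mul, ha, hb]
    simp only [add_mul, mul_add, Algebra.TensorProduct.tmul_mul_tmul, one_mul, mul_one,
      TensorProduct.sub_tmul, TensorProduct.tmul_sub]
    abel

/-- The coefficient of `u ⊗ v` in an element of `T ⊗ T`. -/
def coeffTensor (u v : List (Fin 2)) : T ⊗[ℚ] T →ₗ[ℚ] ℚ :=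
  LinearMap.mul' ℚ ℚ ∘ₗ TensorProduct.map (coeff u) (coeff v)

theorem coeffTensor_tmul (u v : List (Fin 2)) (s t : T) :
    coeffTensor u v (s ⊗ₜ t) = coeff u s * coeff v t := by
  simp [coeffTensor]

theorem coeffTensor_ι_tmul_mul (i : Fin 2) (u v : List (Fin 2)) (z : T ⊗[ℚ] T) :
    coeffTensor u v ((FreeAlgebra.ι ℚ i ⊗ₜ 1) * z) =
      match u with
      | [] => 0
      | j :: u => if i = j then coeffTensor u v z else 0 := by
  induction z using TensorProduct.induction_on with
  | zero => cases u <;> simp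
  | tmul s t =>
    rw [Algebra.TensorProduct.tmul_mul_tmul, one_mul, coeffTensor_tmul]
    cases u with
    | nil => rw [coeff_nil_ι_mul, zero_mul]
    | cons j u =>
      simp only [coeff_cons_ι_mul, coeffTensor_tmul, ite_mul, zero_mul]
  | add a b ha hb =>
    rw [mul_add, map_add, ha, hb]
    cases u with
    | nil => simp
    | cons j u => simp only [map_add]; split_ifs <;> simp

theorem coeffTensor_tmul_ι_mul (i : Fin 2) (u v : List (Fin 2)) (z : T ⊗[ℚ] T) :
    coeffTensor u v ((1 ⊗ₜ FreeAlgebra.ι ℚ i) * z) =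
      match v with
      | [] => 0
      | j :: v => if i = j then coeffTensor u v z else 0 := by
  induction z using TensorProduct.induction_on with
  | zero => cases v <;> simp
  | tmul s t =>
    rw [Algebra.TensorProduct.tmul_mul_tmul, one_mul, coeffTensor_tmul]
    cases v with
    | nil => rw [coeff_nil_ι_mul, mul_zero]
    | cons j v =>
      simp only [coeff_cons_ι_mul, coeffTensor_tmul, mul_ite, mul_zero]
  | add a b ha hb =>
    rw [mul_add, map_add, ha, hb]
    cases v with
    | nil => simp
    | cons j v => simp only [map_add]; split_ifs <;> simp

theorem coeffTensor_coproduct_word (w u v : List (Fin 2)) :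
    coeffTensor u v (coproduct (word w)) =
      ((shuffle u v).map fun w' => coeff w' (word w)).sum := by
  induction w generalizing u v with
  | nil =>
    rw [word_nil, map_one, Algebra.TensorProduct.one_def, coeffTensor_tmul, coeff_one, coeff_one]
    cases u with
    | nil => simp [shuffle_nil, coeff_one]
    | cons a u =>
      cases v with
      | nil => simp [shuffle_cons_nil, coeff_one]
      | cons b v => simp [shuffle_cons_cons, coeff_one, Function.comp_def]
  | cons i w ih =>
    have hi : coproduct (FreeAlgebra.ι ℚ i) =
        FreeAlgebra.ι ℚ i ⊗ₜ 1 + 1 ⊗ₜ FreeAlgebra.ι ℚ i := by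
      rw [coproduct, FreeAlgebra.lift_ι_apply]
    rw [word_cons, map_mul, hi, add_mul, map_add, coeffTensor_ι_tmul_mul, coeffTensor_tmul_ι_mul]
    cases u with
    | nil =>
      cases v with
      | nil => simp [shuffle_nil, coeff_nil_ι_mul]
      | cons b v =>
        simp only [shuffle_nil, List.map_cons, List.map_nil, List.sum_cons, List.sum_nil, add_zero,
          coeff_cons_ι_mul, ih, zero_add]
    | cons a u =>
      cases v with
      | nil =>
        have hu : shuffle u [] = [u] := by cases u <;> simp [shuffle_nil, shuffle_cons_nil]
        simp only [shuffle_cons_nil, List.map_cons, List.map_nil, List.sum_cons, List.sum_nil,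
          add_zero,
          coeff_cons_ι_mul, ih, hu]
      | cons b v =>
        simp only [shuffle_cons_cons, List.map_append, List.map_map, Function.comp_def,
          List.sum_append,
          coeff_cons_ι_mul, ih]
        congr 1 <;> split_ifs <;> simp

/-- The coefficients of a Lie element satisfy the shuffle relations, because Lie elements are
primitive for the unshuffle coproduct. -/
theorem sum_shuffle_lieToTensor (a : L) {u v : List (Fin 2)} (hu : u ≠ []) (hv : v ≠ []) :
    ((shuffle u v).map fun w => coeff w (lieToTensor a)).sum = 0 := by
  have key : ∀ t : T, coeffTensor u v (coproduct t) =
      ((shuffle u v).map fun w => coeff w t).sum := by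
    intro t
    induction t using word_induction with
    | hw w => exact coeffTensor_coproduct_word w u v
    | hadd s t hs ht => simp only [map_add, hs, ht, List.sum_map_add]
    | hsmul c t ht => simp only [map_smul, ht, smul_eq_mul, List.sum_map_mul_left]
  rw [← key, coproduct_lieToTensor, map_add, coeffTensor_tmul, coeffTensor_tmul, coeff_one,
    coeff_one, if_neg hu, if_neg hv, mul_zero, zero_mul, add_zero]

/-- The antipode of the tensor algebra: `x₁ ⊗ ⋯ ⊗ xₙ ↦ (-1)ⁿ xₙ ⊗ ⋯ ⊗ x₁`. -/
def antipode : T →ₗ[ℚ] T := onWords fun w => (-1 : ℚ) ^ w.length • word w.reverse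

theorem antipode_word (w : List (Fin 2)) :
    antipode (word w) = (-1 : ℚ) ^ w.length • word w.reverse := onWords_word _ _

theorem antipode_mul (s t : T) : antipode (s * t) = antipode t * antipode s := by
  refine bilinear_word_induction (f := (LinearMap.mul ℚ T).compr₂ antipode)
    (g := (LinearMap.mul ℚ T).flip.compl₁₂ antipode antipode) (fun v w => ?_) s t
  change antipode (word v * word w) = antipode (word w) * antipode (word v)
  rw [← word_append, antipode_word, antipode_word, antipode_word, List.reverse_append,
    word_append, smul_mul_smul_comm, List.length_append, pow_add, mul_comm ((-1 : ℚ) ^ _)]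

theorem antipode_lieToTensor (a : L) : antipode (lieToTensor a) = - lieToTensor a := by
  induction a using lie_induction with
  | hof i =>
    rw [lieToTensor_of, ← mul_one (FreeAlgebra.ι ℚ i), ← word_nil, ← word_cons, antipode_word]
    simp
  | hadd a b ha hb => rw [map_add, map_add, ha, hb, neg_add]
  | hsmul c a ha => rw [map_smul, map_smul, ha, smul_neg]
  | hlie a b ha hb =>
    rw [lieToTensor_lie, map_sub, antipode_mul, antipode_mul, ha, hb]
    noncomm_ring

theorem coeff_antipode (w : List (Fin 2)) (t : T) :
    coeff w (antipode t) = (-1) ^ w.length * coeff w.reverse t := by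
  induction t using word_induction with
  | hw v =>
    rw [antipode_word, map_smul, coeff_word, coeff_word, smul_eq_mul]
    by_cases h : v.reverse = w
    · subst h; simp
    · rw [if_neg h, if_neg (by rintro rfl; simp at h), mul_zero, mul_zero]
  | hadd s t hs ht => rw [map_add, map_add, hs, ht, map_add, mul_add]
  | hsmul c t ht => rw [map_smul, map_smul, ht, map_smul, smul_eq_mul, smul_eq_mul]; ring

theorem coeff_reverse_lieToTensor (a : L) (w : List (Fin 2)) :
    coeff w.reverse (lieToTensor a) = (-1) ^ (w.length + 1) * coeff w (lieToTensor a) := by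
  have h := coeff_antipode w (lieToTensor a)
  rw [antipode_lieToTensor, map_neg] at h
  have h1 : ((-1 : ℚ) ^ w.length) * (-1) ^ w.length = 1 := by
    rw [← mul_pow]; simp
  calc coeff w.reverse (lieToTensor a)
      = (-1 : ℚ) ^ w.length * ((-1) ^ w.length * coeff w.reverse (lieToTensor a)) := by
        rw [← mul_assoc, h1, one_mul]
    _ = _ := by rw [← h]; ring

theorem shuffle_singleton_replicate (i : Fin 2) (n : ℕ) :
    shuffle [i] (List.replicate n i) = List.replicate (n + 1) (List.replicate (n + 1) i) := by
  induction n with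
  | zero => simp [shuffle_cons_nil]
  | succ n ih =>
    rw [List.replicate_succ, shuffle_cons_cons, ← List.replicate_succ, ih]
    simp [shuffle_nil, List.replicate_succ]

theorem coeff_replicate_lieToTensor (a : L) (i : Fin 2) {n : ℕ} (hn : 2 ≤ n) :
    coeff (List.replicate n i) (lieToTensor a) = 0 := by
  obtain ⟨n, rfl⟩ := Nat.exists_eq_add_of_le' hn
  have h := sum_shuffle_lieToTensor a (u := [i]) (v := List.replicate (n + 1) i) (by simp)
    (by simp)
  rw [shuffle_singleton_replicate, List.map_replicate, List.sum_replicate, nsmul_eq_mul] at h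
  exact (mul_eq_zero.1 h).resolve_left (by positivity)

theorem sum_shuffle_zero_single_one (f : List (Fin 2) → ℚ) (i j : ℕ) :
    ((shuffle [0] (List.replicate i 0 ++ 1 :: List.replicate j 0)).map f).sum =
      (i + 1) * f (List.replicate (i + 1) 0 ++ 1 :: List.replicate j 0) +
      (j + 1) * f (List.replicate i 0 ++ 1 :: List.replicate (j + 1) 0) := by
  induction i generalizing f with
  | zero =>
    rw [List.replicate_zero, List.nil_append, shuffle_cons_cons, List.map_append, List.map_map,
      List.sum_append, shuffle_singleton_replicate]
    simp [shuffle_nil]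
  | succ i ih =>
    rw [List.replicate_succ, List.cons_append, shuffle_cons_cons, List.map_append, List.map_map,
      List.map_map, List.sum_append, ih]
    simp only [shuffle_nil, Function.comp_apply, List.map_cons, List.map_nil, List.sum_cons,
      List.sum_nil, List.replicate_succ, List.cons_append]
    push_cast
    ring

/-- A Lie element is determined in degree `1` in `y` by the coefficient of `xⁿ y`. -/
theorem coeff_single_one_lieToTensor {a : L} {n : ℕ}
    (h : coeff (List.replicate n 0 ++ [1]) (lieToTensor a) = 0) (i j : ℕ) (hij : i + j = n) :
    coeff (List.replicate i 0 ++ 1 :: List.replicate j 0) (lieToTensor a) = 0 := by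
  induction j generalizing i with
  | zero => subst hij; simpa using h
  | succ j ih =>
    have e := sum_shuffle_lieToTensor a (u := [0])
      (v := List.replicate i 0 ++ 1 :: List.replicate j 0) (by simp) (by simp)
    rw [sum_shuffle_zero_single_one, ih (i + 1) (by omega), mul_zero, zero_add] at e
    exact (mul_eq_zero.1 e).resolve_left (by positivity)

/-! ### Coefficients of symplectic derivations -/

theorem coeff_zero_cons_derToTensor (D : Der) (w : List (Fin 2)) :
    coeff (0 :: w) (derToTensor D) = - coeff w (lieToTensor (D y)) := by
  rw [derToTensor_apply, map_sub, coeff_cons_ι_mul, coeff_cons_ι_mul]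
  simp

theorem coeff_one_cons_derToTensor (D : Der) (w : List (Fin 2)) :
    coeff (1 :: w) (derToTensor D) = coeff w (lieToTensor (D x)) := by
  rw [derToTensor_apply, map_sub, coeff_cons_ι_mul, coeff_cons_ι_mul]
  simp

/-- The tensor of a derivation which kills `ω₀` is invariant under cyclic rotations. -/
theorem coeff_rotate_one_derToTensor {D : Der} (hD : D ⁅x, y⁆ = 0) (i : Fin 2)
    (w : List (Fin 2)) :
    coeff (w ++ [i]) (derToTensor D) = coeff (i :: w) (derToTensor D) := by
  have h : derToTensor D = lieToTensor (D x) * FreeAlgebra.ι ℚ 1 -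
      lieToTensor (D y) * FreeAlgebra.ι ℚ 0 := by
    have e := congrArg lieToTensor hD
    rw [LieDerivation.apply_lie_eq_add, map_add, lieToTensor_lie, lieToTensor_lie, map_zero,
      x, y, lieToTensor_of, lieToTensor_of] at e
    rw [derToTensor_apply, ← sub_eq_zero, ← neg_eq_zero, ← e, x, y]
    abel
  conv_lhs => rw [h]
  rw [map_sub, coeff_concat_mul_ι, coeff_concat_mul_ι]
  fin_cases i
  · rw [Fin.zero_eta, coeff_zero_cons_derToTensor]; simp
  · rw [Fin.mk_one, coeff_one_cons_derToTensor]; simp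

theorem coeff_rotate_derToTensor {D : Der} (hD : D ⁅x, y⁆ = 0) (w : List (Fin 2)) (k : ℕ) :
    coeff (w.rotate k) (derToTensor D) = coeff w (derToTensor D) := by
  induction k generalizing w with
  | zero => rw [List.rotate_zero]
  | succ k ih =>
    cases w with
    | nil => simp
    | cons i w => rw [List.rotate_cons_succ, ih, coeff_rotate_one_derToTensor hD]

theorem coeff_derToTensor_of_length_ne {n : ℕ} {D : Der} (hD : D ∈ hDeg n) {w : List (Fin 2)}
    (hw : w.length ≠ n + 2) : coeff w (derToTensor D) = 0 := by
  match w with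
  | [] => rw [derToTensor_apply, map_sub, coeff_nil_ι_mul, coeff_nil_ι_mul, sub_zero]
  | 0 :: w =>
    rw [coeff_zero_cons_derToTensor, neg_eq_zero]
    refine coeff_lieToTensor_of_length_ne (hD.2 1) fun h => hw ?_
    rw [List.length_cons, h]
  | 1 :: w =>
    rw [coeff_one_cons_derToTensor]
    refine coeff_lieToTensor_of_length_ne (hD.2 0) fun h => hw ?_
    rw [List.length_cons, h]

theorem eq_zero_of_derToTensor_eq_zero {n : ℕ} {D : Der} (hD : D ∈ hDeg n)
    (h : derToTensor D = 0) : D = 0 := by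
  apply der_ext
  intro i
  rw [LieDerivation.zero_apply]
  apply lieToTensor_injective_on (hD.2 i)
  apply ext_coeff
  intro w
  fin_cases i
  · change coeff w (lieToTensor (D x)) = _
    rw [← coeff_one_cons_derToTensor, h, map_zero, map_zero]
  · change coeff w (lieToTensor (D y)) = _
    rw [← neg_neg (coeff w (lieToTensor (D y))), ← coeff_zero_cons_derToTensor, h, map_zero,
      map_zero, neg_zero]

theorem spLie_mem_freeLieDeg (g : Sp2) {n : ℕ} {a : L} (ha : a ∈ freeLieDeg n) :
    spLie g a ∈ freeLieDeg n := by
  have hof : ∀ i, spLie g (FreeLieAlgebra.of ℚ i) ∈ freeLieDeg 1 := fun i => by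
    rw [spLie_of]
    exact add_mem (Submodule.smul_mem _ _ (of_mem_freeLieDeg 0))
      (Submodule.smul_mem _ _ (of_mem_freeLieDeg 1))
  refine freeLieDeg_induction (p := fun n a => spLie g a ∈ freeLieDeg n) hof ?_ ?_ ?_ ?_ ha
  · intro n
    rw [map_zero]
    exact zero_mem _
  · intro n a b ha hb
    rw [map_add]
    exact add_mem ha hb
  · intro n c a ha
    rw [map_smul]
    exact Submodule.smul_mem _ _ ha
  · intro n i a _ ha
    rw [LieHom.map_lie, add_comm]
    exact lie_mem_freeLieDeg (hof i) ha

theorem spLie_omega (g : Sp2) : spLie g ⁅x, y⁆ = ⁅x, y⁆ := by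
  have hdet := g.det_coe
  rw [Matrix.det_fin_two] at hdet
  rw [LieHom.map_lie, x, y, spLie_of, spLie_of]
  simp only [add_lie, lie_add, smul_lie, lie_smul, lie_self]
  rw [← lie_skew (FreeLieAlgebra.of ℚ (1 : Fin 2)) (FreeLieAlgebra.of ℚ 0)]
  trans ((g : Matrix (Fin 2) (Fin 2) ℚ) 0 0 * (g : Matrix (Fin 2) (Fin 2) ℚ) 1 1 -
    (g : Matrix (Fin 2) (Fin 2) ℚ) 0 1 * (g : Matrix (Fin 2) (Fin 2) ℚ) 1 0) •
      ⁅FreeLieAlgebra.of ℚ (0 : Fin 2), FreeLieAlgebra.of ℚ 1⁆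
  · module
  · rw [hdet, one_smul]

theorem spRep_mem_hDeg (g : Sp2) {n : ℕ} {D : Der} (hD : D ∈ hDeg n) : spRep g D ∈ hDeg n := by
  refine ⟨?_, fun i => ?_⟩
  · rw [spRep_apply, spLie_omega, hD.1, map_zero]
  · rw [spRep_apply, spLie_of, map_add, map_smul, map_smul]
    exact spLie_mem_freeLieDeg g (add_mem (Submodule.smul_mem _ _ (hD.2 0))
      (Submodule.smul_mem _ _ (hD.2 1)))

/-! ### Coefficients under the torus, the Weyl element and unipotent elements -/

theorem coeff_spT_torus (s : ℚˣ) (w : List (Fin 2)) (t : T) :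
    coeff w (spT (torus s) t) = (s : ℚ) ^ ((w.count 0 : ℤ) - w.count 1) * coeff w t := by
  have hs : (s : ℚ) ≠ 0 := s.ne_zero
  have hw : ∀ v : List (Fin 2),
      spT (torus s) (word v) = (s : ℚ) ^ ((v.count 0 : ℤ) - v.count 1) • word v := by
    intro v
    induction v with
    | nil => simp
    | cons i v ih =>
      rw [word_cons, map_mul, ih, spT_ι]
      fin_cases i
      · simp only [torus, Fin.zero_eta, Matrix.of_apply, Matrix.cons_val', Matrix.cons_val_zero,
          Matrix.cons_val_one, Matrix.cons_val_fin_one, zero_smul, add_zero, List.count_cons_self,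
          smul_mul_smul_comm, ← zpow_one_add₀ hs]
        simp only [List.count_cons, beq_iff_eq, zero_ne_one, if_false]
        congr 2
        push_cast
        ring
      · simp only [torus, Fin.mk_one, Matrix.of_apply, Matrix.cons_val', Matrix.cons_val_zero,
          Matrix.cons_val_one, Matrix.cons_val_fin_one, zero_smul, zero_add, List.count_cons_self,
          smul_mul_smul_comm, Units.val_inv_eq_inv_val]
        simp only [List.count_cons, beq_iff_eq, one_ne_zero, if_false]
        rw [← zpow_neg_one, ← zpow_add₀ hs]
        congr 2
        push_cast
        ring
  induction t using word_induction with
  | hw v =>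
    rw [hw, map_smul, smul_eq_mul, coeff_word]
    by_cases h : v = w
    · rw [h]
    · simp [h]
  | hadd a b ha hb => rw [map_add, map_add, ha, hb, map_add, mul_add]
  | hsmul c a ha => rw [map_smul, map_smul, ha, map_smul, smul_eq_mul, smul_eq_mul]; ring

/-- A derivation on which the torus element `t` acts by `t ^ m` is a combination of words of
weight `m`. -/
theorem coeff_eq_zero_of_weight {D : Der} {m : ℤ}
    (h : ∀ s : ℚˣ, spRep (torus s) D = (s : ℚ) ^ m • D) {w : List (Fin 2)}
    (hw : (w.count 0 : ℤ) - w.count 1 ≠ m) : coeff w (derToTensor D) = 0 := by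
  have e := congrArg (fun D => coeff w (derToTensor D)) (h (Units.mk0 2 (by norm_num)))
  simp only [derToTensor_spRep, coeff_spT_torus, map_smul, smul_eq_mul, Units.val_mk0] at e
  by_contra hc
  exact hw (zpow_right_injective₀ (a := (2 : ℚ)) (by norm_num) (by norm_num)
    (mul_right_cancel₀ hc e))

/-- The Weyl element `x ↦ y`, `y ↦ -x`. -/
def weyl : Sp2 := ⟨!![0, -1; 1, 0], by simp [Matrix.det_fin_two]⟩

theorem coeff_spT_weyl (w : List (Fin 2)) (t : T) :
    coeff (w.map (· + 1)) (spT weyl t) = (-1) ^ w.count 1 * coeff w t := by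
  have hw : ∀ v : List (Fin 2),
      spT weyl (word v) = (-1 : ℚ) ^ v.count 1 • word (v.map (· + 1)) := by
    intro v
    induction v with
    | nil => simp
    | cons i v ih =>
      rw [word_cons, map_mul, ih, spT_ι, List.map_cons, word_cons]
      fin_cases i
      · simp [weyl]
      · simp [weyl, pow_succ]
  have hinj : Function.Injective (fun v : List (Fin 2) => v.map (· + 1)) :=
    List.map_injective_iff.2 (add_left_injective 1)
  induction t using word_induction with
  | hw v =>
    rw [hw, map_smul, smul_eq_mul, coeff_word, coeff_word]
    by_cases h : v = w
    · rw [h, if_pos rfl, if_pos rfl]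
    · rw [if_neg h, if_neg (fun e => h (hinj e)), mul_zero, mul_zero]
  | hadd a b ha hb => rw [map_add, map_add, ha, hb, map_add, mul_add]
  | hsmul c a ha => rw [map_smul, map_smul, ha, map_smul, smul_eq_mul, smul_eq_mul]; ring

/-- All words obtained by changing some letters `x` of a word into `y`. -/
def changeSome : List (Fin 2) → List (List (Fin 2))
  | [] => [[]]
  | 0 :: w => (changeSome w).map (0 :: ·) ++ (changeSome w).map (1 :: ·)
  | 1 :: w => (changeSome w).map (1 :: ·)

/-- All words obtained by changing one letter `x` of a word into `y`. -/
def changeOne : List (Fin 2) → List (List (Fin 2))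
  | [] => []
  | 0 :: w => (1 :: w) :: (changeOne w).map (0 :: ·)
  | 1 :: w => (changeOne w).map (1 :: ·)

theorem coeff_spT_unipotent_one (w : List (Fin 2)) (t : T) :
    coeff w (spT (unipotent 1) t) = ((changeSome w).map fun v => coeff v t).sum := by
  have h0 : spT (unipotent 1) (FreeAlgebra.ι ℚ 0) = FreeAlgebra.ι ℚ 0 := by
    rw [spT_ι]; simp [unipotent]
  have h1 : spT (unipotent 1) (FreeAlgebra.ι ℚ 1) = FreeAlgebra.ι ℚ 0 + FreeAlgebra.ι ℚ 1 := by
    rw [spT_ι]; simp [unipotent]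
  induction t using word_induction with
  | hw v =>
    induction v generalizing w with
    | nil =>
      rw [word_nil, map_one]
      match w with
      | [] => simp [changeSome]
      | 0 :: w => simp [changeSome, coeff_one, Function.comp_def]
      | 1 :: w => simp [changeSome, coeff_one, Function.comp_def]
    | cons i v ih =>
      match i, w with
      | 0, [] => simp [changeSome, h0, coeff_nil_ι_mul]
      | 1, [] => simp [changeSome, h1, coeff_nil_ι_mul, add_mul]
      | 0, 0 :: w =>
        simp [changeSome, h0, coeff_cons_ι_mul, Function.comp_def, ih]
      | 1, 0 :: w =>
        simp [changeSome, h1, coeff_cons_ι_mul, Function.comp_def, ih, add_mul]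
      | 0, 1 :: w =>
        simp [changeSome, h0, coeff_cons_ι_mul, Function.comp_def]
      | 1, 1 :: w =>
        simp [changeSome, h1, coeff_cons_ι_mul, Function.comp_def, ih, add_mul]
  | hadd a b ha hb => simp only [map_add, ha, hb, List.sum_map_add]
  | hsmul c a ha => simp only [map_smul, ha, smul_eq_mul, List.sum_map_mul_left]

theorem sum_changeSome_eq_self (f : List (Fin 2) → ℚ) (k : ℕ)
    (hf : ∀ v : List (Fin 2), v.count 1 ≠ k → f v = 0) (w : List (Fin 2)) (hw : k ≤ w.count 1) :
    ((changeSome w).map f).sum = f w := by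
  induction w generalizing f k with
  | nil => simp [changeSome]
  | cons i w ih =>
    match i with
    | 0 =>
      simp only [List.count_cons, beq_iff_eq, zero_ne_one, if_false, add_zero] at hw
      simp only [changeSome, List.map_append, List.map_map, List.sum_append]
      rw [ih (f ∘ (0 :: ·)) k (fun v hv => hf _ (by simpa using hv)) hw]
      cases k with
      | zero =>
        rw [List.sum_eq_zero]
        · simp
        · simp only [List.mem_map, Function.comp_apply]
          rintro _ ⟨v, _, rfl⟩
          exact hf _ (by simp)
      | succ k =>
        rw [ih (f ∘ (1 :: ·)) k (fun v hv => hf _ (by simpa using hv)) (by omega)]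
        simp only [Function.comp_apply, add_eq_left]
        exact hf _ (by rw [List.count_cons_self]; omega)
    | 1 =>
      rw [List.count_cons_self] at hw
      simp only [changeSome, List.map_map]
      cases k with
      | zero =>
        rw [List.sum_eq_zero]
        · exact (hf _ (by simp)).symm
        · simp only [List.mem_map, Function.comp_apply]
          rintro _ ⟨v, _, rfl⟩
          exact hf _ (by simp)
      | succ k =>
        exact ih (f ∘ (1 :: ·)) k (fun v hv => hf _ (by simpa using hv)) (by omega)

theorem sum_changeSome_eq_sum_changeOne (f : List (Fin 2) → ℚ) (k : ℕ)
    (hf : ∀ v : List (Fin 2), v.count 1 ≠ k + 1 → f v = 0) (w : List (Fin 2))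
    (hw : w.count 1 = k) : ((changeSome w).map f).sum = ((changeOne w).map f).sum := by
  induction w generalizing f k with
  | nil => exact (by simpa [changeSome, changeOne] using hf [] (by simp))
  | cons i w ih =>
    match i with
    | 0 =>
      simp only [List.count_cons, beq_iff_eq, zero_ne_one, if_false, add_zero] at hw
      simp only [changeSome, changeOne, List.map_append, List.map_map, List.sum_append,
        List.map_cons, List.sum_cons]
      rw [ih (f ∘ (0 :: ·)) k (fun v hv => hf _ (by simpa using hv)) hw,
        sum_changeSome_eq_self (f ∘ (1 :: ·)) k (fun v hv => hf _ (by simpa using hv)) w hw.ge,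
        add_comm]
      rfl
    | 1 =>
      rw [List.count_cons_self] at hw
      subst hw
      simp only [changeSome, changeOne, List.map_map]
      exact ih (f ∘ (1 :: ·)) _ (fun v hv => hf _ (by simpa using hv)) rfl

/-- A derivation of weight zero fixed by the unipotent elements is annihilated by the raising
operator `y ↦ x`; here is the coefficient of a word in this relation. -/
theorem sum_changeOne_eq_zero {D : Der} (k : ℕ) (hD : spRep (unipotent 1) D = D)
    (hf : ∀ v : List (Fin 2), v.count 1 ≠ k + 1 → coeff v (derToTensor D) = 0)
    {w : List (Fin 2)} (hw : w.count 1 = k) :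
    ((changeOne w).map fun v => coeff v (derToTensor D)).sum = 0 := by
  rw [← sum_changeSome_eq_sum_changeOne _ k hf w hw, ← coeff_spT_unipotent_one,
    ← derToTensor_spRep, hD]
  exact hf w (by omega)

/-! ### The derivations `ε₂ₖ` -/

theorem adx_zero : adx 0 = y := rfl

theorem adx_succ (j : ℕ) : adx (j + 1) = ⁅x, adx j⁆ := Function.iterate_succ_apply' _ _ _

theorem adx_mem_freeLieDeg (j : ℕ) : adx j ∈ freeLieDeg (j + 1) := by
  induction j with
  | zero => exact of_mem_freeLieDeg 1
  | succ j ih => rw [adx_succ]; exact of_lie_mem_freeLieDeg 0 ih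

theorem eps_x (k : ℕ) : eps k x = adx (2 * k) := derLift_of _ 0

theorem eps_y (k : ℕ) :
    eps k y = ∑ j ∈ Finset.range k, (-1 : ℚ) ^ j • ⁅adx j, adx (2 * k - 1 - j)⁆ := derLift_of _ 1

theorem eps_omega (k : ℕ) : eps k ⁅x, y⁆ = 0 := by
  have hsum : ⁅x, eps k y⁆ = ∑ j ∈ Finset.range k,
      ((-1 : ℚ) ^ j • ⁅adx j, adx (2 * k - j)⁆ -
        (-1 : ℚ) ^ (j + 1) • ⁅adx (j + 1), adx (2 * k - (j + 1))⁆) := by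
    rw [eps_y, lie_sum]
    refine Finset.sum_congr rfl fun j hj => ?_
    have hj := Finset.mem_range.1 hj
    rw [lie_smul, leibniz_lie, ← adx_succ, ← adx_succ, show 2 * k - 1 - j + 1 = 2 * k - j by omega,
      show 2 * k - 1 - j = 2 * k - (j + 1) by omega, pow_succ]
    module
  rw [LieDerivation.apply_lie_eq_add, hsum, Finset.sum_range_sub', eps_x,
    show 2 * k - k = k by omega, lie_self, smul_zero, pow_zero, one_smul, Nat.sub_zero, sub_zero,
    adx_zero, ← lie_skew]
  exact neg_add_cancel (G := L) _

theorem eps_mem_hDeg (k : ℕ) : eps k ∈ hDeg (2 * k) := by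
  refine ⟨eps_omega k, fun i => ?_⟩
  fin_cases i
  · change eps k x ∈ _
    rw [eps_x]
    exact adx_mem_freeLieDeg _
  · change eps k y ∈ _
    rw [eps_y]
    refine Submodule.sum_mem _ fun j hj => Submodule.smul_mem _ _ ?_
    have hj := Finset.mem_range.1 hj
    have := lie_mem_freeLieDeg (adx_mem_freeLieDeg j) (adx_mem_freeLieDeg (2 * k - 1 - j))
    rwa [show j + 1 + (2 * k - 1 - j + 1) = 2 * k + 1 by omega] at this

theorem coeff_adx (n : ℕ) : coeff (List.replicate n 0 ++ [1]) (lieToTensor (adx n)) = 1 := by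
  induction n with
  | zero =>
    rw [adx_zero, y, lieToTensor_of, ← mul_one (FreeAlgebra.ι ℚ 1), List.replicate_zero,
      List.nil_append, coeff_cons_ι_mul, coeff_one]
    simp
  | succ n ih =>
    rw [adx_succ, lieToTensor_lie, map_sub, x, lieToTensor_of, coeff_concat_mul_ι,
      List.replicate_succ, List.cons_append, coeff_cons_ι_mul, ih]
    simp

theorem eps_ne_zero (k : ℕ) : eps k ≠ 0 := by
  intro h
  have := coeff_adx (2 * k)
  rw [← eps_x, h, LieDerivation.zero_apply, map_zero, map_zero] at this
  exact zero_ne_one this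

theorem spLie_unipotent_adx (s : ℚ) (j : ℕ) :
    spLie (unipotent s) (adx (j + 1)) = adx (j + 1) := by
  have hx : spLie (unipotent s) x = x := by
    rw [x, spLie_of]; simp [unipotent]
  have hy : spLie (unipotent s) y = s • x + y := by
    rw [y, spLie_of]; simp [unipotent, x]
  induction j with
  | zero => rw [adx_succ, adx_zero, LieHom.map_lie, hx, hy, lie_add, lie_smul, lie_self,
      smul_zero, zero_add]
  | succ j ih => rw [adx_succ, LieHom.map_lie, ih, hx]

theorem unipotent_eps {k : ℕ} (hk : 1 ≤ k) (s : ℚ) : spRep (unipotent s) (eps k) = eps k := by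
  have hy : spLie (unipotent s) y = s • x + y := by
    rw [y, spLie_of]; simp [unipotent, x]
  obtain ⟨k, rfl⟩ := Nat.exists_eq_add_of_le' hk
  have hx : spLie (unipotent s) (eps (k + 1) x) = eps (k + 1) x := by
    rw [eps_x, show 2 * (k + 1) = 2 * k + 1 + 1 by ring, spLie_unipotent_adx]
  apply der_ext
  intro i
  fin_cases i
  · change spRep (unipotent s) (eps (k + 1)) x = eps (k + 1) x
    rw [spRep_apply_x, hx]
    simp [unipotent]
  · change spRep (unipotent s) (eps (k + 1)) y = eps (k + 1) y
    rw [spRep_apply_y, hx, eps_y, map_sum, eps_x]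
    simp only [map_smul, LieHom.map_lie]
    have hz : ∀ j ∈ Finset.range k,
        (-1 : ℚ) ^ (j + 1) • ⁅spLie (unipotent s) (adx (j + 1)),
          spLie (unipotent s) (adx (2 * (k + 1) - 1 - (j + 1)))⁆ =
        (-1 : ℚ) ^ (j + 1) • ⁅adx (j + 1), adx (2 * (k + 1) - 1 - (j + 1))⁆ := by
      intro j hj
      have hj := Finset.mem_range.1 hj
      rw [show 2 * (k + 1) - 1 - (j + 1) = (2 * k - j - 1) + 1 by omega, spLie_unipotent_adx,
        spLie_unipotent_adx]
    rw [Finset.sum_range_succ', Finset.sum_congr rfl hz, Finset.sum_range_succ', adx_zero, hy,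
      show 2 * (k + 1) - 1 - 0 = 2 * k + 1 by omega, spLie_unipotent_adx,
      show 2 * (k + 1) = 2 * k + 1 + 1 by ring, adx_succ (2 * k + 1), add_lie, smul_lie]
    simp [unipotent]
    abel

theorem torus_adx (s : ℚˣ) (j : ℕ) :
    spLie (torus s) (adx j) = ((s : ℚ) ^ j * (s : ℚ)⁻¹) • adx j := by
  have hx : spLie (torus s) x = (s : ℚ) • x := by
    rw [x, spLie_of]; simp [torus]
  induction j with
  | zero => rw [adx_zero, y, spLie_of]; simp [torus]
  | succ j ih => rw [adx_succ, LieHom.map_lie, ih, hx, smul_lie, lie_smul, smul_smul]; congr 1; ring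

theorem torus_eps {k : ℕ} (hk : 1 ≤ k) (s : ℚˣ) :
    spRep (torus s) (eps k) = (s : ℚ) ^ (2 * k - 2) • eps k := by
  have hs : (s : ℚ) ≠ 0 := s.ne_zero
  obtain ⟨k, rfl⟩ := Nat.exists_eq_add_of_le' hk
  rw [show 2 * (k + 1) - 2 = 2 * k by omega]
  apply der_ext
  intro i
  fin_cases i
  · change spRep (torus s) (eps (k + 1)) x = (s : ℚ) ^ (2 * k) • eps (k + 1) x
    rw [spRep_apply_x, eps_x, torus_adx]
    simp only [torus, Matrix.of_apply, Matrix.cons_val', Matrix.cons_val_zero,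
      Matrix.cons_val_one, Matrix.cons_val_fin_one, zero_smul, sub_zero, smul_smul,
      Units.val_inv_eq_inv_val]
    congr 1
    field_simp
    ring
  · change spRep (torus s) (eps (k + 1)) y = (s : ℚ) ^ (2 * k) • eps (k + 1) y
    rw [spRep_apply_y, eps_y, map_sum]
    simp only [map_smul, LieHom.map_lie, torus_adx, smul_lie, lie_smul, Finset.smul_sum]
    simp only [torus, Matrix.of_apply, Matrix.cons_val', Matrix.cons_val_zero,
      Matrix.cons_val_one, Matrix.cons_val_fin_one, zero_smul, sub_zero, smul_smul]
    refine Finset.sum_congr rfl fun j hj => ?_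
    have hj := Finset.mem_range.1 hj
    congr 1
    have e : (s : ℚ) ^ j * (s : ℚ) ^ (2 * (k + 1) - 1 - j) = (s : ℚ) ^ (2 * k) * s := by
      rw [← pow_add, ← pow_succ]
      congr 1
      omega
    calc (s : ℚ) * ((-1) ^ j * ((s : ℚ) ^ (2 * (k + 1) - 1 - j) * (s : ℚ)⁻¹ *
          ((s : ℚ) ^ j * (s : ℚ)⁻¹)))
        = (-1) ^ j * ((s : ℚ) ^ j * (s : ℚ) ^ (2 * (k + 1) - 1 - j)) * (s : ℚ)⁻¹ *
            ((s : ℚ) * (s : ℚ)⁻¹) := by ring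
      _ = (s : ℚ) ^ (2 * k) * (-1) ^ j := by
        rw [e, mul_inv_cancel₀ hs]
        field_simp

theorem isHighestWeightVector_eps {k : ℕ} (hk : 1 ≤ k) :
    IsHighestWeightVector (2 * k - 2) (eps k) :=
  ⟨eps_ne_zero k, unipotent_eps hk, torus_eps hk⟩

/-! ### Weight spaces of `𝔥_{1,1}(2k)` -/

theorem eq_replicate_of_count_eq_zero {i j : Fin 2} (hij : i ≠ j) {w : List (Fin 2)}
    (h : w.count i = 0) : w = List.replicate w.length j := by
  refine List.eq_replicate_of_mem fun a ha => ?_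
  by_contra hne
  have : a = i := by
    fin_cases a <;> fin_cases i <;> fin_cases j <;> simp_all
  subst this
  exact List.count_eq_zero.1 h ha

theorem count_zero_add_count_one (w : List (Fin 2)) : w.count 0 + w.count 1 = w.length := by
  induction w with
  | nil => rfl
  | cons i w ih =>
    fin_cases i
    · simp; omega
    · simp; omega

theorem exists_rotate_eq_cons {i : Fin 2} {w : List (Fin 2)} (h : i ∈ w) :
    ∃ k w', w.rotate k = i :: w' ∧ ∀ j, w.count j = (i :: w').count j := by
  obtain ⟨u, v, rfl⟩ := List.append_of_mem h
  refine ⟨u.length, v ++ u, by rw [List.rotate_append_length_eq, List.cons_append], fun j => ?_⟩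
  simp only [List.count_append, List.count_cons]
  omega

/-- The weight `2k - 2` part of `𝔥_{1,1}(2k)` is at most one-dimensional: all the words in the
tensor of `D` have exactly two letters `y`, and can be rotated to begin with `y`. -/
theorem eq_zero_of_weight_of_coeff {k : ℕ} {D : Der} (hD : D ∈ hDeg (2 * k))
    (hwt : ∀ s : ℚˣ, spRep (torus s) D = (s : ℚ) ^ (2 * k - 2 : ℤ) • D)
    (h : coeff (List.replicate (2 * k) 0 ++ [1]) (lieToTensor (D x)) = 0) : D = 0 := by
  apply eq_zero_of_derToTensor_eq_zero hD
  apply ext_coeff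
  intro w
  rw [map_zero]
  by_cases hl : w.length = 2 * k + 2
  swap
  · exact coeff_derToTensor_of_length_ne hD hl
  by_cases hc : (w.count 0 : ℤ) - w.count 1 = 2 * k - 2
  swap
  · exact coeff_eq_zero_of_weight hwt hc
  have hsum := count_zero_add_count_one w
  obtain ⟨r, w', hr, hcount⟩ :=
    exists_rotate_eq_cons (List.count_pos_iff.1 (show 0 < w.count 1 by omega))
  rw [← coeff_rotate_derToTensor hD.1 w r, hr, coeff_one_cons_derToTensor]
  have h1 := hcount 1
  rw [List.count_cons_self] at h1
  have hl' := congrArg List.length hr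
  rw [List.length_rotate, List.length_cons] at hl'
  obtain ⟨u, v, rfl⟩ := List.append_of_mem (List.count_pos_iff.1 (show 0 < w'.count 1 by omega))
  rw [List.count_append, List.count_cons_self] at h1
  rw [eq_replicate_of_count_eq_zero (j := 0) (by decide) (show u.count 1 = 0 by omega),
    eq_replicate_of_count_eq_zero (j := 0) (by decide) (show v.count 1 = 0 by omega)]
  refine coeff_single_one_lieToTensor h _ _ ?_
  rw [List.length_append, List.length_cons] at hl'
  omega

theorem exists_eq_smul_eps {k : ℕ} (hk : 1 ≤ k) {D : Der} (hD : D ∈ hDeg (2 * k))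
    (hwt : ∀ s : ℚˣ, spRep (torus s) D = (s : ℚ) ^ (2 * k - 2) • D) : ∃ c : ℚ, D = c • eps k := by
  refine ⟨coeff (List.replicate (2 * k) 0 ++ [1]) (lieToTensor (D x)), sub_eq_zero.1 ?_⟩
  refine eq_zero_of_weight_of_coeff (sub_mem hD (Submodule.smul_mem _ _ (eps_mem_hDeg k)))
    (fun s => ?_) ?_
  · rw [map_sub, map_smul, hwt, torus_eps hk, smul_sub, smul_comm,
      show (2 * (k : ℤ) - 2) = ((2 * k - 2 : ℕ) : ℤ) by push_cast [show 2 ≤ 2 * k by omega]; rfl,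
      zpow_natCast]
  · rw [LieDerivation.sub_apply, LieDerivation.smul_apply, eps_x, map_sub, map_smul, map_sub,
      map_smul, coeff_adx, smul_eq_mul, mul_one, sub_self]

/-- There are no weights below `-(2k - 2)` in `𝔥_{1,1}(2k)`. -/
theorem eq_zero_of_low_weight {k : ℕ} (hk : 1 ≤ k) {D : Der} (hD : D ∈ hDeg (2 * k)) {m : ℤ}
    (hm : m < 2 - 2 * k) (hwt : ∀ s : ℚˣ, spRep (torus s) D = (s : ℚ) ^ m • D) : D = 0 := by
  apply eq_zero_of_derToTensor_eq_zero hD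
  apply ext_coeff
  intro w
  rw [map_zero]
  by_cases hl : w.length = 2 * k + 2
  swap
  · exact coeff_derToTensor_of_length_ne hD hl
  by_cases hc : (w.count 0 : ℤ) - w.count 1 = m
  swap
  · exact coeff_eq_zero_of_weight hwt hc
  have hsum := count_zero_add_count_one w
  by_cases h0 : w.count 0 = 0
  · rw [eq_replicate_of_count_eq_zero (j := 1) (by decide) h0, hl, List.replicate_succ,
      coeff_one_cons_derToTensor, coeff_replicate_lieToTensor _ _ (by omega)]
  · obtain ⟨r, w', hr, hcount⟩ :=
      exists_rotate_eq_cons (List.count_pos_iff.1 (Nat.pos_of_ne_zero h0))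
    have h1 := hcount 0
    rw [List.count_cons_self] at h1
    have hl' := congrArg List.length hr
    rw [List.length_rotate, List.length_cons] at hl'
    rw [← coeff_rotate_derToTensor hD.1 w r, hr, coeff_zero_cons_derToTensor,
      eq_replicate_of_count_eq_zero (j := 1) (by decide) (show w'.count 0 = 0 by omega),
      coeff_replicate_lieToTensor _ _ (by omega), neg_zero]

/-! ### Polynomial maps -/

/-- Maps from `ℚ` to a vector space which are polynomial. -/
def polyMaps (M : Type*) [AddCommGroup M] [Module ℚ M] : Submodule ℚ (ℚ → M) :=
  Submodule.span ℚ {f | ∃ (j : ℕ) (m : M), f = fun s => s ^ j • m}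

section polyMaps

variable {M N : Type*} [AddCommGroup M] [Module ℚ M] [AddCommGroup N] [Module ℚ N]

theorem monomial_mem_polyMaps (j : ℕ) (m : M) : (fun s => s ^ j • m) ∈ polyMaps M :=
  Submodule.subset_span ⟨j, m, rfl⟩

theorem const_mem_polyMaps (m : M) : (fun _ => m) ∈ polyMaps M := by
  simpa using monomial_mem_polyMaps 0 m

theorem comp_mem_polyMaps (φ : M →ₗ[ℚ] N) {f : ℚ → M} (hf : f ∈ polyMaps M) :
    (fun s => φ (f s)) ∈ polyMaps N := by
  induction hf using Submodule.span_induction with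
  | mem f hf =>
    obtain ⟨j, m, rfl⟩ := hf
    simpa using monomial_mem_polyMaps j (φ m)
  | zero => simpa using const_mem_polyMaps (0 : N)
  | add f g _ _ hf hg => simpa using! add_mem hf hg
  | smul c f _ hf => simpa using! Submodule.smul_mem _ c hf

theorem mul_mem_polyMaps {f : ℚ → M} (hf : f ∈ polyMaps M) :
    (fun s => s • f s) ∈ polyMaps M := by
  induction hf using Submodule.span_induction with
  | mem f hf =>
    obtain ⟨j, m, rfl⟩ := hf
    simpa [smul_smul, ← pow_succ'] using monomial_mem_polyMaps (j + 1) m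
  | zero => simpa using const_mem_polyMaps (0 : M)
  | add f g _ _ hf hg => simpa using! add_mem hf hg
  | smul c f _ hf => simpa [smul_comm _ c] using! Submodule.smul_mem _ c hf

theorem lie_mem_polyMaps {f g : ℚ → L} (hf : f ∈ polyMaps L) (hg : g ∈ polyMaps L) :
    (fun s => ⁅f s, g s⁆) ∈ polyMaps L := by
  induction hf using Submodule.span_induction with
  | mem f hf =>
    obtain ⟨j, m, rfl⟩ := hf
    induction hg using Submodule.span_induction with
    | mem g hg =>
      obtain ⟨i, m', rfl⟩ := hg
      simpa [smul_smul, ← pow_add] using monomial_mem_polyMaps (i + j) ⁅m, m'⁆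
    | zero => simpa using const_mem_polyMaps (0 : L)
    | add f g _ _ hf hg => simpa [add_comm] using! add_mem hf hg
    | smul c f _ hf => simpa [smul_comm _ c] using! Submodule.smul_mem _ c hf
  | zero => simpa using const_mem_polyMaps (0 : L)
  | add f g _ _ hf hg => simpa using! add_mem hf hg
  | smul c f _ hf => simpa using! Submodule.smul_mem _ c hf

theorem exists_eq_sum_of_mem_polyMaps {f : ℚ → M} (hf : f ∈ polyMaps M) :
    ∃ (m : ℕ → M) (n : ℕ), (∀ j, n ≤ j → m j = 0) ∧
      ∀ s, f s = ∑ j ∈ Finset.range n, s ^ j • m j := by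
  have key : ∃ p : ℕ →₀ M, ∀ s, f s = p.sum fun j m => s ^ j • m := by
    induction hf using Submodule.span_induction with
    | mem f hf =>
      obtain ⟨j, m, rfl⟩ := hf
      exact ⟨Finsupp.single j m, fun s => by simp⟩
    | zero => exact ⟨0, fun s => by simp⟩
    | add f g _ _ hf hg =>
      obtain ⟨p, hp⟩ := hf
      obtain ⟨q, hq⟩ := hg
      refine ⟨p + q, fun s => ?_⟩
      rw [Finsupp.sum_add_index' (by simp) (by simp), Pi.add_apply, hp, hq]
    | smul c f _ hf =>
      obtain ⟨p, hp⟩ := hf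
      refine ⟨c • p, fun s => ?_⟩
      rw [Finsupp.sum_smul_index' (by simp), Pi.smul_apply, hp, Finsupp.smul_sum]
      simp only [smul_comm c]
  obtain ⟨p, hp⟩ := key
  have hb : ∀ j, p.support.sup id + 1 ≤ j → p j = 0 := fun j hj => by
    by_contra h
    have := Finset.le_sup (f := id) (Finsupp.mem_support_iff.2 h)
    simp only [id] at this
    omega
  refine ⟨p, p.support.sup id + 1, hb, fun s => ?_⟩
  rw [hp, Finsupp.sum_of_support_subset _ _ _ (by simp)]
  intro j hj
  by_contra h
  exact Finsupp.mem_support_iff.1 hj (hb j (by simpa using h))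

/-- A polynomial with coefficients in a vector space which vanishes infinitely often is zero. -/
theorem eq_zero_of_sum_pow_smul_eq_zero {m : ℕ → M} {n : ℕ} {S : Set ℚ} (hS : S.Infinite)
    (h : ∀ s ∈ S, ∑ j ∈ Finset.range n, s ^ j • m j = 0) {j : ℕ} (hj : j < n) : m j = 0 := by
  rw [← Module.forall_dual_apply_eq_zero_iff ℚ]
  intro φ
  let p : Polynomial ℚ := ∑ j ∈ Finset.range n, Polynomial.C (φ (m j)) * Polynomial.X ^ j
  have hp : p = 0 := by
    refine Polynomial.eq_zero_of_infinite_isRoot _ (hS.mono fun s hs => ?_)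
    have e := congrArg φ (h s hs)
    simp only [map_sum, map_smul, smul_eq_mul, map_zero] at e
    simp only [p, Set.mem_ofPred_eq, Polynomial.IsRoot, Polynomial.eval_finsetSum,
      Polynomial.eval_mul, Polynomial.eval_C, Polynomial.eval_pow, Polynomial.eval_X]
    simpa only [mul_comm] using e
  have e := congrArg (fun q => Polynomial.coeff q j) hp
  simpa [p, Polynomial.finsetSum_coeff, Polynomial.coeff_X_pow, hj] using e

theorem mem_of_sum_pow_smul_mem {m : ℕ → M} {n : ℕ} {S : Set ℚ} (hS : S.Infinite)
    (P : Submodule ℚ M) (h : ∀ s ∈ S, ∑ j ∈ Finset.range n, s ^ j • m j ∈ P) {j : ℕ}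
    (hj : j < n) : m j ∈ P := by
  rw [← Submodule.Quotient.mk_eq_zero]
  refine eq_zero_of_sum_pow_smul_eq_zero (m := fun j => P.mkQ (m j)) hS (fun s hs => ?_) hj
  have := (Submodule.Quotient.mk_eq_zero P).2 (h s hs)
  rw [← Submodule.mkQ_apply, map_sum] at this
  simpa using this

end polyMaps

/-! ### The irreducible module generated by `ε₂ₖ` -/

/-- The unipotent element `x ↦ x + s y`, `y ↦ y`. -/
def lowerUnipotent (s : ℚ) : Sp2 := ⟨!![1, 0; s, 1], by simp [Matrix.det_fin_two]⟩

theorem spLie_lowerUnipotent_mem_polyMaps (a : L) :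
    (fun s => spLie (lowerUnipotent s) a) ∈ polyMaps L := by
  induction a using lie_induction with
  | hof i =>
    have : (fun s => spLie (lowerUnipotent s) (FreeLieAlgebra.of ℚ i)) =
        (fun _ => FreeLieAlgebra.of ℚ i) +
          fun s => s • if i = 0 then FreeLieAlgebra.of ℚ (1 : Fin 2) else 0 := by
      funext s
      rw [spLie_of]
      fin_cases i <;> simp [lowerUnipotent]
    rw [this]
    exact add_mem (const_mem_polyMaps _) (mul_mem_polyMaps (const_mem_polyMaps _))
  | hadd a b ha hb => simpa using! add_mem ha hb
  | hsmul c a ha => simpa using! Submodule.smul_mem _ c ha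
  | hlie a b ha hb => simpa using! lie_mem_polyMaps ha hb

/-- `derLift` as a linear map. -/
def derLiftLinear : (Fin 2 → L) →ₗ[ℚ] Der where
  toFun := derLift
  map_add' f g := der_ext fun i => by
    rw [LieDerivation.add_apply, derLift_of, derLift_of, derLift_of, Pi.add_apply]
  map_smul' c f := der_ext fun i => by
    rw [LieDerivation.smul_apply, derLift_of, derLift_of, Pi.smul_apply, RingHom.id_apply]

theorem spRep_lowerUnipotent_mem_polyMaps (D : Der) :
    (fun s => spRep (lowerUnipotent s) D) ∈ polyMaps Der := by
  have hx : (fun s => spRep (lowerUnipotent s) D x) ∈ polyMaps L := by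
    have : (fun s => spRep (lowerUnipotent s) D x) = (fun s => spLie (lowerUnipotent s) (D x)) -
        fun s => s • spLie (lowerUnipotent s) (D y) := by
      funext s
      rw [spRep_apply_x]
      simp [lowerUnipotent]
    rw [this]
    exact sub_mem (spLie_lowerUnipotent_mem_polyMaps _)
      (mul_mem_polyMaps (spLie_lowerUnipotent_mem_polyMaps _))
  have hy : (fun s => spRep (lowerUnipotent s) D y) ∈ polyMaps L := by
    have : (fun s => spRep (lowerUnipotent s) D y) =
        fun s => spLie (lowerUnipotent s) (D y) := by
      funext s
      rw [spRep_apply_y]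
      simp [lowerUnipotent]
    rw [this]
    exact spLie_lowerUnipotent_mem_polyMaps _
  have : (fun s => spRep (lowerUnipotent s) D) =
      (fun s => derLiftLinear (LinearMap.single ℚ (fun _ => L) 0
        (spRep (lowerUnipotent s) D x))) +
      fun s => derLiftLinear (LinearMap.single ℚ (fun _ => L) 1
        (spRep (lowerUnipotent s) D y)) := by
    funext s
    rw [Pi.add_apply, ← map_add]
    apply der_ext
    intro i
    change _ = derLift _ _
    rw [derLift_of]
    fin_cases i
    · simp [x]
    · simp [y]
  rw [this]
  exact add_mem (comp_mem_polyMaps (derLiftLinear ∘ₗ LinearMap.single ℚ (fun _ => L) 0) hx)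
    (comp_mem_polyMaps (derLiftLinear ∘ₗ LinearMap.single ℚ (fun _ => L) 1) hy)

theorem coe_mul_apply (g h : Sp2) (i j : Fin 2) :
    ((g * h : Sp2) : Matrix (Fin 2) (Fin 2) ℚ) i j =
      (g : Matrix (Fin 2) (Fin 2) ℚ) i 0 * (h : Matrix (Fin 2) (Fin 2) ℚ) 0 j +
        (g : Matrix (Fin 2) (Fin 2) ℚ) i 1 * (h : Matrix (Fin 2) (Fin 2) ℚ) 1 j := by
  rw [Matrix.SpecialLinearGroup.coe_mul, Matrix.mul_apply, Fin.sum_univ_two]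

theorem coe_torus (t : ℚˣ) :
    (torus t : Matrix (Fin 2) (Fin 2) ℚ) = !![(t : ℚ), 0; 0, ((t⁻¹ : ℚˣ) : ℚ)] := rfl

theorem coe_unipotent (s : ℚ) : (unipotent s : Matrix (Fin 2) (Fin 2) ℚ) = !![1, s; 0, 1] := rfl

theorem coe_lowerUnipotent (s : ℚ) :
    (lowerUnipotent s : Matrix (Fin 2) (Fin 2) ℚ) = !![1, 0; s, 1] := rfl

theorem torus_mul_lowerUnipotent (t : ℚˣ) (s : ℚ) :
    torus t * lowerUnipotent s = lowerUnipotent (s * ((t : ℚ)⁻¹) ^ 2) * torus t := by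
  ext i j
  have ht : (t : ℚ) ≠ 0 := t.ne_zero
  rw [coe_mul_apply, coe_mul_apply, coe_torus, coe_lowerUnipotent, coe_lowerUnipotent]
  fin_cases i <;> fin_cases j <;> simp
  field_simp

theorem eq_lowerUnipotent_mul (g : Sp2) (a : ℚˣ) (ha : (g : Matrix (Fin 2) (Fin 2) ℚ) 0 0 = a) :
    g = lowerUnipotent ((g : Matrix (Fin 2) (Fin 2) ℚ) 1 0 * (a : ℚ)⁻¹) * torus a *
      unipotent ((g : Matrix (Fin 2) (Fin 2) ℚ) 0 1 * (a : ℚ)⁻¹) := by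
  have ha' : (a : ℚ) ≠ 0 := a.ne_zero
  have hdet := g.det_coe
  rw [Matrix.det_fin_two, ha] at hdet
  ext i j
  rw [coe_mul_apply, coe_mul_apply, coe_mul_apply, coe_torus, coe_lowerUnipotent, coe_unipotent]
  fin_cases i <;> fin_cases j <;> simp
  · exact ha
  · field_simp
  · field_simp
    linarith

/-- The expansion `exp(sF) ε₂ₖ = ∑ⱼ sʲ wⱼ` along the orbit of the lower unipotent subgroup; it ends
at `j = 2k - 2` because there are no weights below `-(2k - 2)`. -/
theorem exists_orbit_expansion {k : ℕ} (hk : 1 ≤ k) :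
    ∃ w : ℕ → Der, w 0 = eps k ∧ (∀ j, w j ∈ hDeg (2 * k)) ∧
      ∀ s, spRep (lowerUnipotent s) (eps k) =
        ∑ j ∈ Finset.range (2 * k - 2 + 1), s ^ j • w j := by
  obtain ⟨w, n, hw, hsum⟩ :=
    exists_eq_sum_of_mem_polyMaps (spRep_lowerUnipotent_mem_polyMaps (eps k))
  have hmem : ∀ j, w j ∈ hDeg (2 * k) := by
    intro j
    by_cases hj : j < n
    · refine mem_of_sum_pow_smul_mem Set.infinite_univ _ (fun s _ => ?_) hj
      rw [← hsum]
      exact spRep_mem_hDeg _ (eps_mem_hDeg k)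
    · rw [hw j (not_lt.1 hj)]
      exact zero_mem _
  have hwt : ∀ (j : ℕ) (t : ℚˣ),
      spRep (torus t) (w j) = (t : ℚ) ^ ((2 * k - 2 : ℤ) - 2 * j) • w j := by
    intro j t
    have ht : (t : ℚ) ≠ 0 := t.ne_zero
    by_cases hj : j < n
    · rw [← sub_eq_zero]
      refine eq_zero_of_sum_pow_smul_eq_zero
        (m := fun j => spRep (torus t) (w j) - (t : ℚ) ^ ((2 * k - 2 : ℤ) - 2 * j) • w j)
        Set.infinite_univ (fun s _ => ?_) hj
      have e : spRep (torus t) (spRep (lowerUnipotent s) (eps k)) =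
          (t : ℚ) ^ (2 * k - 2) • spRep (lowerUnipotent (s * ((t : ℚ)⁻¹) ^ 2)) (eps k) := by
        rw [← map_smul, ← torus_eps hk, ← Module.End.mul_apply, ← Module.End.mul_apply, ← map_mul,
          ← map_mul, torus_mul_lowerUnipotent]
      rw [hsum, hsum, map_sum, Finset.smul_sum, ← sub_eq_zero, ← Finset.sum_sub_distrib] at e
      rw [← e]
      refine Finset.sum_congr rfl fun j _ => ?_
      rw [smul_sub, map_smul, smul_smul, smul_smul]
      congr 2
      rw [zpow_sub₀ ht, zpow_mul, mul_pow, ← pow_mul,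
        show (2 * (k : ℤ) - 2) = ((2 * k - 2 : ℕ) : ℤ) by push_cast [show 2 ≤ 2 * k by omega]; rfl,
        zpow_natCast, inv_pow, div_eq_mul_inv, show (t : ℚ) ^ (2 : ℤ) = (t : ℚ) ^ 2 from rfl,
        zpow_natCast, pow_mul]
      ring
    · rw [hw j (not_lt.1 hj), map_zero, smul_zero]
  have hhigh : ∀ j, 2 * k - 2 < j → w j = 0 := fun j hj =>
    eq_zero_of_low_weight hk (hmem j) (by omega) (hwt j)
  have hsum' : ∀ s, spRep (lowerUnipotent s) (eps k) =
        ∑ j ∈ Finset.range (2 * k - 2 + 1), s ^ j • w j := by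
    intro s
    rw [hsum]
    trans ∑ j ∈ Finset.range (n + (2 * k - 2 + 1)), s ^ j • w j
    · refine Finset.sum_subset (by intro j; simp; omega) fun j _ hj => ?_
      rw [hw j (by simpa using hj), smul_zero]
    · refine (Finset.sum_subset (by intro j; simp; omega) fun j _ hj => ?_).symm
      rw [hhigh j (by simp at hj; omega), smul_zero]
  refine ⟨w, ?_, hmem, hsum'⟩
  have e := hsum' 0
  have h1 : lowerUnipotent 0 = 1 := by
    ext i j
    fin_cases i <;> fin_cases j <;> simp [lowerUnipotent]
  rw [h1, map_one, Module.End.one_apply, Finset.sum_range_succ', Finset.sum_eq_zero] at e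
  · simpa using e.symm
  · intro j _
    simp

theorem infinite_setOf_ne_zero (r : ℚ) : {s : ℚ | 1 + r * s ≠ 0}.Infinite := by
  have hfin : {s : ℚ | 1 + r * s = 0}.Finite := by
    refine Set.Subsingleton.finite fun s hs s' hs' => ?_
    simp only [Set.mem_ofPred_eq] at hs hs'
    have hr : r ≠ 0 := by
      rintro rfl
      simp at hs
    exact mul_left_cancel₀ hr (by linarith)
  exact hfin.infinite_compl

/-- The action of the unipotent elements on the vectors `wⱼ`, obtained by comparing coefficients
in `U(r) L(s) ε = (1 + r s)ᵐ L(s / (1 + r s)) ε`. -/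
theorem unipotent_orbit_expansion {k : ℕ} (hk : 1 ≤ k) {w : ℕ → Der}
    (hw : ∀ s, spRep (lowerUnipotent s) (eps k) =
        ∑ j ∈ Finset.range (2 * k - 2 + 1), s ^ j • w j) (r : ℚ) {i : ℕ}
    (hi : i < 2 * k - 2 + 1) :
    spRep (unipotent r) (w i) = ∑ j ∈ Finset.range (2 * k - 2 + 1),
      ((Polynomial.X ^ j * (1 + Polynomial.C r * Polynomial.X) ^ (2 * k - 2 - j) :
        Polynomial ℚ).coeff i) • w j := by
  set m := 2 * k - 2 with hm
  set p : ℕ → Polynomial ℚ :=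
    fun j => Polynomial.X ^ j * (1 + Polynomial.C r * Polynomial.X) ^ (m - j) with hp
  rw [← sub_eq_zero]
  refine eq_zero_of_sum_pow_smul_eq_zero
    (m := fun i => spRep (unipotent r) (w i) - ∑ j ∈ Finset.range (m + 1), (p j).coeff i • w j)
    (infinite_setOf_ne_zero r) (fun s hs => ?_) hi
  have hs : 1 + r * s ≠ 0 := hs
  have hdeg : ∀ j ∈ Finset.range (m + 1), (p j).natDegree < m + 1 := by
    intro j hj
    have hj := Finset.mem_range.1 hj
    have h1 : (1 + Polynomial.C r * Polynomial.X : Polynomial ℚ).natDegree ≤ 1 := by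
      compute_degree
    have h2 := Polynomial.natDegree_pow_le_of_le (m - j) h1
    have h3 := Polynomial.natDegree_mul_le (p := (Polynomial.X : Polynomial ℚ) ^ j)
      (q := (1 + Polynomial.C r * Polynomial.X) ^ (m - j))
    rw [Polynomial.natDegree_X_pow] at h3
    simp only [hp]
    omega
  have e1 : spRep (unipotent r) (spRep (lowerUnipotent s) (eps k)) =
      (1 + r * s) ^ m • spRep (lowerUnipotent (s * (1 + r * s)⁻¹)) (eps k) := by
    have hg := eq_lowerUnipotent_mul (unipotent r * lowerUnipotent s) (Units.mk0 _ hs)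
      (by rw [coe_mul_apply, coe_unipotent, coe_lowerUnipotent]; simp)
    have h10 : ((unipotent r * lowerUnipotent s : Sp2) : Matrix (Fin 2) (Fin 2) ℚ) 1 0 = s := by
      rw [coe_mul_apply, coe_unipotent, coe_lowerUnipotent]; simp
    rw [h10] at hg
    rw [← Module.End.mul_apply, ← map_mul, hg, map_mul, map_mul, Module.End.mul_apply,
      Module.End.mul_apply, unipotent_eps hk, torus_eps hk, map_smul]
    rfl
  rw [hw, hw, map_sum, Finset.smul_sum] at e1
  have e2 : ∀ j ∈ Finset.range (m + 1),
      (1 + r * s) ^ m • (s * (1 + r * s)⁻¹) ^ j • w j =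
        ∑ i ∈ Finset.range (m + 1), s ^ i • (p j).coeff i • w j := by
    intro j hj
    have h := Polynomial.eval_eq_sum_range' (hdeg j hj) s
    simp only [smul_smul]
    rw [← Finset.sum_smul]
    congr 1
    simp only [mul_comm (s ^ _)]
    rw [← h]
    have hj := Finset.mem_range.1 hj
    simp only [hp, Polynomial.eval_mul, Polynomial.eval_pow, Polynomial.eval_X,
      Polynomial.eval_add, Polynomial.eval_one, Polynomial.eval_C]
    rw [show (1 + r * s) ^ m = (1 + r * s) ^ (m - j) * (1 + r * s) ^ j by
      rw [← pow_add]; congr 1; omega]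
    rw [mul_pow, inv_pow]
    field_simp
  rw [Finset.sum_congr rfl e2, Finset.sum_comm, ← sub_eq_zero, ← Finset.sum_sub_distrib] at e1
  rw [← e1]
  refine Finset.sum_congr rfl fun i _ => ?_
  rw [smul_sub, map_smul, Finset.smul_sum]

/-- The span of `w₀, …, wᵢ₋₁`. -/
def initialSpan (w : ℕ → Der) (i : ℕ) : Submodule ℚ Der := Submodule.span ℚ (w '' Set.Iio i)

theorem mem_initialSpan (w : ℕ → Der) {i j : ℕ} (h : j < i) : w j ∈ initialSpan w i :=
  Submodule.subset_span ⟨j, h, rfl⟩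

theorem initialSpan_mono (w : ℕ → Der) {i j : ℕ} (h : i ≤ j) :
    initialSpan w i ≤ initialSpan w j :=
  Submodule.span_mono (Set.image_mono (Set.Iio_subset_Iio h))

theorem mem_initialSpan_succ (w : ℕ → Der) {i : ℕ} {v : Der} (hv : v ∈ initialSpan w (i + 1)) :
    ∃ (c : ℚ) (z : Der), z ∈ initialSpan w i ∧ v = c • w i + z := by
  have h : w '' Set.Iio (i + 1) = insert (w i) (w '' Set.Iio i) := by
    rw [← Set.image_insert_eq]
    congr 1
    ext j
    simp
  rw [initialSpan, h, Submodule.mem_span_insert] at hv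
  exact hv

/-- The submodule generated by `ε₂ₖ`. -/
def epsModule (k : ℕ) : Subrepresentation spRep where
  toSubmodule := Submodule.span ℚ (Set.range fun g => spRep g (eps k))
  apply_mem_toSubmodule g v hv := by
    induction hv using Submodule.span_induction with
    | mem v hv =>
      obtain ⟨h, rfl⟩ := hv
      refine Submodule.subset_span ⟨g * h, ?_⟩
      change spRep (g * h) (eps k) = spRep g (spRep h (eps k))
      rw [map_mul, Module.End.mul_apply]
    | zero => rw [map_zero]; exact zero_mem _
    | add a b _ _ ha hb => rw [map_add]; exact add_mem ha hb
    | smul c a _ ha => rw [map_smul]; exact Submodule.smul_mem _ _ ha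

theorem eps_mem_epsModule (k : ℕ) : eps k ∈ epsModule k :=
  Submodule.subset_span ⟨1, by
    change spRep 1 (eps k) = eps k
    rw [map_one, Module.End.one_apply]⟩

theorem epsModule_le {k : ℕ} (P : Submodule ℚ Der) (hP : ∀ g, ∀ v ∈ P, spRep g v ∈ P)
    (h : eps k ∈ P) : (epsModule k).toSubmodule ≤ P :=
  Submodule.span_le.2 (by rintro _ ⟨g, rfl⟩; exact hP g _ h)

theorem epsModule_le_initialSpan {k : ℕ} (hk : 1 ≤ k) {w : ℕ → Der}
    (hw : ∀ s, spRep (lowerUnipotent s) (eps k) =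
        ∑ j ∈ Finset.range (2 * k - 2 + 1), s ^ j • w j) :
    (epsModule k).toSubmodule ≤ initialSpan w (2 * k - 2 + 1) := by
  have hlow : ∀ s, spRep (lowerUnipotent s) (eps k) ∈ initialSpan w (2 * k - 2 + 1) := fun s => by
    rw [hw]
    exact Submodule.sum_mem _ fun j hj =>
      Submodule.smul_mem _ _ (mem_initialSpan w (Finset.mem_range.1 hj))
  have hup : ∀ r, ∀ v ∈ initialSpan w (2 * k - 2 + 1),
      spRep (unipotent r) v ∈ initialSpan w (2 * k - 2 + 1) := by
    intro r v hv
    induction hv using Submodule.span_induction with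
    | mem v hv =>
      obtain ⟨i, hi, rfl⟩ := hv
      rw [unipotent_orbit_expansion hk hw r hi]
      exact Submodule.sum_mem _ fun j hj =>
        Submodule.smul_mem _ _ (mem_initialSpan w (Finset.mem_range.1 hj))
    | zero => rw [map_zero]; exact zero_mem _
    | add a b _ _ ha hb => rw [map_add]; exact add_mem ha hb
    | smul c a _ ha => rw [map_smul]; exact Submodule.smul_mem _ _ ha
  have hne : ∀ g : Sp2, (g : Matrix (Fin 2) (Fin 2) ℚ) 0 0 ≠ 0 →
      spRep g (eps k) ∈ initialSpan w (2 * k - 2 + 1) := by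
    intro g hg
    rw [eq_lowerUnipotent_mul g (Units.mk0 _ hg) rfl, map_mul, map_mul, Module.End.mul_apply,
      Module.End.mul_apply, unipotent_eps hk, torus_eps hk, map_smul]
    exact Submodule.smul_mem _ _ (hlow _)
  refine Submodule.span_le.2 ?_
  rintro _ ⟨g, rfl⟩
  by_cases hg : (g : Matrix (Fin 2) (Fin 2) ℚ) 0 0 = 0
  · -- the product with a unipotent element has a nonzero upper left entry
    have hdet := g.det_coe
    rw [Matrix.det_fin_two, hg] at hdet
    have h1 : ((unipotent 1 * g : Sp2) : Matrix (Fin 2) (Fin 2) ℚ) 0 0 ≠ 0 := by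
      rw [coe_mul_apply, coe_unipotent, hg]
      intro h
      have h : (g : Matrix (Fin 2) (Fin 2) ℚ) 1 0 = 0 := by simpa using h
      rw [h] at hdet
      simp at hdet
    have h2 := hup (-1) _ (hne _ h1)
    rw [← Module.End.mul_apply, ← map_mul, ← mul_assoc] at h2
    have h3 : unipotent (-1) * unipotent 1 = 1 := by
      ext i j
      rw [coe_mul_apply, coe_unipotent, coe_unipotent]
      fin_cases i <;> fin_cases j <;> simp
    rwa [h3, one_mul] at h2
  · exact hne g hg

/-- Any nonzero invariant subspace of the module generated by `ε₂ₖ` contains `ε₂ₖ`: the operator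
`U(1) - 1` lowers the index of the last `wᵢ` which occurs in a vector by one. -/
theorem eps_mem_of_invariant {k : ℕ} (hk : 1 ≤ k) {W : Submodule ℚ Der}
    (hW : ∀ g, ∀ v ∈ W, spRep g v ∈ W) (hle : W ≤ (epsModule k).toSubmodule) (hne : W ≠ ⊥) :
    eps k ∈ W := by
  obtain ⟨w, hw0, -, hw⟩ := exists_orbit_expansion hk
  have hexp : ∀ i < 2 * k - 2 + 1, ∃ z ∈ initialSpan w (i - 1),
      spRep (unipotent 1) (w i) = w i + ((2 * k - 2 + 1 - i : ℕ) : ℚ) •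
        (if i = 0 then 0 else w (i - 1)) + z := by
    intro i hi
    rw [unipotent_orbit_expansion hk hw 1 hi]
    have hc : ∀ j, (Polynomial.X ^ j *
        (1 + Polynomial.C (1 : ℚ) * Polynomial.X) ^ (2 * k - 2 - j)).coeff i =
        if j ≤ i then ((2 * k - 2 - j).choose (i - j) : ℚ) else 0 := by
      intro j
      rw [map_one, one_mul, Polynomial.coeff_X_pow_mul', Polynomial.coeff_one_add_X_pow]
    simp only [hc]
    rw [← Finset.sum_subset (s₁ := Finset.range (i + 1)) (by intro j; simp; omega)
      (fun j _ hj => by rw [if_neg (by simpa using hj), zero_smul])]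
    cases i with
    | zero => exact ⟨0, zero_mem _, by simp⟩
    | succ i =>
      rw [Finset.sum_range_succ, Finset.sum_range_succ]
      refine ⟨∑ j ∈ Finset.range i,
        (if j ≤ i + 1 then ((2 * k - 2 - j).choose (i + 1 - j) : ℚ) else 0) • w j,
        Submodule.sum_mem _ fun j hj => Submodule.smul_mem _ _
          (mem_initialSpan w (Finset.mem_range.1 hj)), ?_⟩
      rw [if_pos le_rfl, if_pos (Nat.le_succ i), Nat.sub_self, Nat.choose_zero_right,
        show i + 1 - i = 1 by omega, Nat.choose_one_right, if_neg (Nat.succ_ne_zero i),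
        show 2 * k - 2 + 1 - (i + 1) = 2 * k - 2 - i by omega, Nat.add_sub_cancel]
      push_cast
      rw [one_smul]
      abel
  have hlower : ∀ i ≤ 2 * k - 2 + 1, ∀ z ∈ initialSpan w i,
      spRep (unipotent 1) z - z ∈ initialSpan w (i - 1) := by
    intro i hi z hz
    induction hz using Submodule.span_induction with
    | mem v hv =>
      obtain ⟨j, hj, rfl⟩ := hv
      have hj : j < i := hj
      obtain ⟨z, hz, e⟩ := hexp j (by omega)
      rw [e, add_assoc, add_sub_cancel_left]
      refine add_mem (Submodule.smul_mem _ _ ?_) (initialSpan_mono w (by omega) hz)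
      split_ifs
      · exact zero_mem _
      · exact mem_initialSpan w (by omega)
    | zero => rw [map_zero, sub_zero]; exact zero_mem _
    | add a b _ _ ha hb => rw [map_add, add_sub_add_comm]; exact add_mem ha hb
    | smul c a _ ha => rw [map_smul, ← smul_sub]; exact Submodule.smul_mem _ _ ha
  have hstep : ∀ i < 2 * k - 2 + 1, ∀ v ∈ W, ∀ c : ℚ, c ≠ 0 → ∀ z ∈ initialSpan w i,
      v = c • w i + z → eps k ∈ W := by
    intro i
    induction i with
    | zero =>
      intro _ v hv c hc z hz e
      have hz0 : z = 0 := by simpa [initialSpan] using hz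
      rw [hz0, add_zero, hw0] at e
      rw [e] at hv
      exact (Submodule.smul_mem_iff _ hc).1 hv
    | succ i ih =>
      intro hi v hv c hc z hz e
      obtain ⟨z', hz', e'⟩ := hexp (i + 1) hi
      refine ih (by omega) (spRep (unipotent 1) v - v) (sub_mem (hW _ _ hv) hv)
        (c * ((2 * k - 2 + 1 - (i + 1) : ℕ) : ℚ))
        (mul_ne_zero hc (Nat.cast_ne_zero.2 (by omega)))
        (c • z' + (spRep (unipotent 1) z - z))
        (add_mem (Submodule.smul_mem _ _ hz') (hlower (i + 1) hi.le z hz)) ?_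
      rw [e, map_add, map_smul, e', if_neg (Nat.succ_ne_zero i), Nat.add_sub_cancel]
      module
  have htop : ∀ i ≤ 2 * k - 2 + 1, ∀ v ∈ W, v ≠ 0 → v ∈ initialSpan w i → eps k ∈ W := by
    intro i
    induction i with
    | zero =>
      intro _ v _ hv0 hv
      exact absurd (by simpa [initialSpan] using hv) hv0
    | succ i ih =>
      intro hi v hv hv0 hvi
      obtain ⟨c, z, hz, e⟩ := mem_initialSpan_succ w hvi
      by_cases hc : c = 0
      · rw [hc, zero_smul, zero_add] at e
        exact ih (by omega) v hv hv0 (e ▸ hz)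
      · exact hstep i (by omega) v hv c hc z hz e
  obtain ⟨v, hv, hv0⟩ := Submodule.exists_mem_ne_zero_of_ne_bot hne
  exact htop _ le_rfl v hv hv0 (epsModule_le_initialSpan hk hw (hle hv))

theorem isIrreducible_toRepresentation {V : Subrepresentation spRep} {v : Der} (hv : v ∈ V)
    (hv0 : v ≠ 0) (h : ∀ W : Submodule ℚ Der, (∀ g, ∀ v ∈ W, spRep g v ∈ W) →
      W ≤ V.toSubmodule → W ≠ ⊥ → V.toSubmodule ≤ W) : V.toRepresentation.IsIrreducible := by
  have hnt : Nontrivial (Subrepresentation V.toRepresentation) := by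
    refine ⟨⟨⊥, ⊤, fun e => hv0 ?_⟩⟩
    have : (⟨v, hv⟩ : V.toSubmodule) ∈ (⊥ : Subrepresentation V.toRepresentation) := by
      rw [e]; trivial
    exact congrArg Subtype.val ((Submodule.mem_bot ℚ).1 this)
  refine { eq_bot_or_eq_top := fun W => or_iff_not_imp_left.2 fun hW => ?_ }
  have hle := h (W.toSubmodule.map V.toSubmodule.subtype) ?_ ?_ ?_
  · apply Subrepresentation.toSubmodule_injective
    refine (eq_top_iff.2 fun u _ => ?_ : W.toSubmodule = (⊤ : Submodule ℚ V.toSubmodule))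
    obtain ⟨u', hu', e⟩ := hle u.2
    have : u' = u := Subtype.ext e
    exact this ▸ hu'
  · rintro g _ ⟨u, hu, rfl⟩
    exact ⟨V.toRepresentation g u, W.apply_mem_toSubmodule g hu, rfl⟩
  · exact Submodule.map_subtype_le _ _
  · intro e
    apply hW
    apply Subrepresentation.toSubmodule_injective
    refine eq_bot_iff.2 fun u hu => ?_
    have hu' : (u : Der) ∈ W.toSubmodule.map V.toSubmodule.subtype := ⟨u, hu, rfl⟩
    rw [e] at hu'
    exact Subtype.ext hu'

theorem le_of_isIrreducible {V W : Subrepresentation spRep} (hV : V.toRepresentation.IsIrreducible)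
    (hle : W.toSubmodule ≤ V.toSubmodule) {v : Der} (hv : v ∈ W) (hv0 : v ≠ 0) :
    V.toSubmodule ≤ W.toSubmodule := by
  let W' : Subrepresentation V.toRepresentation :=
    ⟨W.toSubmodule.comap V.toSubmodule.subtype, fun g u hu => W.apply_mem_toSubmodule g hu⟩
  rcases hV.eq_bot_or_eq_top W' with h | h
  · have : (⟨v, hle hv⟩ : V.toSubmodule) ∈ W' := hv
    rw [h] at this
    exact absurd (congrArg Subtype.val ((Submodule.mem_bot ℚ).1 this)) hv0
  · intro u hu
    have : (⟨u, hu⟩ : V.toSubmodule) ∈ W' := by rw [h]; trivial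
    exact this

theorem isSpSummand_epsModule {k : ℕ} (hk : 1 ≤ k) :
    IsSpSummand (2 * k) (2 * k - 2) (epsModule k) where
  le_hDeg := epsModule_le _ (fun g _ hv => spRep_mem_hDeg g hv) (eps_mem_hDeg k)
  irreducible := isIrreducible_toRepresentation (eps_mem_epsModule k) (eps_ne_zero k)
    fun W hW hle hne => epsModule_le W hW (eps_mem_of_invariant hk hW hle hne)
  highest_weight := ⟨eps k, eps_mem_epsModule k, isHighestWeightVector_eps hk⟩

theorem eq_epsModule {k : ℕ} (hk : 1 ≤ k) {V : Subrepresentation spRep}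
    (hV : IsSpSummand (2 * k) (2 * k - 2) V) : V = epsModule k := by
  obtain ⟨v, hv, hhw⟩ := hV.highest_weight
  obtain ⟨c, rfl⟩ := exists_eq_smul_eps hk (hV.le_hDeg hv) hhw.torus_weight
  have hc : c ≠ 0 := by
    rintro rfl
    exact hhw.ne_zero (zero_smul _ _)
  have hmem : eps k ∈ V.toSubmodule := (Submodule.smul_mem_iff _ hc).1 hv
  have hle : (epsModule k).toSubmodule ≤ V.toSubmodule :=
    epsModule_le _ (fun g _ hv => V.apply_mem_toSubmodule g hv) hmem
  exact Subrepresentation.toSubmodule_injective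
    (le_antisymm (le_of_isIrreducible hV.irreducible hle (eps_mem_epsModule k) (eps_ne_zero k)) hle)

/-! ### The Enomoto–Satoh map vanishes on `𝔲` -/

theorem coeff_cyclicSum (v : List (Fin 2)) (t : T) :
    coeff v (cyclicSum t) = ∑ i ∈ Finset.range v.length, coeff (v.rotate i) t := by
  induction t using word_induction with
  | hw w =>
    rw [cyclicSum_word, map_sum]
    simp only [coeff_word]
    by_cases hl : w.length = v.length
    · have hback : ∀ (a b : List (Fin 2)) (i : ℕ), i < a.length → a.length = b.length →
          a.rotate i = b → a = b.rotate ((a.length - i) % a.length) := by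
        rintro a b i hi hab rfl
        rw [List.rotate_rotate, ← List.rotate_mod, Nat.add_mod_mod,
          show i + (a.length - i) = a.length by omega, Nat.mod_self, List.rotate_zero]
      refine Finset.sum_bij' (fun i _ => (w.length - i) % w.length)
        (fun i _ => (w.length - i) % w.length) ?_ ?_ ?_ ?_ ?_
      · intro i hi
        have hi := Finset.mem_range.1 hi
        rw [← hl]
        exact Finset.mem_range.2 (Nat.mod_lt _ (by omega))
      · intro i hi
        have hi := Finset.mem_range.1 hi
        exact Finset.mem_range.2 (Nat.mod_lt _ (by omega))
      · intro i hi
        have hi := Finset.mem_range.1 hi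
        rcases Nat.eq_zero_or_pos i with rfl | h0
        · simp
        · rw [Nat.mod_eq_of_lt (show w.length - i < w.length by omega),
            Nat.sub_sub_self hi.le, Nat.mod_eq_of_lt hi]
      · intro i hi
        have hi := Finset.mem_range.1 hi
        rcases Nat.eq_zero_or_pos i with rfl | h0
        · simp
        · rw [Nat.mod_eq_of_lt (show w.length - i < w.length by omega),
            Nat.sub_sub_self (by omega), Nat.mod_eq_of_lt (by omega)]
      · intro i hi
        have hi := Finset.mem_range.1 hi
        congr 1
        refine propext ⟨fun h => hback w v i hi hl h, fun h => ?_⟩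
        have h' := hback v w _ (by rw [← hl]; exact Nat.mod_lt _ (by omega)) hl.symm h.symm
        rw [h', ← hl]
        congr 1
        rcases Nat.eq_zero_or_pos i with rfl | h0
        · simp
        · rw [Nat.mod_eq_of_lt (show w.length - i < w.length by omega),
            Nat.sub_sub_self hi.le, Nat.mod_eq_of_lt hi]
    · rw [Finset.sum_eq_zero, Finset.sum_eq_zero]
      · intro i _
        rw [if_neg]
        rintro rfl
        simp at hl
      · intro i _
        rw [if_neg]
        rintro rfl
        simp at hl
  | hadd a b ha hb => simp only [map_add, ha, hb, Finset.sum_add_distrib]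
  | hsmul c a ha => simp only [map_smul, ha, Finset.smul_sum]

theorem coeff_contract12 (v : List (Fin 2)) (t : T) :
    coeff v (contract12 t) = coeff (0 :: 1 :: v) t - coeff (1 :: 0 :: v) t := by
  induction t using word_induction with
  | hw w =>
    match w with
    | [] => rw [word_nil, contract12_one, coeff_one, coeff_one]; simp
    | [i] => rw [word_cons, word_nil, mul_one, contract12_ι, ← mul_one (FreeAlgebra.ι ℚ i),
        coeff_cons_ι_mul, coeff_cons_ι_mul, coeff_one, coeff_one]; simp
    | i :: j :: w =>
      rw [word_cons, word_cons, contract12_ι_mul_ι_mul, coeff_cons_ι_mul, coeff_cons_ι_mul,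
        coeff_cons_ι_mul, coeff_cons_ι_mul, map_smul]
      fin_cases i <;> fin_cases j <;> simp [interForm]
  | hadd a b ha hb => simp only [map_add, ha, hb]; ring
  | hsmul c a ha => simp only [map_smul, ha, smul_eq_mul]; ring

theorem coeff_ES (v : List (Fin 2)) (D : Der) :
    coeff v (ES D) = ∑ i ∈ Finset.range v.length, (coeff (0 :: 1 :: v.rotate i) (derToTensor D) -
      coeff (1 :: 0 :: v.rotate i) (derToTensor D)) := by
  rw [ES_apply, coeff_cyclicSum]
  simp only [coeff_contract12]

theorem ES_eq_zero_of_mem_hDeg_zero {D : Der} (hD : D ∈ hDeg 0) : ES D = 0 := by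
  apply ext_coeff
  intro v
  rw [coeff_ES, map_zero]
  refine Finset.sum_eq_zero fun i hi => ?_
  have hi := Finset.mem_range.1 hi
  rw [coeff_derToTensor_of_length_ne hD
      (by rw [List.length_cons, List.length_cons, List.length_rotate]; omega),
    coeff_derToTensor_of_length_ne hD
      (by rw [List.length_cons, List.length_cons, List.length_rotate]; omega), sub_zero]

/-- The terms of the divergence of `ε₂ₖ` cancel in a telescoping sum over the rotations of the only
cyclic word with one letter `y`. -/
theorem ES_eps {k : ℕ} (hk : 1 ≤ k) : ES (eps k) = 0 := by
  apply ext_coeff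
  intro v
  rw [coeff_ES, map_zero]
  have hD := eps_mem_hDeg k
  by_cases hc : v.length = 2 * k ∧ v.count 1 = 1
  · obtain ⟨hl, h1⟩ := hc
    obtain ⟨r, u, hr, hcount⟩ :=
      exists_rotate_eq_cons (List.count_pos_iff.1 (show 0 < v.count 1 by omega))
    have hu : u.count 1 = 0 := by
      have := hcount 1
      rw [List.count_cons_self] at this
      omega
    have hul := congrArg List.length hr
    rw [List.length_rotate, List.length_cons] at hul
    obtain ⟨n, hn⟩ : ∃ n, u.length = n := ⟨_, rfl⟩
    have hu' := eq_replicate_of_count_eq_zero (j := 0) (by decide) hu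
    rw [hn] at hu'
    rw [← sum_rotate_rotate (fun w => coeff (0 :: 1 :: w) (derToTensor (eps k)) -
      coeff (1 :: 0 :: w) (derToTensor (eps k))) v (r + 1), ← List.rotate_rotate, hr, hul, hu',
      List.length_replicate]
    set γ : ℕ → ℕ → ℚ := fun a b =>
      coeff (1 :: (List.replicate a 0 ++ 1 :: List.replicate b 0)) (derToTensor (eps k)) with hγ
    have hsymm : ∀ a b, γ a b = γ b a := by
      intro a b
      have h := coeff_rotate_derToTensor hD.1
        ((1 :: List.replicate a 0) ++ (1 :: List.replicate b 0)) (a + 1)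
      have e : ((1 :: List.replicate a (0 : Fin 2)) ++ (1 :: List.replicate b 0)).rotate (a + 1) =
          (1 :: List.replicate b 0) ++ (1 :: List.replicate a 0) := by
        have := List.rotate_append_length_eq (1 :: List.replicate a (0 : Fin 2))
          (1 :: List.replicate b 0)
        rwa [List.length_cons, List.length_replicate] at this
      rw [e] at h
      exact h.symm
    have hrot : ∀ j ∈ Finset.range (n + 1),
        ((1 :: List.replicate n (0 : Fin 2)).rotate 1).rotate j =
          List.replicate (n - j) 0 ++ 1 :: List.replicate j 0 := by
      intro j hj
      have hj := Finset.mem_range.1 hj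
      have := List.rotate_append_length_eq (1 :: List.replicate j (0 : Fin 2))
          (List.replicate (n - j) 0)
      rw [List.rotate_rotate, ← this, List.length_cons, List.length_replicate, add_comm 1 j,
        List.cons_append,
        List.replicate_append_replicate, show j + (n - j) = n by omega]
    have hterm : ∀ j ∈ Finset.range (n + 1),
        coeff (0 :: 1 :: ((1 :: List.replicate n (0 : Fin 2)).rotate 1).rotate j)
            (derToTensor (eps k)) -
          coeff (1 :: 0 :: ((1 :: List.replicate n (0 : Fin 2)).rotate 1).rotate j)
            (derToTensor (eps k)) = γ (n + 1 - (j + 1)) (j + 1) - γ (n + 1 - j) j := by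
      intro j hj
      rw [hrot j hj]
      have hj := Finset.mem_range.1 hj
      congr 1
      · rw [← coeff_rotate_one_derToTensor hD.1]
        simp only [hγ]
        rw [show n + 1 - (j + 1) = n - j by omega, List.replicate_succ', List.cons_append,
          List.append_assoc, List.cons_append]
      · simp only [hγ]
        rw [show n + 1 - j = n - j + 1 by omega, List.replicate_succ, List.cons_append]
    rw [Finset.sum_congr rfl hterm, Finset.sum_range_sub (fun j => γ (n + 1 - j) j), Nat.sub_self,
      Nat.sub_zero, hsymm, sub_self]
  · refine Finset.sum_eq_zero fun i _ => ?_
    have hz : ∀ w : List (Fin 2), (w.length = v.length + 2) → w.count 1 = v.count 1 + 1 →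
        coeff w (derToTensor (eps k)) = 0 := by
      intro w hw h1
      by_cases hl : v.length = 2 * k
      · have hsum := count_zero_add_count_one w
        refine coeff_eq_zero_of_weight (m := (2 * k - 2 : ℕ))
          (fun s => by rw [zpow_natCast]; exact torus_eps hk s) ?_
        have : v.count 1 ≠ 1 := fun h => hc ⟨hl, h⟩
        omega
      · exact coeff_derToTensor_of_length_ne hD (by omega)
    have hcnt : (v.rotate i).count 1 = v.count 1 := (List.rotate_perm v i).count_eq 1
    rw [hz _ (by simp) (by simp [hcnt]), hz _ (by simp) (by simp [hcnt]), sub_zero]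

theorem ES_eq_zero_of_mem_uLie {ε₀ : Der} (h₀ : ε₀ ∈ hDeg 0) {u : Der} (hu : u ∈ uLie ε₀) :
    ES u = 0 := by
  induction hu using LieSubalgebra.lieSpan_induction with
  | mem z hz =>
    rcases hz with rfl | ⟨k, hk, rfl⟩
    · exact ES_eq_zero_of_mem_hDeg_zero h₀
    · exact ES_eps hk
  | zero => exact map_zero _
  | add a b _ _ ha hb => rw [map_add, ha, hb, add_zero]
  | smul c a _ ha => rw [map_smul, ha, smul_zero]
  | lie a b _ _ ha hb => exact ES_lie_eq_zero ha hb

theorem epsModule_le_ker_ES {k : ℕ} (hk : 1 ≤ k) :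
    (epsModule k).toSubmodule ≤ LinearMap.ker ES :=
  epsModule_le _ (fun g _ hv => LinearMap.mem_ker.2 (ES_spRep g (LinearMap.mem_ker.1 hv)))
    (LinearMap.mem_ker.2 (ES_eps hk))

/-! ### Symplectic derivations from trees -/

theorem strip_spT (g : Sp2) (i : Fin 2) (t : T) :
    strip i (spT g t) = (g : Matrix (Fin 2) (Fin 2) ℚ) i 0 • spT g (strip 0 t) +
      (g : Matrix (Fin 2) (Fin 2) ℚ) i 1 • spT g (strip 1 t) := by
  induction t using word_induction with
  | hw w =>
    cases w with
    | nil => simp [strip_one]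
    | cons j w =>
      rw [word_cons, map_mul, spT_ι, add_mul, smul_mul_assoc, smul_mul_assoc, map_add, map_smul,
        map_smul, strip_ι_mul, strip_ι_mul, strip_ι_mul, strip_ι_mul]
      fin_cases i <;> fin_cases j <;> simp
  | hadd s t hs ht => simp only [map_add, hs, ht, smul_add]; abel
  | hsmul c t ht => simp only [map_smul, ht, smul_add, smul_comm c]

theorem spLie_adT (g : Sp2) (t : T) (a : L) : spLie g (adT t a) = adT (spT g t) (spLie g a) := by
  induction t using word_induction with
  | hw w =>
    induction w with
    | nil => simp
    | cons i w ih =>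
      rw [word_cons, map_mul, map_mul, map_mul, Module.End.mul_apply, Module.End.mul_apply, adT_ι,
        LieHom.map_lie, ih, spT_ι, spLie_of]
      simp only [map_add, map_smul, LinearMap.add_apply, LinearMap.smul_apply, adT_ι, add_lie,
        smul_lie]
  | hadd s t hs ht => simp only [map_add, hs, ht, LinearMap.add_apply]
  | hsmul c t ht => simp only [map_smul, ht, LinearMap.smul_apply]

theorem adT_mem_freeLieDeg {m n : ℕ} {t : T} (ht : ∀ w : List (Fin 2), w.length ≠ m →
    coeff w t = 0) {a : L} (ha : a ∈ freeLieDeg n) : adT t a ∈ freeLieDeg (m + n) := by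
  let P : T →ₗ[ℚ] T := onWords fun w => if w.length = m then word w else 0
  have hP : P t = t := by
    apply ext_coeff
    intro w
    have key : ∀ t, coeff w (P t) = if w.length = m then coeff w t else 0 := by
      intro t
      induction t using word_induction with
      | hw v =>
        rw [onWords_word]
        by_cases h : v = w
        · subst h
          split_ifs <;> simp
        · rw [coeff_word, if_neg h]
          split_ifs <;> simp [coeff_word, h]
      | hadd s t hs ht => rw [map_add, map_add, hs, ht, map_add]; split_ifs <;> simp
      | hsmul c t ht => rw [map_smul, map_smul, ht, map_smul]; split_ifs <;> simp
    rw [key]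
    split_ifs with h
    · rfl
    · exact (ht w h).symm
  rw [← hP]
  clear hP ht
  induction t using word_induction with
  | hw w =>
    rw [onWords_word]
    split_ifs with h
    · subst h
      induction w with
      | nil => simpa using ha
      | cons i w ih =>
        rw [word_cons, map_mul, Module.End.mul_apply, adT_ι, List.length_cons,
          show w.length + 1 + n = w.length + n + 1 by ring]
        exact of_lie_mem_freeLieDeg i ih
    · rw [map_zero, LinearMap.zero_apply]
      exact zero_mem _
  | hadd s t hs ht => rw [map_add, map_add, LinearMap.add_apply]; exact add_mem hs ht
  | hsmul c t ht => rw [map_smul, map_smul, LinearMap.smul_apply]; exact Submodule.smul_mem _ _ ht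

/-- The cyclic derivative with respect to `xᵢ` of the cyclic word `A B`, for Lie elements `A` and
`B`; it is again a Lie element. -/
def cyclicDeriv (i : Fin 2) : L →ₗ[ℚ] L →ₗ[ℚ] L :=
  (adT.toLinearMap ∘ₗ strip i ∘ₗ lieToTensor) + (adT.toLinearMap ∘ₗ strip i ∘ₗ lieToTensor).flip

theorem cyclicDeriv_apply (i : Fin 2) (A B : L) : cyclicDeriv i A B =
    adT (strip i (lieToTensor A)) B + adT (strip i (lieToTensor B)) A := rfl

/-- The symplectic derivation attached to the cyclic word `A B`, for Lie elements `A` and `B`. If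
`A` and `B` are brackets of letters, this is the planar binary tree obtained by joining the roots
of the trees of `A` and `B`. -/
def treeDer : L →ₗ[ℚ] L →ₗ[ℚ] Der :=
  (cyclicDeriv 1).compr₂ (derLiftLinear ∘ₗ LinearMap.single ℚ (fun _ => L) 0) -
    (cyclicDeriv 0).compr₂ (derLiftLinear ∘ₗ LinearMap.single ℚ (fun _ => L) 1)

theorem derLiftLinear_apply (f : Fin 2 → L) (i : Fin 2) :
    derLiftLinear f (FreeLieAlgebra.of ℚ i) = f i := derLift_of f i

theorem treeDer_x (A B : L) : treeDer A B x = cyclicDeriv 1 A B := by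
  rw [treeDer, LinearMap.sub_apply, LinearMap.sub_apply, LieDerivation.sub_apply,
    LinearMap.compr₂_apply, LinearMap.compr₂_apply, LinearMap.comp_apply, LinearMap.comp_apply, x,
    derLiftLinear_apply, derLiftLinear_apply]
  simp

theorem treeDer_y (A B : L) : treeDer A B y = - cyclicDeriv 0 A B := by
  rw [treeDer, LinearMap.sub_apply, LinearMap.sub_apply, LieDerivation.sub_apply,
    LinearMap.compr₂_apply, LinearMap.compr₂_apply, LinearMap.comp_apply, LinearMap.comp_apply, y,
    derLiftLinear_apply, derLiftLinear_apply]
  simp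

/-- The derivation kills `ω₀` because `∑ᵢ [xᵢ, θ(∂ᵢ A) B] = [A, B]` is antisymmetric, where `θ` is
the adjoint action of the tensor algebra. -/
theorem treeDer_omega (A B : L) : treeDer A B ⁅x, y⁆ = 0 := by
  have key : ∀ A B : L, ⁅x, adT (strip 0 (lieToTensor A)) B⁆ +
      ⁅y, adT (strip 1 (lieToTensor A)) B⁆ = ⁅A, B⁆ := by
    intro A B
    rw [x, y, ← adT_ι, ← adT_ι, ← Module.End.mul_apply, ← Module.End.mul_apply, ← map_mul,
      ← map_mul, ← LinearMap.add_apply, ← map_add, sum_ι_mul_strip _ (coeff_nil_lieToTensor A),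
      adT_lieToTensor]
  have h1 := key A B
  have h2 := key B A
  rw [← lie_skew B A, ← h1, eq_neg_iff_add_eq_zero] at h2
  rw [LieDerivation.apply_lie_eq_add, treeDer_x, treeDer_y, cyclicDeriv_apply, cyclicDeriv_apply,
    lie_neg, ← lie_skew _ y, lie_add, lie_add, ← neg_add, neg_eq_zero, ← h2]
  abel

theorem treeDer_mem_hDeg {p q : ℕ} {A B : L} (hA : A ∈ freeLieDeg (p + 1))
    (hB : B ∈ freeLieDeg (q + 1)) : treeDer A B ∈ hDeg (p + q) := by
  have hstrip : ∀ (p : ℕ) (A : L) (i : Fin 2), A ∈ freeLieDeg (p + 1) → ∀ w : List (Fin 2),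
      w.length ≠ p → coeff w (strip i (lieToTensor A)) = 0 := by
    intro p A i hA w hw
    rw [coeff_strip]
    exact coeff_lieToTensor_of_length_ne hA (by rw [List.length_cons]; omega)
  have hmem : ∀ i, cyclicDeriv i A B ∈ freeLieDeg (p + q + 1) := by
    intro i
    rw [cyclicDeriv_apply]
    refine add_mem (adT_mem_freeLieDeg (hstrip p A i hA) hB) ?_
    rw [show p + q + 1 = q + (p + 1) by ring]
    exact adT_mem_freeLieDeg (hstrip q B i hB) hA
  refine ⟨treeDer_omega A B, fun i => ?_⟩
  fin_cases i
  · exact (treeDer_x A B) ▸ hmem 1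
  · exact (treeDer_y A B) ▸ neg_mem (hmem 0)

theorem cyclicDeriv_spLie (g : Sp2) (i : Fin 2) (A B : L) :
    cyclicDeriv i (spLie g A) (spLie g B) =
      (g : Matrix (Fin 2) (Fin 2) ℚ) i 0 • spLie g (cyclicDeriv 0 A B) +
        (g : Matrix (Fin 2) (Fin 2) ℚ) i 1 • spLie g (cyclicDeriv 1 A B) := by
  simp only [cyclicDeriv_apply, lieToTensor_spLie, strip_spT, map_add, map_smul,
    LinearMap.add_apply, LinearMap.smul_apply, ← spLie_adT, smul_add]
  abel

/-- A bilinear map from `𝓛` to derivations which commutes with the action of `Sp`. -/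
def IsEquivariant (F : L →ₗ[ℚ] L →ₗ[ℚ] Der) : Prop :=
  ∀ g A B, spRep g (F A B) = F (spLie g A) (spLie g B)

theorem isEquivariant_treeDer : IsEquivariant treeDer := by
  intro g A B
  apply der_ext
  intro i
  fin_cases i
  · change spRep g (treeDer A B) x = treeDer (spLie g A) (spLie g B) x
    rw [spRep_apply_x, treeDer_x, treeDer_x, treeDer_y, cyclicDeriv_spLie, map_neg, smul_neg]
    abel
  · change spRep g (treeDer A B) y = treeDer (spLie g A) (spLie g B) y
    rw [spRep_apply_y, treeDer_x, treeDer_y, treeDer_y, cyclicDeriv_spLie, map_neg, smul_neg]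
    abel

/-- Contraction with the symplectic form of two letters which act on the two arguments of a
bilinear map. -/
def casimir (F : L →ₗ[ℚ] L →ₗ[ℚ] Der) : L →ₗ[ℚ] L →ₗ[ℚ] Der :=
  F.compl₁₂ (LieAlgebra.ad ℚ L x : L →ₗ[ℚ] L) (LieAlgebra.ad ℚ L y : L →ₗ[ℚ] L) -
    F.compl₁₂ (LieAlgebra.ad ℚ L y : L →ₗ[ℚ] L) (LieAlgebra.ad ℚ L x : L →ₗ[ℚ] L)

theorem casimir_apply (F : L →ₗ[ℚ] L →ₗ[ℚ] Der) (A B : L) :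
    casimir F A B = F ⁅x, A⁆ ⁅y, B⁆ - F ⁅y, A⁆ ⁅x, B⁆ := rfl

theorem IsEquivariant.casimir {F : L →ₗ[ℚ] L →ₗ[ℚ] Der} (hF : IsEquivariant F) :
    IsEquivariant (casimir F) := by
  intro g A B
  have hdet := g.det_coe
  rw [Matrix.det_fin_two] at hdet
  rw [casimir_apply, casimir_apply, map_sub, hF, hF]
  simp only [LieHom.map_lie]
  rw [x, y, spLie_of, spLie_of]
  simp only [add_lie, smul_lie, map_add, map_smul, LinearMap.add_apply, LinearMap.smul_apply,
    smul_add, smul_smul]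
  trans ((g : Matrix (Fin 2) (Fin 2) ℚ) 0 0 * (g : Matrix (Fin 2) (Fin 2) ℚ) 1 1 -
    (g : Matrix (Fin 2) (Fin 2) ℚ) 0 1 * (g : Matrix (Fin 2) (Fin 2) ℚ) 1 0) •
    (F ⁅FreeLieAlgebra.of ℚ (0 : Fin 2), spLie g A⁆ ⁅FreeLieAlgebra.of ℚ (1 : Fin 2), spLie g B⁆ -
      F ⁅FreeLieAlgebra.of ℚ (1 : Fin 2), spLie g A⁆ ⁅FreeLieAlgebra.of ℚ (0 : Fin 2), spLie g B⁆)
  · module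
  · rw [hdet, one_smul]

/-- Bracketing the first argument of a bilinear map with `ω₀`. -/
def adOmega (F : L →ₗ[ℚ] L →ₗ[ℚ] Der) : L →ₗ[ℚ] L →ₗ[ℚ] Der :=
  F ∘ₗ (LieAlgebra.ad ℚ L ⁅x, y⁆ : L →ₗ[ℚ] L)

theorem adOmega_apply (F : L →ₗ[ℚ] L →ₗ[ℚ] Der) (A B : L) :
    adOmega F A B = F ⁅⁅x, y⁆, A⁆ B := rfl

theorem IsEquivariant.adOmega {F : L →ₗ[ℚ] L →ₗ[ℚ] Der} (hF : IsEquivariant F) :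
    IsEquivariant (adOmega F) := by
  intro g A B
  rw [adOmega_apply, adOmega_apply, hF, LieHom.map_lie, spLie_omega]

/-- A bilinear map which sends `𝓛(p + 1) × 𝓛(q + 1)` to `𝔥_{1,1}(p + q + d)`. -/
def RaisesDegree (d : ℕ) (F : L →ₗ[ℚ] L →ₗ[ℚ] Der) : Prop :=
  ∀ p q A B, A ∈ freeLieDeg (p + 1) → B ∈ freeLieDeg (q + 1) → F A B ∈ hDeg (p + q + d)

theorem RaisesDegree.casimir {d : ℕ} {F : L →ₗ[ℚ] L →ₗ[ℚ] Der} (hF : RaisesDegree d F) :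
    RaisesDegree (d + 2) (casimir F) := by
  intro p q A B hA hB
  rw [casimir_apply, show p + q + (d + 2) = (p + 1) + (q + 1) + d by ring]
  exact sub_mem (hF _ _ _ _ (of_lie_mem_freeLieDeg 0 hA) (of_lie_mem_freeLieDeg 1 hB))
    (hF _ _ _ _ (of_lie_mem_freeLieDeg 1 hA) (of_lie_mem_freeLieDeg 0 hB))

theorem omega_mem_freeLieDeg : ⁅x, y⁆ ∈ freeLieDeg 2 :=
  of_lie_mem_freeLieDeg 0 (of_mem_freeLieDeg 1)

theorem RaisesDegree.adOmega {d : ℕ} {F : L →ₗ[ℚ] L →ₗ[ℚ] Der} (hF : RaisesDegree d F) :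
    RaisesDegree (d + 2) (adOmega F) := by
  intro p q A B hA hB
  rw [adOmega_apply, show p + q + (d + 2) = (2 + p) + q + d by ring]
  have h := lie_mem_freeLieDeg omega_mem_freeLieDeg hA
  rw [← add_assoc] at h
  exact hF _ _ _ _ h hB

/-- An `Sp`-invariant derivation: `j` contracted pairs of letters and `n` brackets with `ω₀`,
applied to the tree `ω₀ — ω₀`. -/
def invariantDer (j n : ℕ) : Der := casimir^[j] (adOmega^[n] treeDer) ⁅x, y⁆ ⁅x, y⁆

theorem invariantDer_mem_hSp (j n : ℕ) : invariantDer j n ∈ hSp (2 * (j + n) + 2) := by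
  have h1 : ∀ n, IsEquivariant (adOmega^[n] treeDer) ∧ RaisesDegree (2 * n) (adOmega^[n] treeDer) :=
    fun n => by
    induction n with
    | zero =>
      refine ⟨isEquivariant_treeDer, fun p q A B hA hB => ?_⟩
      rw [Nat.mul_zero, Nat.add_zero]
      exact treeDer_mem_hDeg hA hB
    | succ n ih => rw [Function.iterate_succ_apply']; exact ⟨ih.1.adOmega, ih.2.adOmega⟩
  have h2 : ∀ j, IsEquivariant (casimir^[j] (adOmega^[n] treeDer)) ∧
      RaisesDegree (2 * (j + n)) (casimir^[j] (adOmega^[n] treeDer)) := fun j => by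
    induction j with
    | zero => rw [zero_add]; exact h1 n
    | succ j ih =>
      rw [Function.iterate_succ_apply', show 2 * (j + 1 + n) = 2 * (j + n) + 2 by ring]
      exact ⟨ih.1.casimir, ih.2.casimir⟩
  refine ⟨?_, fun g => ?_⟩
  · have := (h2 j).2 1 1 _ _ omega_mem_freeLieDeg omega_mem_freeLieDeg
    rwa [show 1 + 1 + 2 * (j + n) = 2 * (j + n) + 2 by ring] at this
  · rw [invariantDer, (h2 j).1, spLie_omega]

/-! ### Coefficients of the invariant derivations -/

/-- The coefficient of `w` in `ad x_{i₁} ⋯ ad x_{iₙ} (y)`, where `p = [i₁, …, iₙ]`. -/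
def adCoeff : List (Fin 2) → List (Fin 2) → ℤ
  | [], w => if w = [1] then 1 else 0
  | i :: p, w => (if w.head? = some i then adCoeff p w.tail else 0) -
      if w.getLast? = some i then adCoeff p w.dropLast else 0

theorem coeff_adT_word_y (p w : List (Fin 2)) :
    coeff w (lieToTensor (adT (word p) y)) = adCoeff p w := by
  induction p generalizing w with
  | nil =>
    rw [word_nil, map_one, Module.End.one_apply, y, lieToTensor_of,
      ← mul_one (FreeAlgebra.ι ℚ 1), ← word_nil, ← word_cons, coeff_word, adCoeff]
    simp [eq_comm]
  | cons i p ih =>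
    rw [word_cons, map_mul, Module.End.mul_apply, adT_ι, lieToTensor_lie, lieToTensor_of, map_sub,
      adCoeff, Int.cast_sub]
    congr 1
    · cases w with
      | nil => simp [coeff_nil_ι_mul]
      | cons j w =>
        rw [coeff_cons_ι_mul, ih]
        simp [eq_comm]
    · rcases List.eq_nil_or_concat w with rfl | ⟨w, j, rfl⟩
      · simp [coeff_nil_mul_ι]
      · rw [List.concat_eq_append, coeff_concat_mul_ι, ih]
        simp [eq_comm]

/-- Finite linear combinations of lists, to compute with Lie elements and tensors. -/
abbrev Comb : Type := List (ℤ × List (Fin 2))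

/-- The tensor `∑ c w` of a linear combination of words. -/
def tensorEval (P : Comb) : T := (P.map fun c => (c.1 : ℚ) • word c.2).sum

/-- The Lie element `∑ c ad x_{i₁} ⋯ ad x_{iₙ} (y)` of a linear combination of lists. -/
def lieEval (P : Comb) : L := (P.map fun c => (c.1 : ℚ) • adT (word c.2) y).sum

/-- The expansion of `ad x_{i₁} ⋯ ad x_{iₙ} (y)` in words. -/
def adExpand : List (Fin 2) → Comb
  | [] => [(1, [1])]
  | i :: p => (adExpand p).map (fun c => (c.1, i :: c.2)) ++
      (adExpand p).map (fun c => (-c.1, c.2 ++ [i]))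

/-- The Fox derivative `∂₁` of a Lie element. -/
def stripExpand (P : Comb) : Comb :=
  P.flatMap fun c => (adExpand c.2).filterMap fun u =>
    if u.2.head? = some 1 then some (c.1 * u.1, u.2.tail) else none

/-- The coefficient of `w` in the result of applying the tensor `P` to the Lie element `Q`. -/
def actCoeff (P Q : Comb) (w : List (Fin 2)) : ℤ :=
  (P.map fun u => (Q.map fun c => u.1 * c.1 * adCoeff (u.2 ++ c.2) w).sum).sum

/-- The coefficient of `y w` in the tensor of a tree. -/
def treeCoeff (w : List (Fin 2)) (A B : Comb) : ℤ :=
  actCoeff (stripExpand A) B w + actCoeff (stripExpand B) A w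

/-- The bracket with the letter `xᵢ`. -/
def combAd (i : Fin 2) (P : Comb) : Comb := P.map fun c => (c.1, i :: c.2)

/-- The bracket with `ω₀`. -/
def combAdOmega (P : Comb) : Comb :=
  combAd 0 (combAd 1 P) ++ (combAd 1 (combAd 0 P)).map fun c => (-c.1, c.2)

theorem tensorEval_cons (c : ℤ × List (Fin 2)) (P : Comb) :
    tensorEval (c :: P) = (c.1 : ℚ) • word c.2 + tensorEval P := rfl

theorem lieEval_cons (c : ℤ × List (Fin 2)) (P : Comb) :
    lieEval (c :: P) = (c.1 : ℚ) • adT (word c.2) y + lieEval P := rfl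

theorem tensorEval_append (P Q : Comb) :
    tensorEval (P ++ Q) = tensorEval P + tensorEval Q := by
  simp [tensorEval]

theorem lieEval_append (P Q : Comb) : lieEval (P ++ Q) = lieEval P + lieEval Q := by
  simp [lieEval]

theorem lieEval_neg (P : Comb) : lieEval (P.map fun c => (-c.1, c.2)) = - lieEval P := by
  induction P with
  | nil => simp [lieEval]
  | cons c P ih => rw [List.map_cons, lieEval_cons, lieEval_cons, ih]; push_cast; module

theorem lieEval_combAd (i : Fin 2) (P : Comb) :
    lieEval (combAd i P) = ⁅FreeLieAlgebra.of ℚ i, lieEval P⁆ := by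
  induction P with
  | nil => simp [lieEval, combAd]
  | cons c P ih =>
    rw [combAd, List.map_cons, lieEval_cons, lieEval_cons, lie_add, ← ih, lie_smul, word_cons,
      map_mul, Module.End.mul_apply, adT_ι]
    rfl

theorem lieEval_combAdOmega (P : Comb) : lieEval (combAdOmega P) = ⁅⁅x, y⁆, lieEval P⁆ := by
  rw [combAdOmega, lieEval_append, lieEval_neg, lieEval_combAd, lieEval_combAd, lieEval_combAd,
    lieEval_combAd, lie_lie, sub_eq_add_neg]
  rfl

theorem tensorEval_adExpand (p : List (Fin 2)) :
    tensorEval (adExpand p) = lieToTensor (adT (word p) y) := by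
  induction p with
  | nil => simp [adExpand, tensorEval, y, lieToTensor_of]
  | cons i p ih =>
    have h1 : ∀ P : Comb, tensorEval (P.map fun c => (c.1, i :: c.2)) =
        FreeAlgebra.ι ℚ i * tensorEval P := by
      intro P
      induction P with
      | nil => simp [tensorEval]
      | cons c P ih =>
        rw [List.map_cons, tensorEval_cons, tensorEval_cons, ih, mul_add, mul_smul_comm, word_cons]
    have h2 : ∀ P : Comb, tensorEval (P.map fun c => (-c.1, c.2 ++ [i])) =
        - (tensorEval P * FreeAlgebra.ι ℚ i) := by
      intro P
      induction P with
      | nil => simp [tensorEval]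
      | cons c P ih =>
        rw [List.map_cons, tensorEval_cons, tensorEval_cons, ih, add_mul, smul_mul_assoc,
          word_append, word_cons, word_nil, mul_one]
        push_cast
        module
    rw [adExpand, tensorEval_append, h1, h2, ih, word_cons, map_mul, Module.End.mul_apply, adT_ι,
      lieToTensor_lie, lieToTensor_of, sub_eq_add_neg]

theorem tensorEval_stripExpand (P : Comb) :
    tensorEval (stripExpand P) = strip 1 (lieToTensor (lieEval P)) := by
  have h : ∀ (a : ℤ) (Q : Comb), tensorEval (Q.filterMap fun u =>
      if u.2.head? = some 1 then some (a * u.1, u.2.tail) else none) =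
        (a : ℚ) • strip 1 (tensorEval Q) := by
    intro a Q
    induction Q with
    | nil => simp [tensorEval]
    | cons u Q ih =>
      obtain ⟨b, u⟩ := u
      rw [List.filterMap_cons, tensorEval_cons, map_add, smul_add, ← ih, map_smul]
      cases u with
      | nil => simp [strip_one]
      | cons j u =>
        rw [word_cons, strip_ι_mul]
        by_cases hj : j = 1
        · simp [hj, tensorEval_cons, smul_smul]
        · simp [hj]
  induction P with
  | nil => simp [stripExpand, tensorEval, lieEval]
  | cons c P ih =>
    rw [stripExpand, List.flatMap_cons, tensorEval_append, h, tensorEval_adExpand, lieEval_cons,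
      map_add, map_add, map_smul, map_smul, ← ih]
    rfl

theorem coeff_adT_tensorEval (P Q : Comb) (w : List (Fin 2)) :
    coeff w (lieToTensor (adT (tensorEval P) (lieEval Q))) = actCoeff P Q w := by
  induction P with
  | nil => simp [tensorEval, actCoeff]
  | cons u P ih =>
    rw [tensorEval_cons, map_add, map_smul, LinearMap.add_apply, LinearMap.smul_apply, map_add,
      map_add, ih, map_smul, map_smul, actCoeff, actCoeff, List.map_cons, List.sum_cons,
      Int.cast_add]
    congr 1
    clear ih
    induction Q with
    | nil => simp [lieEval]
    | cons c Q ih =>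
      rw [lieEval_cons, map_add, map_smul, map_add, map_add, map_smul, map_smul,
        ← Module.End.mul_apply, ← map_mul, ← word_append, coeff_adT_word_y, smul_add, ih,
        List.map_cons, List.sum_cons]
      push_cast
      simp only [smul_eq_mul]
      ring

theorem coeff_treeDer (w : List (Fin 2)) (A B : Comb) :
    coeff (1 :: w) (derToTensor (treeDer (lieEval A) (lieEval B))) = treeCoeff w A B := by
  rw [coeff_one_cons_derToTensor, treeDer_x, cyclicDeriv_apply, ← tensorEval_stripExpand,
    ← tensorEval_stripExpand, map_add, map_add, coeff_adT_tensorEval, coeff_adT_tensorEval,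
    treeCoeff, Int.cast_add]

/-- The effect of `casimir` on the coefficients of a bilinear map. -/
def casimirCoeff (f : Comb → Comb → ℤ) (A B : Comb) : ℤ :=
  f (combAd 0 A) (combAd 1 B) - f (combAd 1 A) (combAd 0 B)

/-- The coefficient of `y w` in the tensor of `invariantDer j n`. -/
def invariantCoeff (w : List (Fin 2)) (j n : ℕ) : ℤ :=
  casimirCoeff^[j] (fun A => treeCoeff w (combAdOmega^[n] A)) [(1, [0])] [(1, [0])]

theorem coeff_invariantDer (w : List (Fin 2)) (j n : ℕ) :
    coeff (1 :: w) (derToTensor (invariantDer j n)) = invariantCoeff w j n := by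
  have h1 : ∀ n (A B : Comb), coeff (1 :: w) (derToTensor ((adOmega^[n] treeDer) (lieEval A)
      (lieEval B))) = treeCoeff w (combAdOmega^[n] A) B := by
    intro n
    induction n with
    | zero => exact coeff_treeDer w
    | succ n ih =>
      intro A B
      rw [Function.iterate_succ_apply', adOmega_apply, ← lieEval_combAdOmega, ih,
        Function.iterate_succ_apply]
  have h2 : ∀ j (A B : Comb), coeff (1 :: w) (derToTensor ((casimir^[j] (adOmega^[n] treeDer))
      (lieEval A) (lieEval B))) =
        (casimirCoeff^[j] (fun A => treeCoeff w (combAdOmega^[n] A)) A B : ℤ) := by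
    intro j
    induction j with
    | zero => exact h1 n
    | succ j ih =>
      intro A B
      rw [Function.iterate_succ_apply', Function.iterate_succ_apply', casimir_apply, map_sub,
        map_sub, x, y, ← lieEval_combAd, ← lieEval_combAd, ← lieEval_combAd, ← lieEval_combAd, ih,
        ih, casimirCoeff, Int.cast_sub]
  have h3 : lieEval [(1, [0])] = ⁅x, y⁆ := by
    simp [lieEval, adT_ι, x]
  rw [invariantCoeff, ← h2, h3]
  rfl

/-! ### Dihedral classes of words -/

/-- Encoding of words by natural numbers, with binary digits in increasing order. -/
def code : List (Fin 2) → ℕ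
  | [] => 0
  | i :: w => i.val + 2 * code w

/-- The word of length `l` with a given code. -/
def ofCode : ℕ → ℕ → List (Fin 2)
  | 0, _ => []
  | l + 1, n => Fin.ofNat 2 n :: ofCode l (n / 2)

theorem ofCode_code (w : List (Fin 2)) : ofCode w.length (code w) = w := by
  induction w with
  | nil => rfl
  | cons i w ih =>
    have hi := i.isLt
    rw [List.length_cons, code, ofCode, show (i.val + 2 * code w) / 2 = code w by omega, ih]
    congr 1
    ext
    simp only [Fin.ofNat, Nat.add_mul_mod_self_left]
    omega

theorem code_lt (w : List (Fin 2)) : code w < 2 ^ w.length := by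
  induction w with
  | nil => simp [code]
  | cons i w ih =>
    have hi := i.isLt
    rw [List.length_cons, code, pow_succ]
    omega

theorem code_append_singleton (w : List (Fin 2)) (i : Fin 2) :
    code (w ++ [i]) = code w + 2 ^ w.length * i.val := by
  induction w with
  | nil => simp [code]
  | cons j w ih => rw [List.cons_append, code, code, ih, List.length_cons, pow_succ]; ring

theorem code_map_add_one (w : List (Fin 2)) : code (w.map (· + 1)) = 2 ^ w.length - 1 - code w := by
  have h : code (w.map (· + 1)) + code w + 1 = 2 ^ w.length := by
    induction w with
    | nil => simp [code]
    | cons i w ih =>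
      rw [List.map_cons, code, code, List.length_cons, pow_succ, ← ih]
      fin_cases i <;> simp <;> ring
  omega

/-- The code of the rotation of a word of length twelve. -/
def rotateCode (n : ℕ) : ℕ := n / 2 + 2048 * (n % 2)

/-- The minimum of two numbers, in a form which the kernel evaluates quickly. -/
def minCode (m n : ℕ) : ℕ := bif m.ble n then m else n

/-- The least number among `n` and its first `k` rotations. -/
def minRotate : ℕ → ℕ → ℕ
  | 0, n => n
  | k + 1, n => minCode n (minRotate k (rotateCode n))

/-- The least code of a word of length twelve obtained from `w` by rotations, reversal and the
exchange of the two letters. -/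
def classCode (w : List (Fin 2)) : ℕ :=
  minCode (minCode (minRotate 11 (code w)) (minRotate 11 (4095 - code w)))
    (minCode (minRotate 11 (code w.reverse)) (minRotate 11 (4095 - code w.reverse)))

/-- A set of codes of words of length twelve which is stable under rotation, reversal and the
exchange of the two letters contains the class code of each of its words. -/
theorem exists_code_eq_classCode {P : List (Fin 2) → Prop}
    (hlen : ∀ u, P u → u.length = 12) (hrot : ∀ i u, P (i :: u) → P (u ++ [i]))
    (hrev : ∀ u, P u → P u.reverse) (hswap : ∀ u, P u → P (u.map (· + 1))) {w : List (Fin 2)}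
    (hw : P w) : ∃ u, P u ∧ code u = classCode w := by
  have hmin : ∀ m n, (∃ u, P u ∧ code u = m) → (∃ u, P u ∧ code u = n) →
      ∃ u, P u ∧ code u = minCode m n := by
    intro m n hm hn
    rw [minCode]
    cases m.ble n
    · exact hn
    · exact hm
  have hminrot : ∀ k n, (∃ u, P u ∧ code u = n) → ∃ u, P u ∧ code u = minRotate k n := by
    intro k
    induction k with
    | zero => exact fun n hn => hn
    | succ k ih =>
      intro n hn
      refine hmin _ _ hn (ih _ ?_)
      obtain ⟨u, hu, rfl⟩ := hn
      cases u with
      | nil => exact absurd (hlen _ hu) (by simp)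
      | cons i u =>
        refine ⟨u ++ [i], hrot i u hu, ?_⟩
        have hl : u.length = 11 := by simpa using hlen _ hu
        have hi := i.isLt
        rw [code_append_singleton, hl, rotateCode, code]
        omega
  have hall : ∀ u, P u → ∃ v, P v ∧ code v = minCode (minRotate 11 (code u))
      (minRotate 11 (4095 - code u)) := fun u hu =>
    hmin _ _ (hminrot _ _ ⟨u, hu, rfl⟩)
      (hminrot _ _ ⟨_, hswap u hu, by rw [code_map_add_one, hlen u hu]; norm_num⟩)
  exact hmin _ _ (hall w hw) (hall _ (hrev w hw))

theorem coeff_reverse_derToTensor {D : Der} (hD : D ⁅x, y⁆ = 0) {w : List (Fin 2)}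
    (hw : Even w.length) : coeff w.reverse (derToTensor D) = coeff w (derToTensor D) := by
  cases w with
  | nil => rfl
  | cons i w =>
    rw [List.length_cons] at hw
    rw [List.reverse_cons, coeff_rotate_one_derToTensor hD]
    fin_cases i
    · change coeff (0 :: _) _ = coeff (0 :: _) _
      rw [coeff_zero_cons_derToTensor, coeff_zero_cons_derToTensor, coeff_reverse_lieToTensor,
        hw.neg_one_pow, one_mul]
    · change coeff (1 :: _) _ = coeff (1 :: _) _
      rw [coeff_one_cons_derToTensor, coeff_one_cons_derToTensor, coeff_reverse_lieToTensor,
        hw.neg_one_pow, one_mul]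

theorem coeff_eq_zero_of_mem_hSp {n : ℕ} {D : Der} (hD : D ∈ hSp n) {w : List (Fin 2)}
    (hw : w.count 0 ≠ w.count 1) : coeff w (derToTensor D) = 0 :=
  coeff_eq_zero_of_weight (m := 0) (fun s => by rw [hD.2, zpow_zero, one_smul]) (by omega)

/-! ### Linear relations between the coefficients of an invariant derivation of degree ten -/

/-- The coefficient of the words of length twelve in the class with code `n`. -/
abbrev classCoeff (D : Der) (n : ℕ) : ℚ := coeff (ofCode 12 n) (derToTensor D)

theorem coeff_eq_classCoeff {D : Der} (hD : D ∈ hSp 10) {w : List (Fin 2)} (hl : w.length = 12)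
    (hw : w.count 1 = 6) : coeff w (derToTensor D) = classCoeff D (classCode w) := by
  let P : List (Fin 2) → Prop := fun u => u.length = 12 ∧ u.count 1 = 6 ∧
    coeff u (derToTensor D) = coeff w (derToTensor D)
  have hrot : ∀ i u, P (i :: u) → P (u ++ [i]) := by
    intro i u hu
    have hp : (u ++ [i]).Perm (i :: u) := List.perm_append_singleton i u
    simp only [P, hp.length_eq, hp.count_eq, coeff_rotate_one_derToTensor hD.1.1]
    exact hu
  have hrev : ∀ u, P u → P u.reverse := by
    intro u hu
    simp only [P, List.length_reverse, List.count_reverse,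
      coeff_reverse_derToTensor hD.1.1 (by rw [hu.1]; decide : Even u.length)]
    exact hu
  have hswap : ∀ u, P u → P (u.map (· + 1)) := by
    intro u hu
    have hc : (u.map (· + 1)).count 1 = u.count 0 := by
      clear hu
      induction u with
      | nil => rfl
      | cons i u ih => fin_cases i <;> simp [ih]
    have e := coeff_spT_weyl u (derToTensor D)
    rw [← derToTensor_spRep, hD.2 weyl, hu.2.1, Even.neg_one_pow (by decide), one_mul] at e
    refine ⟨by rw [List.length_map, hu.1], ?_, e.trans hu.2.2⟩
    have h1 := count_zero_add_count_one u
    have h2 := hu.1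
    have h3 := hu.2.1
    omega
  obtain ⟨u, ⟨h1, -, h2⟩, h3⟩ :=
    exists_code_eq_classCode (fun u hu => hu.1) hrot hrev hswap ⟨hl, hw, rfl⟩
  rw [classCoeff, ← h3, ← h1, ofCode_code, h2]

theorem length_of_mem_changeOne {v w : List (Fin 2)} (h : v ∈ changeOne w) :
    v.length = w.length := by
  induction w generalizing v with
  | nil => simp [changeOne] at h
  | cons i w ih =>
    match i with
    | 0 =>
      rw [changeOne, List.mem_cons, List.mem_map] at h
      rcases h with rfl | ⟨u, hu, rfl⟩
      · rfl
      · rw [List.length_cons, ih hu, List.length_cons]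
    | 1 =>
      rw [changeOne, List.mem_map] at h
      obtain ⟨u, hu, rfl⟩ := h
      rw [List.length_cons, ih hu, List.length_cons]

theorem count_of_mem_changeOne {v w : List (Fin 2)} (h : v ∈ changeOne w) :
    v.count 1 = w.count 1 + 1 := by
  induction w generalizing v with
  | nil => simp [changeOne] at h
  | cons i w ih =>
    match i with
    | 0 =>
      rw [changeOne, List.mem_cons, List.mem_map] at h
      rcases h with rfl | ⟨u, hu, rfl⟩
      · simp
      · simpa using ih hu
    | 1 =>
      rw [changeOne, List.mem_map] at h
      obtain ⟨u, hu, rfl⟩ := h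
      simpa using ih hu

theorem perm_of_mem_shuffle {u v w : List (Fin 2)} (h : w ∈ shuffle u v) : w.Perm (u ++ v) := by
  induction u generalizing v w with
  | nil =>
    rw [shuffle_nil, List.mem_singleton] at h
    exact h ▸ List.Perm.refl _
  | cons a u ihu =>
    induction v generalizing w with
    | nil =>
      rw [shuffle_cons_nil, List.mem_singleton] at h
      rw [h, List.append_nil]
    | cons b v ihv =>
      rw [shuffle_cons_cons, List.mem_append, List.mem_map, List.mem_map] at h
      rcases h with ⟨s, hs, rfl⟩ | ⟨s, hs, rfl⟩
      · exact (ihu hs).cons a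
      · exact ((ihv hs).cons b).trans List.perm_middle.symm

theorem sum_classCoeff_changeOne {D : Der} (hD : D ∈ hSp 10) (w : List (Fin 2)) (l : List ℕ)
    (h : w.length = 12 ∧ w.count 1 = 5 ∧ (changeOne w).map classCode = l) :
    (l.map (classCoeff D)).sum = 0 := by
  obtain ⟨hl, hw, rfl⟩ := h
  rw [← sum_changeOne_eq_zero 5 (hD.2 _) (fun v hv => ?_) hw, List.map_map]
  · congr 1
    refine List.map_congr_left fun v hv => ?_
    rw [Function.comp_apply, coeff_eq_classCoeff hD ((length_of_mem_changeOne hv).trans hl)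
      (by rw [count_of_mem_changeOne hv, hw])]
  · by_cases h : v.length = 12
    · refine coeff_eq_zero_of_mem_hSp hD ?_
      have := count_zero_add_count_one v
      omega
    · exact coeff_derToTensor_of_length_ne hD.1 h

theorem sum_classCoeff_shuffle {D : Der} (hD : D ∈ hSp 10) (u v : List (Fin 2)) (l : List ℕ)
    (h : u ≠ [] ∧ v ≠ [] ∧ (u ++ v).length = 11 ∧ (u ++ v).count 1 = 5 ∧
      ((shuffle u v).map fun w => classCode (1 :: w)) = l) :
    (l.map (classCoeff D)).sum = 0 := by
  obtain ⟨hu, hv, hl, hc, rfl⟩ := h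
  rw [← sum_shuffle_lieToTensor (D x) hu hv, List.map_map]
  congr 1
  refine List.map_congr_left fun w hw => ?_
  have hp := perm_of_mem_shuffle hw
  rw [Function.comp_apply, ← coeff_one_cons_derToTensor, coeff_eq_classCoeff hD]
  · rw [List.length_cons, hp.length_eq, hl]
  · rw [List.count_cons_self, hp.count_eq, hc]

/-- The 35 classes of words with six letters `x` and six letters `y`, each with the coordinates of
its coefficient with respect to the three parameters of an invariant derivation of degree ten. -/
def classCoord : List (ℕ × ℤ × ℤ × ℤ) :=
  [(63, 0, 0, 0), (95, 1, 0, 0), (111, -4, 0, 0), (119, 6, 0, 0), (175, 13, 0, 0), (183, 0, 1, 0),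
  (187, -21, -2, 0), (189, 11, 1, 0), (207, 0, 0, 0), (215, -32, -2, 0), (219, 60, 4, 0),
  (231, 17, 1, 0), (311, -50, -4, 0), (315, 69, 5, 0), (343, 0, -2, 5), (347, 240, 20, -15),
  (349, -228, -16, 10), (359, 64, 6, -5), (363, -524, -42, 25), (365, 496, 36, -20),
  (371, 229, 18, -10), (411, -312, -25, 15), (423, -2, -2, 5), (427, 528, 44, -30),
  (455, -64, -4, 0), (603, -793, -61, 35), (619, 1120, 88, -50), (683, -1548, -126, 81),
  (685, 1060, 88, -56), (691, 487, 40, -26), (693, -800, -68, 46), (715, 128, 14, -16),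
  (717, -218, -20, 16), (819, -111, -9, 6), (1365, 3552, 288, -192)]

theorem classCoeff_eq {D : Der} (hD : D ∈ hSp 10) {d : ℚ}
    (hd : classCoeff D 343 = 5 * d - 2 * classCoeff D 183) : ∀ c ∈ classCoord,
      classCoeff D c.1 = c.2.1 * classCoeff D 95 + c.2.2.1 * classCoeff D 183 + c.2.2.2 * d := by
  -- These relations determine the coefficients of 32 classes by those of the other three.
  have r0 := sum_classCoeff_changeOne hD [1, 1, 0, 0, 1, 0, 0, 1, 1, 0, 0, 0]
    [359, 411, 411, 359, 411, 619, 411] (by decide +kernel)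
  have r1 := sum_classCoeff_changeOne hD [1, 1, 1, 1, 1, 0, 0, 0, 0, 0, 0, 0]
    [63, 95, 111, 119, 111, 95, 63] (by decide +kernel)
  have r2 := sum_classCoeff_changeOne hD [1, 1, 1, 0, 1, 0, 0, 0, 0, 0, 1, 0]
    [95, 187, 349, 365, 349, 187, 95] (by decide +kernel)
  have r3 := sum_classCoeff_changeOne hD [1, 1, 1, 0, 0, 1, 0, 0, 0, 1, 0, 0]
    [187, 315, 411, 427, 411, 315, 187] (by decide +kernel)
  have r4 := sum_classCoeff_changeOne hD [1, 1, 1, 0, 0, 0, 1, 0, 1, 0, 0, 0]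
    [215, 343, 359, 455, 359, 343, 215] (by decide +kernel)
  have r5 := sum_classCoeff_changeOne hD [1, 1, 0, 1, 1, 0, 0, 0, 1, 0, 0, 0]
    [119, 315, 347, 411, 411, 347, 315] (by decide +kernel)
  have r6 := sum_classCoeff_changeOne hD [1, 1, 0, 1, 0, 1, 1, 0, 0, 0, 0, 0]
    [111, 111, 215, 363, 619, 363, 215] (by decide +kernel)
  have r7 := sum_classCoeff_changeOne hD [1, 0, 1, 0, 1, 0, 1, 0, 1, 0, 0, 0]
    [343, 349, 349, 343, 683, 1365, 683] (by decide +kernel)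
  have r8 := sum_classCoeff_changeOne hD [1, 0, 1, 0, 1, 0, 1, 0, 0, 1, 0, 0]
    [347, 365, 347, 685, 683, 683, 685] (by decide +kernel)
  have r9 := sum_classCoeff_changeOne hD [1, 0, 1, 0, 1, 0, 0, 1, 0, 1, 0, 0]
    [363, 363, 693, 685, 427, 685, 693] (by decide +kernel)
  have r10 := sum_classCoeff_shuffle hD [1] [1, 1, 1, 1, 0, 0, 0, 0, 0, 0]
    [63, 63, 63, 63, 63, 95, 111, 119, 111, 95, 63] (by decide +kernel)
  have r11 := sum_classCoeff_shuffle hD [1] [1, 1, 1, 0, 0, 0, 1, 0, 0, 0]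
    [119, 119, 119, 119, 183, 215, 231, 231, 215, 183, 119] (by decide +kernel)
  have r12 := sum_classCoeff_shuffle hD [1] [1, 1, 0, 1, 0, 0, 0, 0, 1, 0]
    [189, 189, 189, 187, 187, 349, 365, 349, 187, 187, 189] (by decide +kernel)
  have r13 := sum_classCoeff_shuffle hD [1] [1, 1, 0, 0, 1, 0, 0, 1, 0, 0]
    [219, 219, 219, 347, 411, 411, 427, 411, 411, 347, 219] (by decide +kernel)
  have r14 := sum_classCoeff_shuffle hD [1] [1, 1, 0, 0, 0, 1, 1, 0, 0, 0]
    [231, 231, 231, 359, 423, 455, 455, 455, 423, 359, 231] (by decide +kernel)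
  have r15 := sum_classCoeff_shuffle hD [1] [1, 0, 1, 0, 1, 1, 0, 0, 0, 0]
    [215, 215, 219, 219, 215, 215, 215, 363, 619, 363, 215] (by decide +kernel)
  have r16 := sum_classCoeff_shuffle hD [1] [1, 0, 1, 0, 0, 1, 0, 0, 1, 0]
    [365, 365, 603, 603, 685, 717, 717, 685, 603, 603, 365] (by decide +kernel)
  have r17 := sum_classCoeff_shuffle hD [1] [1, 0, 0, 1, 1, 0, 0, 1, 0, 0]
    [411, 411, 619, 411, 411, 411, 691, 819, 819, 691, 411] (by decide +kernel)
  have r18 := sum_classCoeff_shuffle hD [1] [1, 0, 0, 1, 0, 1, 0, 1, 0, 0]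
    [427, 427, 683, 691, 691, 717, 717, 691, 691, 683, 427] (by decide +kernel)
  have r19 := sum_classCoeff_shuffle hD [1] [0, 1, 0, 1, 0, 1, 0, 1, 0, 0]
    [683, 685, 685, 693, 693, 685, 685, 683, 683, 1365, 683] (by decide +kernel)
  have r20 := sum_classCoeff_changeOne hD [1, 1, 1, 1, 0, 0, 1, 0, 0, 0, 0, 0]
    [95, 111, 207, 215, 219, 187, 111] (by decide +kernel)
  have r21 := sum_classCoeff_changeOne hD [1, 1, 1, 0, 1, 0, 0, 1, 0, 0, 0, 0]
    [111, 183, 215, 359, 363, 365, 183] (by decide +kernel)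
  have r22 := sum_classCoeff_changeOne hD [1, 1, 0, 1, 0, 0, 1, 0, 1, 0, 0, 0]
    [215, 347, 363, 423, 717, 685, 363] (by decide +kernel)
  have r23 := sum_classCoeff_changeOne hD [1, 1, 0, 1, 0, 0, 1, 0, 0, 1, 0, 0]
    [219, 603, 619, 715, 717, 603, 365] (by decide +kernel)
  have r24 := sum_classCoeff_changeOne hD [1, 1, 0, 0, 1, 1, 0, 0, 1, 0, 0, 0]
    [311, 315, 371, 411, 819, 691, 411] (by decide +kernel)
  have r25 := sum_classCoeff_shuffle hD [1] [1, 1, 1, 0, 1, 0, 0, 0, 0, 0]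
    [95, 95, 95, 95, 111, 111, 175, 183, 187, 189, 95] (by decide +kernel)
  have r26 := sum_classCoeff_shuffle hD [1] [1, 1, 1, 0, 0, 1, 0, 0, 0, 0]
    [111, 111, 111, 111, 175, 207, 207, 215, 219, 187, 111] (by decide +kernel)
  have r27 := sum_classCoeff_shuffle hD [1] [1, 1, 0, 1, 1, 0, 0, 0, 0, 0]
    [111, 111, 111, 119, 119, 119, 183, 311, 315, 187, 111] (by decide +kernel)
  have r28 := sum_classCoeff_shuffle hD [1] [1, 1, 0, 1, 0, 1, 0, 0, 0, 0]
    [175, 175, 175, 183, 183, 215, 215, 343, 347, 349, 175] (by decide +kernel)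
  have r29 := sum_classCoeff_shuffle hD [1, 0] [1, 1, 1, 0, 1, 0, 0, 0, 0]
    [187, 183, 175, 111, 111, 95, 95, 95, 95, 95, 183, 175, 111, 111, 95, 95, 95, 95, 95, 175, 111,
    111, 95, 95, 95, 95, 95, 111, 111, 95, 95, 95, 95, 95, 175, 111, 111, 111, 111, 111, 111, 111,
    111, 111, 111, 175, 175, 175, 175, 183, 183, 183, 187, 187, 189] (by decide +kernel)
  have r30 := sum_classCoeff_shuffle hD [1, 0] [1, 1, 0, 1, 0, 1, 0, 0, 0]
    [347, 343, 215, 215, 183, 183, 175, 175, 175, 175, 343, 215, 215, 183, 183, 175, 175, 175, 175,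
    215, 215, 183, 183, 175, 175, 175, 175, 343, 311, 311, 183, 183, 183, 183, 311, 311, 183, 183,
    183, 183, 343, 215, 215, 215, 215, 215, 215, 215, 215, 343, 343, 343, 347, 347, 349]
    (by decide +kernel)
  have r31 := sum_classCoeff_shuffle hD [1, 0] [0, 1, 1, 0, 1, 0, 0, 1, 0]
    [717, 717, 685, 603, 603, 365, 365, 365, 603, 603, 685, 693, 347, 347, 349, 349, 349, 365, 365,
    693, 347, 347, 349, 349, 349, 365, 365, 347, 347, 349, 349, 349, 365, 365, 693, 347, 347, 347,
    603, 603, 347, 347, 347, 603, 603, 693, 693, 685, 685, 685, 717, 717, 717, 717, 685]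
    (by decide +kernel)
  generalize classCoeff D = g at *
  simp only [List.map_cons, List.map_nil, List.sum_cons, List.sum_nil] at *
  have g95 : g 95 = (1 : ℤ) * g 95 + (0 : ℤ) * g 183 + (0 : ℤ) * d := by push_cast; ring
  have g183 : g 183 = (0 : ℤ) * g 95 + (1 : ℤ) * g 183 + (0 : ℤ) * d := by push_cast; ring
  have g343 : g 343 = (0 : ℤ) * g 95 + (-2 : ℤ) * g 183 + (5 : ℤ) * d := by
    push_cast; linear_combination hd
  -- Elimination: the class 111 needs a combination of most of the relations; afterwards each class
  -- follows from at most eight relations and the classes which are already known.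
  have g63 : g 63 = (0 : ℤ) * g 95 + (0 : ℤ) * g 183 + (0 : ℤ) * d := by
    push_cast at *
    linear_combination -1 / 4 * r1 + 1 / 4 * r10
  have g111 : g 111 = (-4 : ℤ) * g 95 + (0 : ℤ) * g 183 + (0 : ℤ) * d := by
    push_cast at *
    linear_combination 1 / 14 * r0 - 1 / 14 * r1 + 3 / 14 * r2 - 1 / 14 * r3 + 1 / 14 * r5
      - 5 / 14 * r6 + 1 / 7 * r7 + 1 / 7 * r8 + 1 / 7 * r9 - 3 / 14 * r12 - 1 / 14 * r13
      + 2 / 7 * r15 - 1 / 7 * r19 - 4 / 7 * r20 - 1 / 7 * r21 + 6 / 7 * r25 + 2 / 7 * r26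
      - 2 / 7 * r28 + 1 / 7 * g63
  have g119 : g 119 = (6 : ℤ) * g 95 + (0 : ℤ) * g 183 + (0 : ℤ) * d := by
    push_cast at *
    linear_combination r1 - 2 * g63 - 2 * g111
  have g175 : g 175 = (13 : ℤ) * g 95 + (0 : ℤ) * g 183 + (0 : ℤ) * d := by
    push_cast at *
    linear_combination -1 / 3 * r2 + 1 / 3 * r12 - 5 / 3 * r25 + 1 / 3 * r29 - 8 / 3 * g111
  have g207 : g 207 = (0 : ℤ) * g 95 + (0 : ℤ) * g 183 + (0 : ℤ) * d := by
    push_cast at *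
    linear_combination -r20 + r26 - 3 * g111 - g175
  have g187 : g 187 = (-21 : ℤ) * g 95 + (-2 : ℤ) * g 183 + (0 : ℤ) * d := by
    push_cast at *
    linear_combination 1 / 2 * r2 - 1 / 2 * r12 + 2 * r25 - 4 * g111 - 2 * g175
  have g189 : g 189 = (11 : ℤ) * g 95 + (1 : ℤ) * g 183 + (0 : ℤ) * d := by
    push_cast at *
    linear_combination r25 - 2 * g111 - g175 - g187
  have g215 : g 215 = (-32 : ℤ) * g 95 + (-2 : ℤ) * g 183 + (0 : ℤ) * d := by
    push_cast at *
    linear_combination -1 / 2 * r6 + 1 / 2 * r15 - r20 + 3 * g111 + g187 + g207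
  have g231 : g 231 = (17 : ℤ) * g 95 + (1 : ℤ) * g 183 + (0 : ℤ) * d := by
    push_cast at *
    linear_combination 1 / 2 * r11 - 5 / 2 * g119 - g215
  have g219 : g 219 = (60 : ℤ) * g 95 + (4 : ℤ) * g 183 + (0 : ℤ) * d := by
    push_cast at *
    linear_combination r20 - 2 * g111 - g187 - g207 - g215
  have g315 : g 315 = (69 : ℤ) * g 95 + (5 : ℤ) * g 183 + (0 : ℤ) * d := by
    push_cast at *
    linear_combination 1 / 4 * r3 + 1 / 4 * r5 - 1 / 4 * r13 - 1 / 4 * g119 - 1 / 2 * g187 + g219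
  have g311 : g 311 = (-50 : ℤ) * g 95 + (-4 : ℤ) * g 183 + (0 : ℤ) * d := by
    push_cast at *
    linear_combination r27 - 4 * g111 - 3 * g119 - g187 - g315
  have g359 : g 359 = (64 : ℤ) * g 95 + (6 : ℤ) * g 183 + (-5 : ℤ) * d := by
    push_cast at *
    linear_combination 1 / 2 * r0 - 1 / 2 * r2 - 1 / 2 * r6 + 1 / 2 * r7 + 1 / 2 * r8 + 1 / 2 * r9
      - 1 / 2 * r13 - 1 / 2 * r19 + g111 + g187 + g215 + 2 * g219 - g343
  have g455 : g 455 = (-64 : ℤ) * g 95 + (-4 : ℤ) * g 183 + (0 : ℤ) * d := by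
    push_cast at *
    linear_combination r4 - 2 * g215 - 2 * g343 - 2 * g359
  have g423 : g 423 = (-2 : ℤ) * g 95 + (-2 : ℤ) * g 183 + (5 : ℤ) * d := by
    push_cast at *
    linear_combination 1 / 2 * r14 - 2 * g231 - g359 - 3 / 2 * g455
  have g347 : g 347 = (240 : ℤ) * g 95 + (20 : ℤ) * g 183 + (-15 : ℤ) * d := by
    push_cast at *
    linear_combination 1 / 8 * r0 - 1 / 4 * r2 - 1 / 4 * r5 - 1 / 8 * r6 + 1 / 4 * r21
      + 1 / 2 * r30 + 1 / 4 * g119 - 6 * g175 + 1 / 2 * g187 - 7 * g215 - 2 * g311 + 1 / 2 * g315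
      - 7 / 2 * g343 - 1 / 2 * g359
  have g411 : g 411 = (-312 : ℤ) * g 95 + (-25 : ℤ) * g 183 + (15 : ℤ) * d := by
    push_cast at *
    linear_combination 1 / 2 * r5 - 1 / 2 * g119 - g315 - g347
  have g619 : g 619 = (1120 : ℤ) * g 95 + (88 : ℤ) * g 183 + (-50 : ℤ) * d := by
    push_cast at *
    linear_combination r0 - 2 * g359 - 4 * g411
  have g427 : g 427 = (528 : ℤ) * g 95 + (44 : ℤ) * g 183 + (-30 : ℤ) * d := by
    push_cast at *
    linear_combination r3 - 2 * g187 - 2 * g315 - 2 * g411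
  have g363 : g 363 = (-524 : ℤ) * g 95 + (-42 : ℤ) * g 183 + (25 : ℤ) * d := by
    push_cast at *
    linear_combination 1 / 2 * r6 - g111 - g215 - 1 / 2 * g619
  have g365 : g 365 = (496 : ℤ) * g 95 + (36 : ℤ) * g 183 + (-20 : ℤ) * d := by
    push_cast at *
    linear_combination r21 - g111 - g215 - g359 - g363
  have g349 : g 349 = (-228 : ℤ) * g 95 + (-16 : ℤ) * g 183 + (10 : ℤ) * d := by
    push_cast at *
    linear_combination 1 / 2 * r2 - g187 - 1 / 2 * g365
  have g371 : g 371 = (229 : ℤ) * g 95 + (18 : ℤ) * g 183 + (-10 : ℤ) * d := by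
    push_cast at *
    linear_combination -1 / 2 * r17 + r24 - g311 - g315 + g411 + 1 / 2 * g619
  have g603 : g 603 = (-793 : ℤ) * g 95 + (-61 : ℤ) * g 183 + (35 : ℤ) * d := by
    push_cast at *
    linear_combination 1 / 4 * r16 - 1 / 2 * r22 + 1 / 2 * g215 + 1 / 2 * g347 + g363
      - 3 / 4 * g365 + 1 / 2 * g423
  have g693 : g 693 = (-800 : ℤ) * g 95 + (-68 : ℤ) * g 183 + (46 : ℤ) * d := by
    push_cast at *
    linear_combination -6 / 5 * r22 + 1 / 5 * r31 + 6 / 5 * g215 - 6 / 5 * g347 - 9 / 5 * g349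
      + 12 / 5 * g363 - 9 / 5 * g365 + 6 / 5 * g423 - 8 / 5 * g603
  have g685 : g 685 = (1060 : ℤ) * g 95 + (88 : ℤ) * g 183 + (-56 : ℤ) * d := by
    push_cast at *
    linear_combination 1 / 2 * r9 - g363 - 1 / 2 * g427 - g693
  have g683 : g 683 = (-1548 : ℤ) * g 95 + (-126 : ℤ) * g 183 + (81 : ℤ) * d := by
    push_cast at *
    linear_combination 1 / 2 * r8 - g347 - 1 / 2 * g365 - g685
  have g1365 : g 1365 = (3552 : ℤ) * g 95 + (288 : ℤ) * g 183 + (-192 : ℤ) * d := by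
    push_cast at *
    linear_combination r7 - 2 * g343 - 2 * g349 - 2 * g683
  have g717 : g 717 = (-218 : ℤ) * g 95 + (-20 : ℤ) * g 183 + (16 : ℤ) * d := by
    push_cast at *
    linear_combination 1 / 2 * r16 - 3 / 2 * g365 - 2 * g603 - g685
  have g691 : g 691 = (487 : ℤ) * g 95 + (40 : ℤ) * g 183 + (-26 : ℤ) * d := by
    push_cast at *
    linear_combination 1 / 4 * r18 - 3 / 4 * g427 - 1 / 2 * g683 - 1 / 2 * g717
  have g819 : g 819 = (-111 : ℤ) * g 95 + (-9 : ℤ) * g 183 + (6 : ℤ) * d := by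
    push_cast at *
    linear_combination 1 / 2 * r17 - 3 * g411 - 1 / 2 * g619 - g691
  have g715 : g 715 = (128 : ℤ) * g 95 + (14 : ℤ) * g 183 + (-16 : ℤ) * d := by
    push_cast at *
    linear_combination r23 - g219 - g365 - 2 * g603 - g619 - g717
  simp only [classCoord, List.forall_mem_cons]
  exact ⟨g63, g95, g111, g119, g175, g183, g187, g189, g207, g215, g219, g231, g311, g315, g343,
    g347, g349, g359, g363, g365, g371, g411, g423, g427, g455, g603, g619, g683, g685, g691, g693,
    g715, g717, g819, g1365, fun _ h => absurd h List.not_mem_nil⟩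

/-! ### The invariants of degree ten form a space of dimension three -/

/-- The coordinates of the coefficient of a word with respect to the three parameters of an
invariant derivation of degree ten. -/
def wordCoord (w : List (Fin 2)) : ℤ × ℤ × ℤ :=
  if w.length = 12 ∧ w.count 1 = 6 then (classCoord.lookup (classCode w)).getD 0 else 0

/-- The three parameters of an invariant derivation of degree ten. The denominator makes all
coefficients integral combinations of the parameters. -/
def param : Der →ₗ[ℚ] Fin 3 → ℚ :=
  LinearMap.pi ![coeff (ofCode 12 95), coeff (ofCode 12 183),
    (5 : ℚ)⁻¹ • (coeff (ofCode 12 343) + (2 : ℚ) • coeff (ofCode 12 183))] ∘ₗ derToTensor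

/-- The linear form on parameters with given integral coordinates. -/
def coordEval (p : Fin 3 → ℚ) : ℤ × ℤ × ℤ →+ ℚ where
  toFun z := z.1 * p 0 + z.2.1 * p 1 + z.2.2 * p 2
  map_zero' := by simp
  map_add' z z' := by
    simp only [Prod.fst_add, Prod.snd_add]
    push_cast
    ring

theorem coordEval_apply (p : Fin 3 → ℚ) (z : ℤ × ℤ × ℤ) :
    coordEval p z = z.1 * p 0 + z.2.1 * p 1 + z.2.2 * p 2 := rfl

theorem classCode_mem {w : List (Fin 2)} (hl : w.length = 12) (hw : w.count 1 = 6) :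
    classCode w ∈ classCoord.map Prod.fst := by
  have key : ∀ m < 64, ∀ n < 64, (ofCode 12 (64 * m + n)).count 1 = 6 →
      classCode (ofCode 12 (64 * m + n)) ∈ classCoord.map Prod.fst := by decide +kernel
  have hlt : code w < 4096 := by simpa [hl] using code_lt w
  have h := key (code w / 64) (by omega) (code w % 64) (by omega)
  rw [Nat.div_add_mod, ← hl, ofCode_code] at h
  exact h hw

theorem coeff_eq_coordEval {D : Der} (hD : D ∈ hSp 10) (w : List (Fin 2)) :
    coeff w (derToTensor D) = coordEval (param D) (wordCoord w) := by
  rw [wordCoord]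
  split_ifs with h
  · obtain ⟨c, hc, hcw⟩ := List.mem_map.1 (classCode_mem h.1 h.2)
    obtain ⟨z, hz⟩ : ∃ z, classCoord.lookup (classCode w) = some z := by
      rw [← Option.isSome_iff_exists, List.lookup_isSome_iff]
      exact ⟨c, hc, by simpa using hcw.symm⟩
    have hmem : (classCode w, z) ∈ classCoord := by
      obtain ⟨l₁, l₂, hl, -⟩ := List.lookup_eq_some_iff.1 hz
      rw [hl]
      simp
    have e := classCoeff_eq hD (d := param D 2) (by simp [param, classCoeff]; ring) _ hmem
    rw [coeff_eq_classCoeff hD h.1 h.2, e, hz]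
    rfl
  · rw [map_zero]
    by_cases hl : w.length = 12
    · refine coeff_eq_zero_of_mem_hSp hD ?_
      have := count_zero_add_count_one w
      omega
    · exact coeff_derToTensor_of_length_ne hD.1 hl

theorem eq_zero_of_param_eq_zero {D : Der} (hD : D ∈ hSp 10) (h : param D = 0) : D = 0 := by
  refine eq_zero_of_derToTensor_eq_zero hD.1 (ext_coeff fun w => ?_)
  rw [coeff_eq_coordEval hD, h, coordEval_apply, map_zero]
  simp

theorem param_invariantDer (j n : ℕ) {a b c : ℤ}
    (h : [95, 183, 343].map (fun k => invariantCoeff (ofCode 12 k).tail j n) = [a, b, c]) :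
    param (invariantDer j n) = ![(a : ℚ), b, (c + 2 * b) / 5] := by
  simp only [List.map_cons, List.map_nil, List.cons.injEq, and_true] at h
  obtain ⟨h1, h2, h3⟩ := h
  have ha : coeff (ofCode 12 95) (derToTensor (invariantDer j n)) = a :=
    h1 ▸ coeff_invariantDer (ofCode 12 95).tail j n
  have hb : coeff (ofCode 12 183) (derToTensor (invariantDer j n)) = b :=
    h2 ▸ coeff_invariantDer (ofCode 12 183).tail j n
  have hc : coeff (ofCode 12 343) (derToTensor (invariantDer j n)) = c :=
    h3 ▸ coeff_invariantDer (ofCode 12 343).tail j n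
  ext i
  fin_cases i <;> simp [param, ha, hb, hc]
  ring

theorem param_invariantDer_three_one : param (invariantDer 3 1) = ![6, -102, -46] := by
  rw [param_invariantDer 3 1 (a := 6) (b := -102) (c := -26) (by decide +kernel)]
  norm_num

theorem param_invariantDer_two_two : param (invariantDer 2 2) = ![0, -4, -6] := by
  rw [param_invariantDer 2 2 (a := 0) (b := -4) (c := -22) (by decide +kernel)]
  norm_num

theorem param_invariantDer_one_three : param (invariantDer 1 3) = ![0, 0, 2] := by
  rw [param_invariantDer 1 3 (a := 0) (b := 0) (c := 10) (by decide +kernel)]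
  norm_num

/-- An invariant derivation of degree ten is determined by its parameters, which are arbitrary. -/
def paramEquiv : hSp 10 ≃ₗ[ℚ] (Fin 3 → ℚ) :=
  LinearEquiv.ofBijective (param.domRestrict (hSp 10)) <| by
    constructor
    · rw [← LinearMap.ker_eq_bot, LinearMap.ker_eq_bot']
      exact fun D hD => Subtype.ext (eq_zero_of_param_eq_zero D.2 hD)
    · intro p
      -- The parameters of the three derivations form a triangular matrix, inverted here.
      refine ⟨(p 0 / 6) • ⟨invariantDer 3 1, invariantDer_mem_hSp 3 1⟩ +
        (-(p 1 + 17 * p 0) / 4) • ⟨invariantDer 2 2, invariantDer_mem_hSp 2 2⟩ +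
        ((p 2 + 46 / 6 * p 0 - 6 / 4 * (p 1 + 17 * p 0)) / 2) •
          ⟨invariantDer 1 3, invariantDer_mem_hSp 1 3⟩, ?_⟩
      change param (_ • invariantDer 3 1 + _ • invariantDer 2 2 + _ • invariantDer 1 3) = p
      rw [map_add, map_add, map_smul, map_smul, map_smul, param_invariantDer_three_one,
        param_invariantDer_two_two, param_invariantDer_one_three]
      ext i
      fin_cases i <;> simp <;> ring

theorem paramEquiv_apply (D : hSp 10) : paramEquiv D = param D := rfl

theorem finrank_hSp_ten : Module.finrank ℚ (hSp 10) = 3 := by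
  rw [paramEquiv.finrank_eq, Module.finrank_fin_fun]

/-! ### The Enomoto–Satoh map on brackets with `ε₄` -/

theorem coeff_mul_of_homogeneous {m : ℕ} {a : T} (ha : ∀ u : List (Fin 2), u.length ≠ m →
    coeff u a = 0) (b : T) (w : List (Fin 2)) :
    coeff w (a * b) = coeff (w.take m) a * coeff (w.drop m) b := by
  induction m generalizing a w with
  | zero =>
    have h : a = coeff [] a • (1 : T) := by
      apply ext_coeff
      intro u
      rw [map_smul, coeff_one]
      split_ifs with hu
      · simp [hu]
      · rw [smul_zero]
        exact ha u (by simpa using hu)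
    rw [h]
    simp [coeff_one]
  | succ m ih =>
    have h0 : coeff [] a = 0 := ha [] (by simp)
    have hs : ∀ i (u : List (Fin 2)), u.length ≠ m → coeff u (strip i a) = 0 := by
      intro i u hu
      rw [coeff_strip]
      exact ha _ (by simpa using hu)
    cases w with
    | nil =>
      conv_lhs => rw [← sum_ι_mul_strip a h0]
      rw [add_mul, mul_assoc, mul_assoc, map_add, coeff_nil_ι_mul, coeff_nil_ι_mul]
      simp [h0]
    | cons j w =>
      conv_lhs => rw [← sum_ι_mul_strip a h0]
      rw [add_mul, mul_assoc, mul_assoc, map_add, coeff_cons_ι_mul, coeff_cons_ι_mul,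
        ih (hs 0), ih (hs 1), coeff_strip, coeff_strip, List.take_succ_cons, List.drop_succ_cons]
      fin_cases j <;> simp

/-- Coefficients of the image of a tensor under a derivation of the tensor algebra with values of
degree `m`: a factor of length `m` is replaced by a letter at every position. -/
theorem coeff_derT {m : ℕ} {d : Fin 2 → T} (hd : ∀ i (u : List (Fin 2)), u.length ≠ m →
    coeff u (d i) = 0) (hm : m ≠ 0) (w : List (Fin 2)) (t : T) :
    coeff w (derT d t) = ∑ k ∈ Finset.range w.length, ∑ i,
      coeff ((w.drop k).take m) (d i) * coeff (w.take k ++ i :: w.drop (k + m)) t := by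
  have ht : ∀ t : T, t = coeff [] t • (1 : T) + ∑ i, FreeAlgebra.ι ℚ i * strip i t := by
    intro t
    induction t using word_induction with
    | hw w =>
      cases w with
      | nil => simp [coeff_one, strip_one]
      | cons i w =>
        rw [word_cons, coeff_nil_ι_mul]
        fin_cases i <;> simp [strip_ι_mul]
    | hadd s t hs ht =>
      conv_lhs => rw [hs, ht]
      simp only [map_add, add_smul, mul_add, Finset.sum_add_distrib]
      abel
    | hsmul c t ht =>
      conv_lhs => rw [ht]
      simp only [map_smul, smul_add, Finset.smul_sum, mul_smul_comm, smul_smul, smul_eq_mul]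
  have hder : derT d t = ∑ i, (d i * strip i t + FreeAlgebra.ι ℚ i * derT d (strip i t)) := by
    conv_lhs => rw [ht t]
    rw [map_add, map_smul, derT_one, smul_zero, zero_add, map_sum]
    simp only [derT_ι_mul]
  induction w generalizing t with
  | nil =>
    rw [hder, map_sum]
    refine Finset.sum_eq_zero fun i _ => ?_
    rw [map_add, coeff_mul_of_homogeneous (hd i), coeff_nil_ι_mul, List.take_nil,
      hd i [] (by simpa using hm.symm), zero_mul, zero_add]
  | cons j w ih =>
    have ih' := fun t => ih t (by
      conv_lhs => rw [ht t]
      rw [map_add, map_smul, derT_one, smul_zero, zero_add, map_sum]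
      simp only [derT_ι_mul])
    rw [List.length_cons, Finset.sum_range_succ', hder, map_sum]
    simp only [map_add, coeff_mul_of_homogeneous (hd _), coeff_cons_ι_mul, Finset.sum_add_distrib,
      coeff_strip]
    rw [add_comm]
    congr 1
    · rw [Finset.sum_ite_eq' Finset.univ j]
      simp [ih', coeff_strip, Nat.add_right_comm _ 1 m]
    · simp

/-- The coefficients of `ε₄(x)` and `ε₄(y)`. -/
def epsFourCoeff (i : Fin 2) (w : List (Fin 2)) : ℤ :=
  if i = 0 then adCoeff [0, 0, 0, 0] w else 2 * adCoeff [1, 0, 0, 0] w - adCoeff [0, 1, 0, 0] w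

theorem coeff_derVal_eps_two (i : Fin 2) (w : List (Fin 2)) :
    coeff w (derVal (eps 2) i) = epsFourCoeff i w := by
  have had : ∀ (i : Fin 2) (p : List (Fin 2)),
      ⁅FreeLieAlgebra.of ℚ i, adT (word p) y⁆ = adT (word (i :: p)) y := by
    intro i p
    rw [word_cons, map_mul, Module.End.mul_apply, adT_ι]
  have hy : ∀ p : List (Fin 2), ⁅y, adT (word p) y⁆ = adT (word (1 :: p)) y := had 1
  have hadx : ∀ j, adx j = adT (word (List.replicate j 0)) y := by
    intro j
    induction j with
    | zero => simp [adx_zero]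
    | succ j ih => rw [adx_succ, ih, x, had, List.replicate_succ]
  fin_cases i
  · change coeff w (lieToTensor (eps 2 x)) = _
    rw [eps_x, hadx, coeff_adT_word_y]
    rfl
  · change coeff w (lieToTensor (eps 2 y)) = _
    have h : eps 2 y = (2 : ℚ) • adT (word [1, 0, 0, 0]) y - adT (word [0, 1, 0, 0]) y := by
      rw [eps_y, Finset.sum_range_succ, Finset.sum_range_one]
      have h1 : ⁅adx 0, adx 3⁆ = adT (word [1, 0, 0, 0]) y := by
        rw [hadx 3, adx_zero, hy]
        rfl
      have h2 : ⁅adx 1, adx 2⁆ =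
          adT (word [0, 1, 0, 0]) y - adT (word [1, 0, 0, 0]) y := by
        rw [hadx 2, adx_succ, adx_zero, lie_lie, x, hy, had, had, hy]
        rfl
      rw [h1, h2]
      module
    rw [h, map_sub, map_sub, map_smul, map_smul, coeff_adT_word_y, coeff_adT_word_y,
      epsFourCoeff]
    simp

theorem derVal_eps_two_homogeneous (i : Fin 2) (u : List (Fin 2)) (hu : u.length ≠ 5) :
    coeff u (derVal (eps 2) i) = 0 :=
  coeff_lieToTensor_of_length_ne ((eps_mem_hDeg 2).2 i) hu

/-- The second cocycle term of `ES ⁅ε₄, D⁆` vanishes since `ES ε₄ = 0`. -/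
theorem ES_lie_eps_two (D : Der) : ES ⁅eps 2, D⁆ =
    cyclicSum (derT (derVal (eps 2)) (contract12 (derToTensor D))) := by
  have h : cyclicSum (contract12 (derToTensor (eps 2))) = 0 := ES_eps one_le_two
  rw [ES_lie, cyclicSum_derT (derVal D) h, sub_zero]

/-- The coordinates of the coefficients of the contraction of an invariant derivation of degree
ten. -/
def contractCoord (w : List (Fin 2)) : ℤ × ℤ × ℤ :=
  wordCoord (0 :: 1 :: w) - wordCoord (1 :: 0 :: w)

theorem coeff_contract12_eq_coordEval {D : Der} (hD : D ∈ hSp 10) (w : List (Fin 2)) :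
    coeff w (contract12 (derToTensor D)) = coordEval (param D) (contractCoord w) := by
  rw [coeff_contract12, coeff_eq_coordEval hD, coeff_eq_coordEval hD, contractCoord, map_sub]

/-- The coordinates of the coefficients of `ES ⁅ε₄, D⁆`, for an invariant derivation `D` of degree
ten. -/
def bracketCoord (w : List (Fin 2)) : ℤ × ℤ × ℤ :=
  ∑ r ∈ Finset.range w.length, ∑ k ∈ Finset.range (w.rotate r).length, ∑ i,
    epsFourCoeff i (((w.rotate r).drop k).take 5) •
      contractCoord ((w.rotate r).take k ++ i :: (w.rotate r).drop (k + 5))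

theorem coeff_ES_lie_eps_two {D : Der} (hD : D ∈ hSp 10) (w : List (Fin 2)) :
    coeff w (ES ⁅eps 2, D⁆) = coordEval (param D) (bracketCoord w) := by
  simp only [ES_lie_eps_two, coeff_cyclicSum, coeff_derT derVal_eps_two_homogeneous
    (by decide : 5 ≠ 0), coeff_derVal_eps_two, coeff_contract12_eq_coordEval hD, bracketCoord,
    map_sum, map_zsmul, ← zsmul_eq_mul]

/-- The symplectic element `x ⊗ y - y ⊗ x` of the tensor algebra. -/
def omegaT : T := lieToTensor ⁅x, y⁆

theorem omegaT_eq : omegaT = FreeAlgebra.ι ℚ 0 * FreeAlgebra.ι ℚ 1 -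
    FreeAlgebra.ι ℚ 1 * FreeAlgebra.ι ℚ 0 := by
  rw [omegaT, lieToTensor_lie, x, y, lieToTensor_of, lieToTensor_of]

/-- The coefficients of the powers of the symplectic element. -/
def omegaCoeff : List (Fin 2) → ℤ
  | i :: j :: w => if i = j then 0 else if i = 0 then omegaCoeff w else -omegaCoeff w
  | [_] => 0
  | [] => 1

theorem coeff_omegaT_pow (n : ℕ) (w : List (Fin 2)) :
    coeff w (omegaT ^ n) = if w.length = 2 * n then (omegaCoeff w : ℚ) else 0 := by
  induction n generalizing w with
  | zero =>
    rw [pow_zero, coeff_one, Nat.mul_zero]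
    cases w <;> simp [omegaCoeff]
  | succ n ih =>
    rw [pow_succ', omegaT_eq, sub_mul, mul_assoc, mul_assoc, map_sub, ← omegaT_eq]
    match w with
    | [] => simp [coeff_nil_ι_mul]
    | [i] => simp [coeff_nil_ι_mul, coeff_cons_ι_mul]; omega
    | i :: j :: w =>
      simp only [coeff_cons_ι_mul, ih, List.length_cons, omegaCoeff, Nat.mul_succ,
        Nat.add_right_cancel_iff]
      by_cases hw : w.length = 2 * n <;> fin_cases i <;> fin_cases j <;> simp [hw]

theorem derT_omegaT_pow {D : Der} (hD : D ⁅x, y⁆ = 0) (n : ℕ) :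
    derT (derVal D) (omegaT ^ n) = 0 := by
  induction n with
  | zero => rw [pow_zero, derT_one]
  | succ n ih =>
    rw [pow_succ, derT_mul, ih, zero_mul, zero_add, omegaT, ← lieToTensor_der, hD, map_zero,
      mul_zero]

theorem omegaCoeff_eq_zero : ∀ {w : List (Fin 2)}, w.count 0 ≠ w.count 1 → omegaCoeff w = 0
  | [], h => absurd rfl h
  | [_], _ => rfl
  | i :: j :: w, h => by
    rw [omegaCoeff]
    split_ifs with h1 h2
    · rfl
    all_goals
      have h3 : w.count 0 ≠ w.count 1 := by
        intro e
        apply h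
        fin_cases i <;> fin_cases j <;> simp_all
      simp [omegaCoeff_eq_zero h3]

theorem contractCoord_eq_zero {w : List (Fin 2)} (h : ¬(w.length = 10 ∧ w.count 1 = 5)) :
    contractCoord w = 0 := by
  simp [contractCoord, wordCoord, h]

/-- In the direction `(1, -7, -3)` of the parameters, the cyclic sum of the contraction is `48`
times that of the fifth power of the symplectic element. -/
theorem sum_contractCoord_rotate {w : List (Fin 2)} (hw : w.length = 10) :
    (fun z : ℤ × ℤ × ℤ => z.1 - 7 * z.2.1 - 3 * z.2.2)
      (∑ r ∈ Finset.range w.length, contractCoord (w.rotate r)) =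
        48 * ∑ r ∈ Finset.range w.length, omegaCoeff (w.rotate r) := by
  have h01 := count_zero_add_count_one w
  by_cases h5 : w.count 1 = 5
  · -- By invariance under rotations it suffices to consider words beginning with `x`.
    have key : ∀ m < 16, ∀ n < 32, (0 :: ofCode 9 (32 * m + n)).count 1 = 5 →
        (fun z : ℤ × ℤ × ℤ => z.1 - 7 * z.2.1 - 3 * z.2.2)
          (∑ r ∈ Finset.range 10, contractCoord ((0 :: ofCode 9 (32 * m + n)).rotate r)) =
            48 * ∑ r ∈ Finset.range 10, omegaCoeff ((0 :: ofCode 9 (32 * m + n)).rotate r) := by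
      decide +kernel
    obtain ⟨k, u, hk, hc⟩ := exists_rotate_eq_cons (i := 0) (w := w)
      (List.count_pos_iff.1 (by omega))
    have hl : u.length = 9 := by
      have := congrArg List.length hk
      rw [List.length_rotate, List.length_cons] at this
      omega
    have hlt : code u < 512 := by simpa [hl] using code_lt u
    have h := key (code u / 32) (by omega) (code u % 32) (by omega)
    rw [Nat.div_add_mod, ← hl, ofCode_code, ← hc, ← hk, ← hw, sum_rotate_rotate,
      sum_rotate_rotate] at h
    exact h h5
  · rw [Finset.sum_eq_zero fun r _ => contractCoord_eq_zero ?_,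
      Finset.sum_eq_zero fun r _ => omegaCoeff_eq_zero ?_]
    · rfl
    · rw [(w.rotate_perm r).count_eq, (w.rotate_perm r).count_eq]
      omega
    · rw [(w.rotate_perm r).count_eq]
      omega

/-- The contraction of `D` agrees with a multiple of the fifth power of the symplectic element up to
cyclic permutations, and `ε₄` kills the symplectic element. -/
theorem ES_lie_eps_two_eq_zero {D : Der} (hD : D ∈ hSp 10) {t : ℚ}
    (h : param D = t • ![1, -7, -3]) : ES ⁅eps 2, D⁆ = 0 := by
  have hcyc : cyclicSum (contract12 (derToTensor D) - (48 * t) • omegaT ^ 5) = 0 := by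
    apply ext_coeff
    intro w
    rw [map_zero, coeff_cyclicSum]
    simp only [map_sub, map_smul, coeff_omegaT_pow, List.length_rotate,
      coeff_contract12_eq_coordEval hD, Finset.sum_sub_distrib, ← Finset.smul_sum]
    by_cases hw : w.length = 10
    · have e := congrArg (Int.cast : ℤ → ℚ) (sum_contractCoord_rotate hw)
      push_cast at e
      simp only [if_pos hw, ← map_sum]
      rw [coordEval_apply, h]
      simp only [Pi.smul_apply, Matrix.cons_val, smul_eq_mul]
      linear_combination t * e
    · refine (sub_eq_zero.2 ?_)
      rw [Finset.sum_eq_zero fun r _ => ?_, Finset.sum_eq_zero fun r _ => ?_, smul_zero]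
      · rw [if_neg (by omega)]
      · rw [contractCoord_eq_zero (by simp [hw]), map_zero]
  have e := cyclicSum_derT (derVal (eps 2)) hcyc
  rwa [map_sub, map_smul, derT_omegaT_pow (eps_omega 2), smul_zero, sub_zero,
    ← ES_lie_eps_two] at e

theorem param_of_ES_lie_eps_two_eq_zero {D : Der} (hD : D ∈ hSp 10) (h : ES ⁅eps 2, D⁆ = 0) :
    param D = param D 0 • ![1, -7, -3] := by
  -- These two words give independent linear conditions on the three parameters.
  have h1 := coeff_ES_lie_eps_two hD [0, 0, 0, 0, 0, 0, 1, 1, 0, 0, 1, 1, 1, 1]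
  have h2 := coeff_ES_lie_eps_two hD [0, 0, 0, 0, 0, 1, 0, 1, 1, 0, 0, 1, 1, 1]
  rw [h, map_zero, show bracketCoord [0, 0, 0, 0, 0, 0, 1, 1, 0, 0, 1, 1, 1, 1] = (7, 1, 0) by
    decide +kernel, coordEval_apply] at h1
  rw [h, map_zero, show bracketCoord [0, 0, 0, 0, 0, 1, 0, 1, 1, 0, 0, 1, 1, 1] = (-1, 2, -5) by
    decide +kernel, coordEval_apply] at h2
  push_cast at h1 h2
  ext i
  fin_cases i <;> simp <;> linarith

theorem ES_lie_eps_two_eq_zero_iff {D : Der} (hD : D ∈ hSp 10) :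
    ES ⁅eps 2, D⁆ = 0 ↔ ∃ t : ℚ, param D = t • ![1, -7, -3] :=
  ⟨fun h => ⟨_, param_of_ES_lie_eps_two_eq_zero hD h⟩, fun ⟨_, h⟩ => ES_lie_eps_two_eq_zero hD h⟩

theorem finrank_ker_ES_lie_eps_two : Module.finrank ℚ
    (LinearMap.ker ((ES ∘ₗ (LieAlgebra.ad ℚ Der (eps 2) : Der →ₗ[ℚ] Der)).domRestrict
      (hSp 10))) = 1 := by
  have hker : LinearMap.ker ((ES ∘ₗ (LieAlgebra.ad ℚ Der (eps 2) : Der →ₗ[ℚ] Der)).domRestrict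
      (hSp 10)) = Submodule.span ℚ {paramEquiv.symm ![1, -7, -3]} := by
    ext D
    rw [LinearMap.mem_ker, Submodule.mem_span_singleton]
    refine (ES_lie_eps_two_eq_zero_iff D.2).trans (exists_congr fun t => ?_)
    rw [← paramEquiv_apply, ← LinearEquiv.eq_symm_apply, map_smul, eq_comm]
  rw [hker, finrank_span_singleton]
  intro h
  have := congrFun ((LinearEquiv.map_eq_zero_iff _).1 h) 0
  simp at this

theorem ES_lie_eps_two_eq_zero_iff_exists_smul {σ v : Der} (hσ : σ ∈ hSp 10) (hσ0 : σ ≠ 0)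
    (hES : ES ⁅eps 2, σ⁆ = 0) (hv : v ∈ hSp 10) : ES ⁅eps 2, v⁆ = 0 ↔ ∃ c : ℚ, v = c • σ := by
  constructor
  · intro h
    obtain ⟨s, hs⟩ := (ES_lie_eps_two_eq_zero_iff hσ).1 hES
    obtain ⟨t, ht⟩ := (ES_lie_eps_two_eq_zero_iff hv).1 h
    have hs0 : s ≠ 0 := by
      rintro rfl
      exact hσ0 (eq_zero_of_param_eq_zero hσ (by rw [hs, zero_smul]))
    refine ⟨t / s, sub_eq_zero.1 (eq_zero_of_param_eq_zero
      (sub_mem hv (Submodule.smul_mem _ _ hσ)) ?_)⟩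
    rw [map_sub, map_smul, hs, ht, smul_smul, div_mul_cancel₀ _ hs0, sub_self]
  · rintro ⟨c, rfl⟩
    rw [lie_smul, map_smul, hES, smul_zero]

end GenusOne

end

open GenusOne in
theorem theorem8 :
    -- (i) the summand `[2k-2]_Sp` of `𝔥_{1,1}(2k)`, with highest weight vector `ε_{2k}`
    (∀ k : ℕ, 1 ≤ k →
      (∃! V : Subrepresentation spRep, IsSpSummand (2 * k) (2 * k - 2) V) ∧
      IsHighestWeightVector (2 * k - 2) (eps k) ∧
      ∀ V : Subrepresentation spRep, IsSpSummand (2 * k) (2 * k - 2) V →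
        eps k ∈ V ∧ V.toSubmodule ≤ LinearMap.ker ES) ∧
    (∀ ε₀ ∈ hDeg 0, ∀ u ∈ uLie ε₀, ES u = 0) ∧
    -- (ii) the dimension of the kernel, `ε₄ = eps 2`
    Module.finrank ℚ (hSp 10) = 3 ∧
    Module.finrank ℚ
      (LinearMap.ker ((ES ∘ₗ (LieAlgebra.ad ℚ Der (eps 2) : Der →ₗ[ℚ] Der)).domRestrict
        (hSp 10))) = 1 ∧
    -- the kernel is spanned by any nonzero invariant element of degree 10 whose bracket with `ε₄`
    -- lies in `𝔲`, in particular by any such element which normalizes `𝔲`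
    (∀ ε₀ ∈ hDeg 0, ∀ σ ∈ hSp 10, σ ≠ 0 → ⁅eps 2, σ⁆ ∈ uLie ε₀ →
      ∀ v ∈ hSp 10, ES ⁅eps 2, v⁆ = 0 ↔ ∃ c : ℚ, v = c • σ) := by
  refine ⟨fun k hk => ⟨⟨epsModule k, isSpSummand_epsModule hk, fun V hV => eq_epsModule hk hV⟩,
    isHighestWeightVector_eps hk, fun V hV => ?_⟩, fun ε₀ h₀ u hu => ES_eq_zero_of_mem_uLie h₀ hu,
    finrank_hSp_ten, finrank_ker_ES_lie_eps_two, fun ε₀ h₀ σ hσ hσ0 hu v hv =>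
      ES_lie_eps_two_eq_zero_iff_exists_smul hσ hσ0 (ES_eq_zero_of_mem_uLie h₀ hu) hv⟩
  rw [eq_epsModule hk hV]
  exact ⟨eps_mem_epsModule k, epsModule_le_ker_ES hk⟩
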